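/- **Setting.** We observe $n$ undirected binary networks $X_1,\dots,X_n$ on $d$ common nodes (self-loops allowed), recorded by $X_i(\omega)$, $\omega\in\mathcal J_d=\{(j_1,j_2):1\le j_1\le j_2\le d\}$. All $X_i(\omega)$ are independent and $X_i(\omega)\sim\mathrm{Bernoulli}(P_{z_i^*}(\omega))$, where $z^*\in\{1,2\}^n$ and, for $m\in\{1,2\}$, $P_m(j_1,j_2)=B_m(\sigma_m(j_1),\sigma_m(j_2))$ with $\sigma_m:[d]\to[K]$ and $B_m\in(0,1)^{K\times K}$ symmetric. Put $p_m=\min_kB_m(k,k)$ and $q_m=\max_{k\ne l}B_m(k,l)$ (so $K\ge2$). For absolute constants $\alpha,\beta,\gamma\ge1$ and $p_0<1$, assume, for all $m,m_1,m_2,k,l$: $\#\{i:z_i^*=m\}\in[\frac n{2\alpha},\frac{\alpha n}2]$; $\#\{j:\sigma_m(j)=k\}\in[\frac d{\beta K},\frac{\beta d}K]$; $p_m\ge\gamma^{-1}\max_kB_m(k,k)$; $q_m\le\gamma\min_{k\ne l}B_m(k,l)$; the ratios $p_{m_1}/p_{m_2}$, $q_{m_1}/q_{m_2}$, $p_{m_1}/q_{m_2}$,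 $q_{m_1}/p_{m_2}$ are at most $\gamma$; and all entries $B_m(k,l)$ are at most $p_0$. Let $$I^*=-2\sum_{\omega\in\mathcal J_d}\log\Big(\sqrt{P_1(\omega)P_2(\omega)}+\sqrt{(1-P_1(\omega))(1-P_2(\omega))}\Big),$$ $a_m=p_m(n\wedge d)d$, $b_m=q_m(n\wedge d)d$, $\bar a=a_1\vee a_2$, $\underline a=a_1\wedge a_2$. For label vectors $z,z'$ of the same length $N$ let $h(z,z')=\min_\pi\frac1N\#\{i:z_i\ne\pi(z_i')\}$, the minimum over all permutations $\pi$ of the labels. **Algorithm.** For each $i$, an initialization algorithm, applied to $\{X_j\}_{j\ne i}$ (and possibly an independent random seed), returns labels $\tilde z^{(-i)}_j\in\{1,2\}$, $j\ne i$, and $\tilde\sigma^{(-i)}_1,\tilde\sigma^{(-i)}_2:[d]\to[K]$. Let $\hat B^{(-i)}_m(k,l)$ be the frequency of edges, over the layers $j\ne i$ with $\tilde z_j^{(-i)}=m$ and the $\omega=(j_1,j_2)\in\mathcal J_d$ with $\{\tilde\sigma_m^{(-i)}(j_1),\tilde\sigma_m^{(-i)}(j_2)\}=\{k,l\}$, and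 let $\hat P_m^{(-i)}(j_1,j_2)=\hat B_m^{(-i)}(\tilde\sigma_m^{(-i)}(j_1),\tilde\sigma_m^{(-i)}(j_2))$. Let $\hat z^{(-i)}_j=\tilde z^{(-i)}_j$ for $j\ne i$ and $$\hat z_i^{(-i)}\in\arg\max_{m\in\{1,2\}}\sum_{\omega\in\mathcal J_d}\Big[X_i(\omega)\log\hat P^{(-i)}_m(\omega)+(1-X_i(\omega))\log\big(1-\hat P^{(-i)}_m(\omega)\big)\Big].$$ The output $\hat z$ is $\hat z_1=\hat z_1^{(-1)}$ and $\hat z_i\in\arg\max_{m\in\{1,2\}}\#\{j:\hat z_j^{(-1)}=m,\ \hat z^{(-i)}_j=\hat z^{(-i)}_i\}$ for $i\ge2$. Ties are broken arbitrarily. **Theorem.** Consider a sequence of such models with $n,d\to\infty$ ($K$ and all parameters may vary along the sequence). Let $G$ be the event that for every $i\in[n]$ there is a permutation $\pi$ of $\{1,2\}$ with $$\frac1n\#\{j\ne i:\tilde z^{(-i)}_j\ne\pi(z_j^*)\}\le\eta_z\quad\text{and}\quad h\big(\tilde\sigma^{(-i)}_{\pi(m)},\sigma_m\big)\le\eta_\sigma\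 \text{ for } m=1,2 .$$ Suppose that $\mathbb P(G)\ge1-C_1n^{-2}$ for an absolute constant $C_1$, that $\eta_\sigma=O\big(\min_m(a_m-b_m)/(a_mK)\big)$, $$\eta_\sigma\log\frac1{\eta_\sigma}=o\Big(\frac{I^{*2}}{\bar aK^2(1+d/n)^2}\Big),\qquad\eta_\sigma\vee\eta_z=o\Big(\frac{I^*}{\bar aK^2(1+d/n)}\Big),$$ that $\underline a\ge C$ for an absolute constant $C>0$, that $K^2\log n=o(n)$, and that $I^*\to\infty$. Then there is a sequence $\rho=o(1)$ such that: 1. for every $\epsilon\in(0,1)$, for all sufficiently large indices of the sequence, conditionally on $G$, with probability at least $1-\exp(-(I^*)^{1-\epsilon})$, $$h(\hat z,z^*)\le\exp\Big(-(1-\rho)\frac{I^*}2\Big);$$ 2. for every constant $C'>0$, $\ \mathbb E\big[h(\hat z,z^*)\mid G\big]\le\exp\big(-(1-\rho)\frac{I^*}2\big)+O(n^{-C'})$; 3. unconditionally, $\ \mathbb E\,h(\hat z,z^*)\le\exp\big(-(1-\rho)\frac{I^*}2\big)+O(n^{-2})$. -/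

import Mathlib

open MeasureTheory ProbabilityTheory Filter Topology Asymptotics

noncomputable section

/-- The index set of the (possibly loop) edges of an undirected network on `d` nodes:
pairs `(j₁, j₂)` with `j₁ ≤ j₂`. -/
abbrev Edge (d : ℕ) : Type := {ω : Fin d × Fin d // ω.1 ≤ ω.2}

/-- An undirected binary network on `d` nodes (self-loops allowed), i.e. a symmetric 0-1 adjacency
matrix, recorded by its entries on and above the diagonal. -/
abbrev Network (d : ℕ) : Type := Edge d → Bool

/-- The unordered pair of communities of the two end points of an edge. -/
def commPair {d K : ℕ} (σ : Fin d → Fin K) (ω : Edge d) : Sym2 (Fin K) :=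
  s(σ ω.1.1, σ ω.1.2)

/-- The proportion of misclassified items, up to a permutation of the class names:
`min_π (1 / |ι|) #{i : z i ≠ π (z' i)}`. -/
def misclust {ι κ : Type*} [Fintype ι] [DecidableEq κ] (z z' : ι → κ) : ℝ :=
  ⨅ π : Equiv.Perm κ, ((Finset.univ.filter fun i => z i ≠ π (z' i)).card : ℝ) / Fintype.card ι

/-- The parameters of a two-component mixture multi-layer stochastic block model with `n` layers,
`d` nodes and `K` communities per component: the layer labels, the two community probability
matrices, and the two community assignments. -/
structure MMSBM (n d K : ℕ) where
  z : Fin n → Fin 2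
  B : Fin 2 → Matrix (Fin K) (Fin K) ℝ
  σ : Fin 2 → Fin d → Fin K

namespace MMSBM

variable {n d K : ℕ}

/-- The edge probabilities `P_m(j₁, j₂) = B_m(σ_m(j₁), σ_m(j₂))`. -/
def P (θ : MMSBM n d K) (m : Fin 2) (ω : Edge d) : ℝ :=
  θ.B m (θ.σ m ω.1.1) (θ.σ m ω.1.2)

/-- The separation strength `I*`: the Rényi divergence of order `1/2` between the laws of a
network from the first and from the second component. -/
def separation (θ : MMSBM n d K) : ℝ :=
  -2 * ∑ ω : Edge d, Real.log
    (√(θ.P 0 ω * θ.P 1 ω) + √((1 - θ.P 0 ω) * (1 - θ.P 1 ω)))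

/-- The parameter space `Θ(n, d, K, (p₁, q₁, p₂, q₂), α, β, γ)`. -/
structure InParameterSpace (θ : MMSBM n d K) (p q : Fin 2 → ℝ) (α β γ : ℝ) : Prop where
  layer_balance : ∀ m, ((Finset.univ.filter fun i => θ.z i = m).card : ℝ) ∈
    Set.Icc ((n : ℝ) / (2 * α)) (α * n / 2)
  node_balance : ∀ m k, ((Finset.univ.filter fun j => θ.σ m j = k).card : ℝ) ∈
    Set.Icc ((d : ℝ) / (β * K)) (β * d / K)
  symm : ∀ m, (θ.B m).IsSymm
  mem_Ioo : ∀ m k l, θ.B m k l ∈ Set.Ioo (0 : ℝ) 1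
  p_isLeast : ∀ m, IsLeast {x | ∃ k, x = θ.B m k k} (p m)
  p_homogeneous : ∀ m k, γ⁻¹ * θ.B m k k ≤ p m
  q_isGreatest : ∀ m, IsGreatest {x | ∃ k l, k ≠ l ∧ x = θ.B m k l} (q m)
  q_homogeneous : ∀ m k l, k ≠ l → q m ≤ γ * θ.B m k l
  ratio_pp : ∀ m₁ m₂, p m₁ / p m₂ ≤ γ
  ratio_qq : ∀ m₁ m₂, q m₁ / q m₂ ≤ γ
  ratio_pq : ∀ m₁ m₂, p m₁ / q m₂ ≤ γ
  ratio_qp : ∀ m₁ m₂, q m₁ / p m₂ ≤ γ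

/-- `X₁, …, X_n` are sampled from the model: all edges of all layers are independent, and the edge
`ω` of layer `i` is Bernoulli with parameter `P_{z_i}(ω)`. -/
structure IsSample {Ω : Type*} [MeasurableSpace Ω] (θ : MMSBM n d K) (μ : Measure Ω)
    (X : Fin n → Ω → Network d) : Prop where
  measurable : ∀ i, Measurable (X i)
  indep : iIndepFun (fun (e : Fin n × Edge d) (w : Ω) => X e.1 w e.2) μ
  prob : ∀ i ω, μ.real {w | X i w ω = true} = θ.P (θ.z i) ω

end MMSBM

/-- The rescaled probability `a` with `p = a / ((n ∧ d) d)`. -/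
def rescaled (n d : ℕ) (p : ℝ) : ℝ := p * (((min n d : ℕ) : ℝ) * d)

/-- What an initialization returns when layer `i` is left out: labels of the other layers, and two
community assignments, the one of index `m` belonging to the layers labelled `m`. -/
abbrev InitOutput (n d K : ℕ) (i : Fin n) : Type :=
  ({j : Fin n // j ≠ i} → Fin 2) × (Fin 2 → Fin d → Fin K)

/-- An initialization algorithm: a function of the networks other than the `i`-th, and of a random
seed in `S` (take `S` a point for a deterministic one). -/
abbrev InitAlgorithm (n d K : ℕ) (S : Type*) : Type _ :=
  ∀ i : Fin n, ({j : Fin n // j ≠ i} → Network d) → S → InitOutput n d K i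

/-- The initialization without layer `i` has layer error at most `ηz` and community error at most
`ησ`. The permutation `π` of the component names is common to the layer labels and to the
community assignments: a component named `π m` in the output stands for the true component `m`. -/
def InitGood {n d K : ℕ} (θ : MMSBM n d K) (ηz ησ : ℝ) {i : Fin n} (o : InitOutput n d K i) :
    Prop :=
  ∃ π : Equiv.Perm (Fin 2),
    ((Finset.univ.filter fun j : {j : Fin n // j ≠ i} => o.1 j ≠ π (θ.z j)).card : ℝ) / n ≤ ηz ∧
    ∀ m, misclust (o.2 (π m)) (θ.σ m) ≤ ησ

section Algorithm

variable {n d K : ℕ}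

/-- The leave-one-out estimate of the `(k, l)` entry of the `m`-th community probability matrix:
the edge frequency, over the layers labelled `m`, between the estimated communities `k` and `l`. -/
def looB {i : Fin n} (x : {j : Fin n // j ≠ i} → Network d) (o : InitOutput n d K i)
    (m : Fin 2) (k l : Fin K) : ℝ :=
  (∑ j, if o.1 j = m then
      ∑ ω, (if commPair (o.2 m) ω = s(k, l) then ((x j ω).toNat : ℝ) else 0) else 0) /
  (∑ j, if o.1 j = m then
      ∑ ω : Edge d, (if commPair (o.2 m) ω = s(k, l) then (1 : ℝ) else 0) else 0)

/-- The leave-one-out estimate of the edge probabilities of component `m`. -/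
def looP {i : Fin n} (x : {j : Fin n // j ≠ i} → Network d) (o : InitOutput n d K i)
    (m : Fin 2) (ω : Edge d) : ℝ :=
  looB x o m (o.2 m ω.1.1) (o.2 m ω.1.2)

/-- The logarithm of a nonnegative number, with `log 0 = -∞`. -/
def elog (x : ℝ) : EReal := ENNReal.log (ENNReal.ofReal x)

/-- The log-likelihood `∑_ω x(ω) log P(ω) + (1 - x(ω)) log (1 - P(ω))` of a network `x` under the
edge probabilities `P`, in `[-∞, 0]` and with `0 log 0 = 0`. -/
def logLik (P : Edge d → ℝ) (x : Network d) : EReal :=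
  ∑ ω, if x ω = true then elog (P ω) else elog (1 - P ω)

/-- The label vector with entry `c` at layer `i` and the initial labels elsewhere. -/
def fillLabel {i : Fin n} (o : InitOutput n d K i) (c : Fin 2) (j : Fin n) : Fin 2 :=
  if h : j ≠ i then o.1 ⟨j, h⟩ else c

/-- `zhat` is an output of the two-stage algorithm on the networks `x` with the leave-one-out
initializations `o`. The number `c i` is the likelihood-based label of layer `i` before alignment;
the other layers are then aligned with the first one. Ties in an arg max may be broken in any
way. -/
def IsTwoStageOutput (x : Fin n → Network d) (o : ∀ i, InitOutput n d K i)
    (zhat : Fin n → Fin 2) : Prop :=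
  ∃ c : Fin n → Fin 2,
    (∀ i m, logLik (looP (fun j => x j) (o i) m) (x i) ≤
      logLik (looP (fun j => x j) (o i) (c i)) (x i)) ∧
    (∀ i : Fin n, (i : ℕ) = 0 → zhat i = c i) ∧
    (∀ i₁ i : Fin n, (i₁ : ℕ) = 0 → (i : ℕ) ≠ 0 → ∀ m,
      (Finset.univ.filter fun j =>
        fillLabel (o i₁) (c i₁) j = m ∧ fillLabel (o i) (c i) j = c i).card ≤
      (Finset.univ.filter fun j =>
        fillLabel (o i₁) (c i₁) j = zhat i ∧ fillLabel (o i) (c i) j = c i).card)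

end Algorithm

end

/-! The label of layer `i` is decided by a likelihood ratio test between two edge probability
vectors that were estimated from the other layers and an independent seed, hence are independent of
layer `i`. With the true probabilities, Chernoff's bound at the exponent `1/2` gives the error
`exp (-I / 2)`, because the exponential moment is a product of Hellinger affinities. With estimates,
each factor changes, but the first-order effect of an estimation error is proportional to the
difference of the two true probabilities. Hence, by Cauchy-Schwarz, the exponent changes only by
`o(I)` as soon as the `χ²`-type error `∑ (P̂ - P)² / P` is `o(I)` and the estimates are comparable
with the truth and bounded away from one (`log_chernoffFactor_le`, `measureReal_wrongPreferred_le`).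

The `χ²`-type error is controlled on an event (`Typical`) that depends on the other layers only. The
frequency of a block over the truly labelled cells has a relative error at most `√(ε I / (p d²))`.
The cells that the initialization may count wrongly lie in few layers or touch few nodes, and no
such set of cells contains many edges, uniformly over the choice of these layers and nodes. The
error is then at most a constant times `ε I` (`sum_sq_looP_sub_le`). A union bound over all small
sets of layers and of nodes shows that the event fails with probability at most `exp (-I)`
(`measureReal_not_typical_le`, `typicality_conditions`). For the sets of layers the entropy is not
small compared with the number of edges of a block in one layer, and the exponential moment has to
be taken at `log (1 / η)`, where `η` is the proportion of mislabelled layers. For the sets of nodes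
the entropy is what the condition on `ησ log (1 / ησ)` is for.

When all initializations are accurate, the alignment with the first layer is correct, because the
wrongly labelled layers are fewer than the layers of either component
(`misclust_le_of_isTwoStageOutput`). The expected error is therefore the average over the layers of
the error probabilities of the tests (`setIntegral_misclust_le`). Taking `ε → 0` gives a rate
`exp (-(1 - o(1)) I / 2)` for the expectation, and adding `2 / log I` to the `o(1)` term makes
Markov's inequality strong enough for the bound in probability. -/

noncomputable section

/-! ### Hellinger affinity and the Chernoff factor of a plug-in test -/

lemma sq_sqrt_sub_sqrt_le {x y : ℝ} (hx : 0 < x) (hy : 0 ≤ y) :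
    (√x - √y) ^ 2 ≤ (y - x) ^ 2 / x := by
  have h1 := Real.sq_sqrt hx.le
  have h2 := Real.sq_sqrt hy
  rw [le_div_iff₀ hx]
  have h3 : (y - x) ^ 2 = (√x - √y) ^ 2 * (√x + √y) ^ 2 := by
    rw [← mul_pow, ← h1, ← h2]
    simp only [Real.sqrt_sq (Real.sqrt_nonneg _)]
    ring
  rw [h3]
  apply mul_le_mul_of_nonneg_left _ (sq_nonneg _)
  nlinarith [Real.sqrt_nonneg x, Real.sqrt_nonneg y]

lemma one_sub_affinity_eq {x y : ℝ} (hx : x ∈ Set.Ioo (0 : ℝ) 1) (hy : y ∈ Set.Ioo (0 : ℝ) 1) :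
    1 - (√(x * y) + √((1 - x) * (1 - y))) =
      ((√x - √y) ^ 2 + (√(1 - x) - √(1 - y)) ^ 2) / 2 := by
  have hx' : 0 ≤ 1 - x := by linarith [hx.2]
  rw [Real.sqrt_mul hx.1.le, Real.sqrt_mul hx']
  have h1 := Real.sq_sqrt hx.1.le
  have h2 := Real.sq_sqrt hy.1.le
  have h3 := Real.sq_sqrt hx'
  have h4 := Real.sq_sqrt (show 0 ≤ 1 - y by linarith [hy.2])
  linarith

lemma abs_sqrt_div_sub_one_le {x y : ℝ} (hx : 0 ≤ x) (hy : 0 < y) :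
    |√(x / y) - 1| ≤ |x - y| / y := by
  have h : |√(x / y) - 1| ≤ |x / y - 1| := by
    have h0 := Real.sq_sqrt (div_nonneg hx hy.le)
    have h1 := Real.sqrt_nonneg (x / y)
    have : x / y - 1 = (√(x / y) - 1) * (√(x / y) + 1) := by linarith
    rw [this, abs_mul, abs_of_pos (show 0 < √(x / y) + 1 by linarith)]
    nlinarith [abs_nonneg (√(x / y) - 1)]
  rwa [show x / y - 1 = (x - y) / y by field_simp, abs_div, abs_of_pos hy] at h

/-- Hellinger affinities are stable: replacing the two Bernoulli parameters by estimates costs a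
small fraction of the Hellinger distance and a multiple of the `χ²`-type errors. -/
lemma one_sub_affinity_le {p₀ s a b a' b' : ℝ} (hs : 0 < s) (hp : p₀ < 1)
    (ha : 0 < a) (ha' : a ≤ p₀) (hb : 0 < b) (hb' : b ≤ p₀)
    (hA : a' ∈ Set.Ioo (0 : ℝ) 1) (hB : b' ∈ Set.Ioo (0 : ℝ) 1) :
    1 - (√(a * b) + √((1 - a) * (1 - b))) ≤
      (1 + s) * (1 - (√(a' * b') + √((1 - a') * (1 - b')))) +
        (1 + 1 / s) * (2 / (1 - p₀)) * ((a' - a) ^ 2 / a + (b' - b) ^ 2 / b) := by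
  rw [one_sub_affinity_eq ⟨ha, by linarith⟩ ⟨hb, by linarith⟩, one_sub_affinity_eq hA hB]
  have key : ∀ u v u' v' : ℝ,
      (u - v) ^ 2 ≤ (1 + s) * (u' - v') ^ 2 + (1 + 1 / s) * (2 * ((u - u') ^ 2 + (v - v') ^ 2)) := by
    intro u v u' v'
    have h1 : (u - v) ^ 2 ≤ (1 + s) * (u' - v') ^ 2 + (1 + 1 / s) * ((u - u') - (v - v')) ^ 2 := by
      have : (1 + s) * (u' - v') ^ 2 + (1 + 1 / s) * ((u - u') - (v - v')) ^ 2 - (u - v) ^ 2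
          = (s * (u' - v') - ((u - u') - (v - v'))) ^ 2 / s := by
        field_simp
        ring
      have h2 : 0 ≤ (s * (u' - v') - ((u - u') - (v - v'))) ^ 2 / s := by positivity
      linarith
    have h3 : ((u - u') - (v - v')) ^ 2 ≤ 2 * ((u - u') ^ 2 + (v - v') ^ 2) := by
      nlinarith [sq_nonneg ((u - u') + (v - v'))]
    have h4 : 0 ≤ 1 + 1 / s := by positivity
    linarith [mul_le_mul_of_nonneg_left h3 h4]
  have k1 := key √a √b √a' √b'
  have k2 := key √(1 - a) √(1 - b) √(1 - a') √(1 - b')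
  have e1 := sq_sqrt_sub_sqrt_le ha hA.1.le
  have e2 := sq_sqrt_sub_sqrt_le hb hB.1.le
  have ec : ∀ c c' : ℝ, 0 < c → c ≤ p₀ → c' ∈ Set.Ioo (0 : ℝ) 1 →
      (√c - √c') ^ 2 + (√(1 - c) - √(1 - c')) ^ 2 ≤ 2 / (1 - p₀) * ((c' - c) ^ 2 / c) := by
    intro c c' h0 h1 h2
    have e1 := sq_sqrt_sub_sqrt_le h0 h2.1.le
    have e3 := sq_sqrt_sub_sqrt_le (show 0 < 1 - c by linarith)
      (show 0 ≤ 1 - c' by linarith [h2.2])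
    have hq : 0 < 1 - p₀ := by linarith
    have e4 : (1 - c' - (1 - c)) ^ 2 / (1 - c) ≤ 1 / (1 - p₀) * ((c' - c) ^ 2 / c) := by
      rw [show (1 - c' - (1 - c)) ^ 2 = (c' - c) ^ 2 by ring, div_mul_div_comm, one_mul]
      apply div_le_div_of_nonneg_left (sq_nonneg _) (by positivity)
      nlinarith
    have e5 : (c' - c) ^ 2 / c ≤ 1 / (1 - p₀) * ((c' - c) ^ 2 / c) := by
      apply le_mul_of_one_le_left (by positivity)
      rw [le_div_iff₀ hq]
      linarith
    have : 2 / (1 - p₀) * ((c' - c) ^ 2 / c) =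
      1 / (1 - p₀) * ((c' - c) ^ 2 / c) + 1 / (1 - p₀) * ((c' - c) ^ 2 / c) := by ring
    linarith
  have f1 := ec a a' ha ha' hA
  have f2 := ec b b' hb hb' hB
  have h4 : 0 ≤ 1 + 1 / s := by positivity
  linarith [mul_le_mul_of_nonneg_left f1 h4, mul_le_mul_of_nonneg_left f2 h4]

/-- The factor contributed by one edge to the exponential Chernoff bound (at the exponent `1/2`)
for the likelihood ratio test between the estimates `b'` and `a'`, when the truth is `a`. -/
def chernoffFactor (a a' b' : ℝ) : ℝ :=
  a * √(b' / a') + (1 - a) * √((1 - b') / (1 - a'))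

set_option maxHeartbeats 1000000 in
/-- The Chernoff factor of the plug-in test is, up to `χ²`-type estimation errors and a small
fraction of the exponent, the Hellinger affinity of the two true parameters: the first-order
effect of an estimation error is proportional to the difference of the two parameters. -/
lemma log_chernoffFactor_le {p₀ H r : ℝ} (hp : p₀ < 1) (hH : 1 ≤ H) (hr : 0 < r) :
    ∃ C, 0 ≤ C ∧ ∀ a b a' b' : ℝ, 0 < a → a ≤ p₀ → 0 < b → b ≤ p₀ → b ≤ H * a → a ≤ H * a' →
      0 < b' → (1 - p₀) / 2 ≤ 1 - a' → (1 - p₀) / 2 ≤ 1 - b' →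
      Real.log (chernoffFactor a a' b') ≤
        (1 - r) * Real.log (√(a * b) + √((1 - a) * (1 - b))) +
          C * ((a' - a) ^ 2 / a + (b' - b) ^ 2 / b) := by
  have hq : 0 < 1 - p₀ := by linarith
  set H₁ := H + 2 / (1 - p₀) with hH₁
  have hH₁0 : 0 < H₁ := by positivity
  set v := r * (1 - p₀) / 2 with hv
  have hv0 : 0 < v := by positivity
  set s := v / (H₁ * (6 + 6 * H)) with hs
  have hs0 : 0 < s := by positivity
  set C₁ := (1 + 1 / v) * (2 / (1 - p₀)) with hC₁
  have hC₁0 : 0 ≤ C₁ := by positivity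
  set C₂ := H₁ * (1 / (2 * s) + 3 * s / 2 * H) with hC₂
  have hC₂0 : 0 ≤ C₂ := by positivity
  refine ⟨(C₁ + C₂) / (1 - p₀), by positivity, ?_⟩
  intro a b a' b' ha hap hb hbp hba haa' hb'0 ha'1 hb'1
  have ha'0 : 0 < a' := by
    by_contra h
    push Not at h
    linarith [mul_nonneg (show 0 ≤ H by linarith) (neg_nonneg.2 h)]
  have hA : a' ∈ Set.Ioo (0 : ℝ) 1 := ⟨ha'0, by linarith⟩
  have hB : b' ∈ Set.Ioo (0 : ℝ) 1 := ⟨hb'0, by linarith⟩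
  have hA1 : 0 < 1 - a' := by linarith
  have hB1 : 0 < 1 - b' := by linarith
  set g := √(a * b) + √((1 - a) * (1 - b)) with hg
  set gq := √(a' * b') + √((1 - a') * (1 - b')) with hgq
  set ea := (a' - a) ^ 2 / a with hea
  set eb := (b' - b) ^ 2 / b with heb
  have hea0 : 0 ≤ ea := by positivity
  have heb0 : 0 ≤ eb := by positivity
  have hX := one_sub_affinity_eq (x := a) (y := b) ⟨ha, by linarith⟩ ⟨hb, by linarith⟩
  rw [← hg] at hX
  have hX0 : 0 ≤ 1 - g := by rw [hX]; positivity
  have hY0 : 0 ≤ 1 - gq := by rw [hgq, one_sub_affinity_eq hA hB]; positivity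
  have hstab := one_sub_affinity_le hv0 hp ha hap hb hbp hA hB
  rw [← hg, ← hgq, ← hea, ← heb, ← hC₁] at hstab
  have hgp : 1 - p₀ ≤ g := by
    have : 1 - p₀ ≤ √((1 - a) * (1 - b)) := by
      apply Real.le_sqrt_of_sq_le
      rw [sq]
      exact mul_le_mul (by linarith) (by linarith) hq.le (by linarith)
    linarith [Real.sqrt_nonneg (a * b)]
  have hg0 : 0 < g := by linarith
  -- the Chernoff factor is the affinity of the estimates plus a cross term
  have hf : chernoffFactor a a' b' =
      gq + (a - a') * ((√(b' / a') - 1) - (√((1 - b') / (1 - a')) - 1)) := by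
    have h1 : √(a' * b') = a' * √(b' / a') := by
      rw [show a' * b' = a' ^ 2 * (b' / a') by field_simp, Real.sqrt_mul (by positivity),
        Real.sqrt_sq ha'0.le]
    have h2 : √((1 - a') * (1 - b')) = (1 - a') * √((1 - b') / (1 - a')) := by
      rw [show (1 - a') * (1 - b') = (1 - a') ^ 2 * ((1 - b') / (1 - a')) by field_simp,
        Real.sqrt_mul (by positivity), Real.sqrt_sq hA1.le]
    rw [hgq, h1, h2, chernoffFactor]
    ring
  have hbr : |(√(b' / a') - 1) - (√((1 - b') / (1 - a')) - 1)| ≤ |b' - a'| * (H₁ / a) := by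
    have h1 := abs_sqrt_div_sub_one_le hb'0.le ha'0
    have h2 := abs_sqrt_div_sub_one_le hB1.le hA1
    rw [show 1 - b' - (1 - a') = -(b' - a') by ring, abs_neg] at h2
    have h3 : |b' - a'| / a' ≤ |b' - a'| * (H / a) := by
      rw [div_eq_mul_inv]
      apply mul_le_mul_of_nonneg_left _ (abs_nonneg _)
      rw [inv_eq_one_div, div_le_div_iff₀ ha'0 ha]
      linarith
    have h4 : |b' - a'| / (1 - a') ≤ |b' - a'| * ((2 / (1 - p₀)) / a) := by
      rw [div_eq_mul_inv]
      apply mul_le_mul_of_nonneg_left _ (abs_nonneg _)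
      rw [inv_eq_one_div, div_div, div_le_div_iff₀ hA1 (by positivity)]
      have : (1 - p₀) * a ≤ (1 - p₀) * 1 := mul_le_mul_of_nonneg_left (by linarith) hq.le
      linarith
    have h5 : |b' - a'| * (H₁ / a) =
        |b' - a'| * (H / a) + |b' - a'| * ((2 / (1 - p₀)) / a) := by
      rw [hH₁]; ring
    calc _ ≤ |√(b' / a') - 1| + |√((1 - b') / (1 - a')) - 1| := abs_sub _ _
      _ ≤ |b' - a'| * (H₁ / a) := by rw [h5]; exact add_le_add (h1.trans h3) (h2.trans h4)
  have hd2 : (b' - a') ^ 2 / a ≤ 3 * (H * eb + (4 + 4 * H) * (1 - g) + ea) := by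
    have h1 : (b' - a') ^ 2 ≤ 3 * ((b' - b) ^ 2 + (b - a) ^ 2 + (a' - a) ^ 2) := by
      linarith [sq_nonneg ((b' - b) - (b - a)), sq_nonneg ((b' - b) + (a' - a)),
        sq_nonneg ((b - a) + (a' - a))]
    have h2 : (b' - b) ^ 2 / a ≤ H * eb := by
      rw [heb, ← mul_div_assoc, div_le_div_iff₀ ha hb]
      linarith [mul_le_mul_of_nonneg_left hba (sq_nonneg (b' - b))]
    have h3 : (b - a) ^ 2 / a ≤ (4 + 4 * H) * (1 - g) := by
      have ha2 := Real.sq_sqrt ha.le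
      have hb2 := Real.sq_sqrt hb.le
      have h4 : (b - a) ^ 2 = (√a - √b) ^ 2 * (√a + √b) ^ 2 := by
        rw [← mul_pow, ← ha2, ← hb2]
        simp only [Real.sqrt_sq (Real.sqrt_nonneg _)]
        ring
      have h5 : (√a + √b) ^ 2 ≤ (2 + 2 * H) * a := by
        linarith [sq_nonneg (√a - √b)]
      have h6 : (√a - √b) ^ 2 ≤ 2 * (1 - g) := by
        rw [hX]; linarith [sq_nonneg (√(1 - a) - √(1 - b))]
      rw [div_le_iff₀ ha, h4]
      calc _ ≤ (2 * (1 - g)) * ((2 + 2 * H) * a) :=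
            mul_le_mul h6 h5 (sq_nonneg _) (by linarith)
        _ = _ := by ring
    calc (b' - a') ^ 2 / a ≤ 3 * ((b' - b) ^ 2 + (b - a) ^ 2 + (a' - a) ^ 2) / a := by gcongr
      _ = 3 * ((b' - b) ^ 2 / a + (b - a) ^ 2 / a + ea) := by rw [hea]; ring
      _ ≤ _ := by gcongr
  have hcross : (a - a') * ((√(b' / a') - 1) - (√((1 - b') / (1 - a')) - 1)) ≤
      v * (1 - g) + C₂ * (ea + eb) := by
    have h1 : (a - a') * ((√(b' / a') - 1) - (√((1 - b') / (1 - a')) - 1)) ≤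
        |a - a'| * (|b' - a'| * (H₁ / a)) :=
      (le_abs_self _).trans (by rw [abs_mul]; gcongr)
    have h2 : |a - a'| * |b' - a'| ≤ 1 / (2 * s) * (a' - a) ^ 2 + s / 2 * (b' - a') ^ 2 := by
      have : 1 / (2 * s) * (a' - a) ^ 2 + s / 2 * (b' - a') ^ 2 - |a - a'| * |b' - a'| =
          (|a - a'| - s * |b' - a'|) ^ 2 / (2 * s) := by
        rw [← sq_abs (a' - a), ← sq_abs (b' - a'), abs_sub_comm a' a]
        field_simp
        ring
      have h3 : 0 ≤ (|a - a'| - s * |b' - a'|) ^ 2 / (2 * s) := by positivity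
      linarith
    calc _ ≤ |a - a'| * (|b' - a'| * (H₁ / a)) := h1
      _ = H₁ / a * (|a - a'| * |b' - a'|) := by ring
      _ ≤ H₁ / a * (1 / (2 * s) * (a' - a) ^ 2 + s / 2 * (b' - a') ^ 2) := by gcongr
      _ = H₁ * (1 / (2 * s) * ea + s / 2 * ((b' - a') ^ 2 / a)) := by rw [hea]; ring
      _ ≤ H₁ * (1 / (2 * s) * ea + s / 2 * (3 * (H * eb + (4 + 4 * H) * (1 - g) + ea))) := by
          gcongr
      _ = s * (H₁ * (6 + 6 * H)) * (1 - g) +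
          H₁ * ((1 / (2 * s) + 3 * s / 2) * ea + 3 * s / 2 * H * eb) := by ring
      _ = v * (1 - g) + H₁ * ((1 / (2 * s) + 3 * s / 2) * ea + 3 * s / 2 * H * eb) := by
          rw [hs, div_mul_cancel₀]; positivity
      _ ≤ v * (1 - g) + H₁ * ((1 / (2 * s) + 3 * s / 2 * H) * ea +
            (1 / (2 * s) + 3 * s / 2 * H) * eb) := by
          gcongr
          · exact le_mul_of_one_le_right (by positivity) hH
          · exact le_add_of_nonneg_left (by positivity)
      _ = _ := by rw [hC₂]; ring
  have hfg : chernoffFactor a a' b' ≤ g + (2 * v * (1 - g) + (C₁ + C₂) * (ea + eb)) := by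
    have : 1 - g ≤ (1 - gq) + v * (1 - g) + C₁ * (ea + eb) := by
      have hC : 0 ≤ C₁ * (ea + eb) := by positivity
      have hv1 : 0 ≤ v * (1 - g) := by positivity
      by_cases h : 1 - gq ≤ 1 - g
      · have := mul_le_mul_of_nonneg_left h hv0.le
        linarith
      · linarith
    have h2 : (C₁ + C₂) * (ea + eb) = C₁ * (ea + eb) + C₂ * (ea + eb) := by ring
    rw [hf]
    linarith
  have hf0 : 0 < chernoffFactor a a' b' := by
    have h1 : 0 < √(b' / a') := Real.sqrt_pos.2 (by positivity)
    have h2 : 0 ≤ √((1 - b') / (1 - a')) := Real.sqrt_nonneg _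
    have h3 : 0 ≤ 1 - a := by linarith
    rw [chernoffFactor]
    positivity
  have hlog1 : Real.log (chernoffFactor a a' b') ≤
      Real.log g + (2 * v * (1 - g) + (C₁ + C₂) * (ea + eb)) / (1 - p₀) := by
    set y := 2 * v * (1 - g) + (C₁ + C₂) * (ea + eb) with hy
    have hy0 : 0 ≤ y := by positivity
    calc Real.log (chernoffFactor a a' b') ≤ Real.log (g * (1 + y / g)) := by
          apply Real.log_le_log hf0
          rw [mul_add, mul_div_cancel₀ _ hg0.ne']
          linarith
      _ = Real.log g + Real.log (1 + y / g) := Real.log_mul hg0.ne' (by positivity)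
      _ ≤ Real.log g + y / g := by
          have := Real.log_le_sub_one_of_pos (show 0 < 1 + y / g by positivity)
          linarith
      _ ≤ _ := by gcongr
  have hlog2 : 1 - g ≤ -Real.log g := by
    have := Real.log_le_sub_one_of_pos hg0
    linarith
  have hlast : 2 * v * (1 - g) / (1 - p₀) ≤ -r * Real.log g := by
    rw [hv, show 2 * (r * (1 - p₀) / 2) * (1 - g) / (1 - p₀) = r * (1 - g) by field_simp]
    linarith [mul_le_mul_of_nonneg_left hlog2 hr.le]
  calc _ ≤ Real.log g + (2 * v * (1 - g) + (C₁ + C₂) * (ea + eb)) / (1 - p₀) := hlog1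
    _ = Real.log g + 2 * v * (1 - g) / (1 - p₀) + (C₁ + C₂) / (1 - p₀) * (ea + eb) := by ring
    _ ≤ _ := by linarith

/-! ### Exponential bounds for sums of independent bits -/

section Bernoulli

variable {Ω ι : Type*} [MeasurableSpace Ω] {μ : Measure Ω} [IsProbabilityMeasure μ] [Fintype ι]
  {Y : ι → Ω → Bool} {P : ι → ℝ}

lemma integral_comp_bool {Z : Ω → Bool} (hZ : Measurable Z) (φ : Bool → ℝ) :
    ∫ w, φ (Z w) ∂μ = μ.real {w | Z w = true} * φ true +
      (1 - μ.real {w | Z w = true}) * φ false := by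
  have hm : MeasurableSet {w | Z w = true} := hZ (measurableSet_singleton true)
  have h : (fun w => φ (Z w)) = fun w =>
      {w | Z w = true}.indicator (fun _ => φ true - φ false) w + φ false := by
    funext w
    cases h : Z w <;> simp [Set.indicator, h]
  rw [h, integral_add ((integrable_const _).indicator hm) (integrable_const _),
    integral_indicator hm]
  simp
  ring

lemma integral_prod_comp_bool (hY : ∀ e, Measurable (Y e)) (hind : iIndepFun Y μ)
    (hP : ∀ e, μ.real {w | Y e w = true} = P e) (φ : ι → Bool → ℝ) :
    ∫ w, ∏ e, φ e (Y e w) ∂μ = ∏ e, (P e * φ e true + (1 - P e) * φ e false) := by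
  rw [hind.integral_fun_prod_comp (fun e => (hY e).aemeasurable)
    (fun e => (measurable_of_countable _).aestronglyMeasurable)]
  simp_rw [integral_comp_bool (hY _), hP]

lemma integrable_comp_of_finite {α : Type*} [Finite α] [MeasurableSpace α]
    [MeasurableSingletonClass α] {Z : Ω → α} (hZ : Measurable Z) (φ : α → ℝ) :
    Integrable (fun w => φ (Z w)) μ := by
  have := Fintype.ofFinite α
  refine Integrable.of_bound ((measurable_of_countable φ).comp hZ).aestronglyMeasurable
    (∑ a, ‖φ a‖) (ae_of_all _ fun w => ?_)
  exact Finset.single_le_sum (f := fun a => ‖φ a‖) (fun a _ => norm_nonneg _) (Finset.mem_univ _)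

/-- Markov's inequality for a product of nonnegative functions of independent bits. -/
lemma mul_measureReal_le_prod_comp_bool (hY : ∀ e, Measurable (Y e)) (hind : iIndepFun Y μ)
    (hP : ∀ e, μ.real {w | Y e w = true} = P e) (φ : ι → Bool → ℝ) (hφ : ∀ e b, 0 ≤ φ e b)
    {c : ℝ} {s : Set (ι → Bool)} (hs : ∀ y ∈ s, c ≤ ∏ e, φ e (y e)) :
    c * μ.real {w | (fun e => Y e w) ∈ s} ≤ ∏ e, (P e * φ e true + (1 - P e) * φ e false) := by
  rw [← integral_prod_comp_bool hY hind hP φ]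
  have hYm : Measurable fun w e => Y e w := measurable_pi_lambda _ hY
  have hm : MeasurableSet {w | (fun e => Y e w) ∈ s} := hYm (Set.toFinite s).measurableSet
  have h := integral_mono (μ := μ) (f := {w | (fun e => Y e w) ∈ s}.indicator fun _ => c)
    (g := fun w => ∏ e, φ e (Y e w)) ((integrable_const _).indicator hm)
    (integrable_comp_of_finite hYm fun y => ∏ e, φ e (y e)) ?_
  · rwa [integral_indicator hm, setIntegral_const, smul_eq_mul, mul_comm] at h
  · intro w
    by_cases hw : (fun e => Y e w) ∈ s
    · simpa [Set.indicator, hw] using hs _ hw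
    · simpa [Set.indicator, hw] using Finset.prod_nonneg fun e _ => hφ e _

/-- Exponential Markov bound for a sum of independent bits, valid for either sign of `x`. -/
lemma measureReal_exp_sum_le [DecidableEq ι] (hY : ∀ e, Measurable (Y e)) (hind : iIndepFun Y μ)
    (hP : ∀ e, μ.real {w | Y e w = true} = P e) (A : Finset ι) (x t : ℝ) {s : Set (ι → Bool)}
    (hs : ∀ y ∈ s, x * t ≤ x * ∑ e ∈ A, ((y e).toNat : ℝ)) :
    μ.real {w | (fun e => Y e w) ∈ s} ≤
      Real.exp (-(x * t) + (Real.exp x - 1) * ∑ e ∈ A, P e) := by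
  set φ : ι → Bool → ℝ := fun e b => if e ∈ A then Real.exp (x * (b.toNat : ℝ)) else 1 with hφ
  have hφ0 : ∀ e b, 0 ≤ φ e b := by
    intro e b
    simp only [hφ]
    split_ifs <;> positivity
  have hprod : ∀ y : ι → Bool, ∏ e, φ e (y e) = Real.exp (x * ∑ e ∈ A, ((y e).toNat : ℝ)) := by
    intro y
    simp only [hφ]
    rw [Finset.prod_ite_mem, Finset.univ_inter, Finset.mul_sum, Real.exp_sum]
  have key : Real.exp (x * t) * μ.real {w | (fun e => Y e w) ∈ s} ≤
      ∏ e, (P e * φ e true + (1 - P e) * φ e false) :=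
    mul_measureReal_le_prod_comp_bool hY hind hP φ hφ0 fun y hy => by
      rw [hprod]
      exact Real.exp_le_exp.2 (hs y hy)
  have hbound : ∏ e, (P e * φ e true + (1 - P e) * φ e false) ≤
      Real.exp ((Real.exp x - 1) * ∑ e ∈ A, P e) := by
    have hfac : ∀ e, P e * φ e true + (1 - P e) * φ e false =
        if e ∈ A then P e * Real.exp x + (1 - P e) else 1 := by
      intro e
      simp only [hφ]
      split_ifs <;> simp
    simp_rw [hfac]
    rw [Finset.prod_ite_mem, Finset.univ_inter, Finset.mul_sum, Real.exp_sum]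
    apply Finset.prod_le_prod
    · intro e _
      have h0 : 0 ≤ P e := hP e ▸ measureReal_nonneg
      have h1 : P e ≤ 1 := hP e ▸ measureReal_le_one
      have := Real.exp_pos x
      have := mul_nonneg h0 this.le
      linarith
    · intro e _
      have := Real.add_one_le_exp ((Real.exp x - 1) * P e)
      linarith
  rw [Real.exp_add, Real.exp_neg, inv_mul_eq_div, le_div_iff₀ (Real.exp_pos _), mul_comm]
  exact key.trans hbound

/-- Bernstein's inequality for relative deviations `δ ≤ 1`. -/
lemma measureReal_abs_sum_sub_le [DecidableEq ι] (hY : ∀ e, Measurable (Y e))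
    (hind : iIndepFun Y μ) (hP : ∀ e, μ.real {w | Y e w = true} = P e) (A : Finset ι) {δ : ℝ}
    (hδ : 0 ≤ δ) (hδ1 : δ ≤ 1) :
    μ.real {w | δ * ∑ e ∈ A, P e ≤ |∑ e ∈ A, (((Y e w).toNat : ℝ) - P e)|} ≤
      2 * Real.exp (-(δ ^ 2 / 4) * ∑ e ∈ A, P e) := by
  set l := ∑ e ∈ A, P e with hl
  have hl0 : 0 ≤ l := Finset.sum_nonneg fun e _ => hP e ▸ measureReal_nonneg
  have hx : ∀ x : ℝ, |x| ≤ 1 → Real.exp x - 1 ≤ x + x ^ 2 := fun x hx => by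
    have := (abs_le.1 (Real.abs_exp_sub_one_sub_id_le hx)).2
    linarith
  have h1 := measureReal_exp_sum_le hY hind hP A (δ / 2) ((1 + δ) * l)
    (s := {y | (1 + δ) * l ≤ ∑ e ∈ A, ((y e).toNat : ℝ)})
    (fun y hy => mul_le_mul_of_nonneg_left hy (by linarith))
  have h2 := measureReal_exp_sum_le hY hind hP A (-(δ / 2)) ((1 - δ) * l)
    (s := {y | ∑ e ∈ A, ((y e).toNat : ℝ) ≤ (1 - δ) * l})
    (fun y hy => mul_le_mul_of_nonpos_left hy (by linarith))
  have e1 : -(δ / 2 * ((1 + δ) * l)) + (Real.exp (δ / 2) - 1) * l ≤ -(δ ^ 2 / 4) * l := by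
    have := mul_le_mul_of_nonneg_right (hx (δ / 2) (by rw [abs_le]; constructor <;> linarith)) hl0
    linarith
  have e2 : -(-(δ / 2) * ((1 - δ) * l)) + (Real.exp (-(δ / 2)) - 1) * l ≤ -(δ ^ 2 / 4) * l := by
    have := mul_le_mul_of_nonneg_right (hx (-(δ / 2)) (by rw [abs_le]; constructor <;> linarith)) hl0
    linarith
  rw [← hl] at h1 h2
  have hsub : {w | δ * l ≤ |∑ e ∈ A, (((Y e w).toNat : ℝ) - P e)|} ⊆
      {w | (fun e => Y e w) ∈ {y : ι → Bool | (1 + δ) * l ≤ ∑ e ∈ A, ((y e).toNat : ℝ)}} ∪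
      {w | (fun e => Y e w) ∈ {y : ι → Bool | ∑ e ∈ A, ((y e).toNat : ℝ) ≤ (1 - δ) * l}} := by
    intro w hw
    simp only [Set.mem_ofPred_eq, Set.mem_union, Finset.sum_sub_distrib, ← hl] at hw ⊢
    rcases le_abs.1 hw with h | h
    · left; linarith
    · right; linarith
  calc _ ≤ _ := measureReal_mono hsub
    _ ≤ _ := measureReal_union_le _ _
    _ ≤ Real.exp (-(δ ^ 2 / 4) * l) + Real.exp (-(δ ^ 2 / 4) * l) :=
        add_le_add (h1.trans (Real.exp_le_exp.2 e1)) (h2.trans (Real.exp_le_exp.2 e2))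
    _ = _ := by ring

end Bernoulli

/-- The number of subsets of proportion at most `η` is at most `exp (η |α| (1 + log (1 / η)))`. For
`η = 0` the junk value `log (1 / 0) = 0` is the right one. -/
lemma card_filter_card_le {α : Type*} [Fintype α] [DecidableEq α] {η N : ℝ} (h0 : 0 ≤ η)
    (h1 : η ≤ 1) (hN : (Fintype.card α : ℝ) ≤ N) :
    ((Finset.univ.filter fun V : Finset α => (V.card : ℝ) ≤ η * N).card : ℝ) ≤
      Real.exp (η * N * (1 + Real.log (1 / η))) := by
  rcases h0.eq_or_lt with rfl | hη
  · have : (Finset.univ.filter fun V : Finset α => (V.card : ℝ) ≤ 0 * N) ⊆ {∅} := by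
      intro V hV
      simp only [zero_mul, Finset.mem_filter, Finset.mem_univ, true_and] at hV
      have : V.card = 0 := by exact_mod_cast le_antisymm hV (Nat.cast_nonneg _)
      simpa using this
    have := Finset.card_le_card this
    simpa using this
  have hpow : Real.exp (η * N * (1 + Real.log (1 / η))) =
      Real.exp (η * N * Real.log (1 / η)) * Real.exp (η * N) := by
    rw [← Real.exp_add]; ring_nf
  have hlog : Real.log (1 / η) = -Real.log η := by simp
  have hlog0 : 0 ≤ Real.log (1 / η) := by rw [hlog]; linarith [Real.log_nonpos h0 h1]
  have hterm : ∀ V ∈ Finset.univ.filter (fun V : Finset α => (V.card : ℝ) ≤ η * N),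
      (1 : ℝ) ≤ Real.exp (η * N * Real.log (1 / η)) * η ^ V.card := by
    intro V hV
    simp only [Finset.mem_filter, Finset.mem_univ, true_and] at hV
    have h2 : η ^ V.card = Real.exp (-(V.card * Real.log (1 / η))) := by
      rw [hlog, mul_neg, neg_neg, mul_comm, Real.exp_mul, Real.exp_log hη, Real.rpow_natCast]
    rw [h2, ← Real.exp_add, Real.one_le_exp_iff]
    have := mul_le_mul_of_nonneg_right hV hlog0
    linarith
  calc ((Finset.univ.filter fun V : Finset α => (V.card : ℝ) ≤ η * N).card : ℝ)
      = ∑ V ∈ Finset.univ.filter (fun V : Finset α => (V.card : ℝ) ≤ η * N), (1 : ℝ) := by simp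
    _ ≤ ∑ V ∈ Finset.univ.filter (fun V : Finset α => (V.card : ℝ) ≤ η * N),
          Real.exp (η * N * Real.log (1 / η)) * η ^ V.card := Finset.sum_le_sum hterm
    _ ≤ ∑ V : Finset α, Real.exp (η * N * Real.log (1 / η)) * η ^ V.card :=
        Finset.sum_le_sum_of_subset_of_nonneg (Finset.filter_subset _ _) fun V _ _ => by positivity
    _ = Real.exp (η * N * Real.log (1 / η)) * (1 + η) ^ Fintype.card α := by
        rw [← Finset.mul_sum]
        congr 1
        have := Finset.sum_pow_mul_eq_add_pow η (1 : ℝ) (Finset.univ : Finset α)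
        simp only [one_pow, mul_one, Finset.powerset_univ, Finset.card_univ] at this
        rw [this, add_comm]
    _ ≤ _ := by
        rw [hpow]
        gcongr
        calc (1 + η) ^ Fintype.card α ≤ (Real.exp η) ^ Fintype.card α := by
              gcongr; linarith [Real.add_one_le_exp η]
          _ = Real.exp (η * Fintype.card α) := by rw [mul_comm, Real.exp_nat_mul]
          _ ≤ _ := by gcongr

/-! ### Blocks of edges, and the typical behaviour of the other layers -/

section Counting

variable {d K : ℕ}

/-- The edges between two given communities. -/
def block (σ : Fin d → Fin K) (c : Sym2 (Fin K)) : Finset (Edge d) :=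
  Finset.univ.filter fun ω => commPair σ ω = c

/-- The edges with an end point in `W`. -/
def touching (W : Finset (Fin d)) : Finset (Edge d) :=
  Finset.univ.filter fun ω => ω.1.1 ∈ W ∨ ω.1.2 ∈ W

lemma card_edge_le : (Fintype.card (Edge d) : ℝ) ≤ (d : ℝ) ^ 2 := by
  have h : Fintype.card (Edge d) ≤ Fintype.card (Fin d × Fin d) :=
    Fintype.card_le_of_injective _ Subtype.val_injective
  rw [Fintype.card_prod, Fintype.card_fin] at h
  rw [sq]
  exact_mod_cast h

lemma card_touching_le (W : Finset (Fin d)) : (touching W).card ≤ 2 * W.card * d := by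
  have h : (touching W).card ≤ (W ×ˢ Finset.univ ∪ Finset.univ ×ˢ W : Finset (Fin d × Fin d)).card :=
    Finset.card_le_card_of_injOn Subtype.val
      (fun ω hω => by simpa [touching] using hω) Subtype.val_injective.injOn
  refine h.trans ((Finset.card_union_le _ _).trans_eq ?_)
  simp only [Finset.card_product, Finset.card_univ, Fintype.card_fin]
  ring

lemma card_block_le (σ : Fin d → Fin K) (k l : Fin K) :
    (block σ s(k, l)).card ≤ 2 * ((Finset.univ.filter fun j => σ j = k).card *
      (Finset.univ.filter fun j => σ j = l).card) := by
  have h : (block σ s(k, l)).card ≤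
      ((Finset.univ.filter fun j => σ j = k) ×ˢ (Finset.univ.filter fun j => σ j = l) ∪
        (Finset.univ.filter fun j => σ j = l) ×ˢ
          (Finset.univ.filter fun j => σ j = k) : Finset (Fin d × Fin d)).card :=
    Finset.card_le_card_of_injOn Subtype.val
      (fun ω hω => by simpa [block, commPair] using hω) Subtype.val_injective.injOn
  refine h.trans ((Finset.card_union_le _ _).trans_eq ?_)
  simp only [Finset.card_product]
  ring

lemma mul_le_card_block (σ : Fin d → Fin K) (k l : Fin K) :
    (Finset.univ.filter fun j => σ j = k).card * (Finset.univ.filter fun j => σ j = l).card ≤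
      2 * (block σ s(k, l)).card := by
  classical
  rw [← Finset.card_product, ← Finset.card_filter_add_card_filter_not (fun e => e.1 ≤ e.2), two_mul]
  refine add_le_add ?_ ?_
  · refine Finset.card_le_card_of_injOn
      (fun e => if h : e.1 ≤ e.2 then (⟨e, h⟩ : Edge d) else ⟨(e.2, e.1), (not_le.1 h).le⟩) ?_ ?_
    · intro e he
      simp only [Finset.coe_filter, Finset.mem_product, Finset.mem_filter, Finset.mem_univ,
        true_and, Set.mem_ofPred_eq] at he
      simp [block, commPair, he]
    · intro e he e' he' h
      simp only [Finset.coe_filter, Finset.mem_product, Finset.mem_filter, Finset.mem_univ,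
        true_and, Set.mem_ofPred_eq] at he he'
      simpa [he.2, he'.2] using h
  · refine Finset.card_le_card_of_injOn
      (fun e => if h : e.1 ≤ e.2 then (⟨e, h⟩ : Edge d) else ⟨(e.2, e.1), (not_le.1 h).le⟩) ?_ ?_
    · intro e he
      simp only [Finset.coe_filter, Finset.mem_product, Finset.mem_filter, Finset.mem_univ,
        true_and, Set.mem_ofPred_eq] at he
      simp [block, commPair, he]
    · intro e he e' he' h
      simp only [Finset.coe_filter, Finset.mem_product, Finset.mem_filter, Finset.mem_univ,
        true_and, Set.mem_ofPred_eq] at he he'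
      simp only [he.2, he'.2, dite_false, Subtype.mk.injEq, Prod.mk.injEq] at h
      exact Prod.ext h.2 h.1

end Counting

/-- A frequency over `A` compared with a value `b`, when `A` differs from a set `T` with a good
frequency by elements of a small set `D`. -/
lemma abs_frequency_sub_le {ι : Type*} [DecidableEq ι] {A T D : Finset ι} {y : ι → ℝ} {b δ : ℝ}
    (hAT : A \ T ⊆ D) (hTA : T \ A ⊆ D) (hy : ∀ e, 0 ≤ y e) (hb : 0 ≤ b) (hδ : 0 ≤ δ)
    (hT : |∑ e ∈ T, (y e - b)| ≤ δ * (T.card * b)) (hDA : (D.card : ℝ) ≤ A.card)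
    (hA : (0 : ℝ) < A.card) :
    |(∑ e ∈ A, y e) / A.card - b| ≤ 2 * δ * b + (∑ e ∈ D, y e + b * D.card) / A.card := by
  have h1 : ∑ e ∈ A, (y e - b) =
      ∑ e ∈ T, (y e - b) + (∑ e ∈ A \ T, (y e - b) - ∑ e ∈ T \ A, (y e - b)) := by
    have e1 := Finset.sum_inter_add_sum_sdiff A T fun e => y e - b
    have e2 := Finset.sum_inter_add_sum_sdiff T A fun e => y e - b
    rw [Finset.inter_comm] at e2
    linarith
  have hsub : A \ T ∪ T \ A ⊆ D := Finset.union_subset hAT hTA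
  have hdis : Disjoint (A \ T) (T \ A) :=
    Finset.disjoint_left.2 fun e he he' => (Finset.mem_sdiff.1 he).2 (Finset.mem_sdiff.1 he').1
  have h2 : |∑ e ∈ A \ T, (y e - b) - ∑ e ∈ T \ A, (y e - b)| ≤ ∑ e ∈ D, y e + b * D.card := by
    have habs : ∀ e, |y e - b| ≤ y e + b := fun e => by
      rw [abs_le]; constructor <;> linarith [hy e]
    calc _ ≤ |∑ e ∈ A \ T, (y e - b)| + |∑ e ∈ T \ A, (y e - b)| := abs_sub _ _
      _ ≤ ∑ e ∈ A \ T, |y e - b| + ∑ e ∈ T \ A, |y e - b| :=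
          add_le_add (Finset.abs_sum_le_sum_abs _ _) (Finset.abs_sum_le_sum_abs _ _)
      _ = ∑ e ∈ A \ T ∪ T \ A, |y e - b| := (Finset.sum_union hdis).symm
      _ ≤ ∑ e ∈ A \ T ∪ T \ A, (y e + b) := Finset.sum_le_sum fun e _ => habs e
      _ ≤ ∑ e ∈ D, (y e + b) :=
          Finset.sum_le_sum_of_subset_of_nonneg hsub fun e _ _ => add_nonneg (hy e) hb
      _ = _ := by rw [Finset.sum_add_distrib, Finset.sum_const, nsmul_eq_mul, mul_comm b]
  have hTc : (T.card : ℝ) ≤ 2 * A.card := by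
    have h3 : T.card ≤ A.card + D.card :=
      calc T.card ≤ (A ∪ D).card := Finset.card_le_card fun e he => by
            by_cases h : e ∈ A
            · exact Finset.mem_union_left _ h
            · exact Finset.mem_union_right _ (hTA (Finset.mem_sdiff.2 ⟨he, h⟩))
        _ ≤ _ := Finset.card_union_le _ _
    have : (T.card : ℝ) ≤ A.card + D.card := by exact_mod_cast h3
    linarith
  have h4 : (∑ e ∈ A, y e) / A.card - b = (∑ e ∈ A, (y e - b)) / A.card := by
    rw [Finset.sum_sub_distrib, Finset.sum_const, nsmul_eq_mul]
    field_simp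
  rw [h4, abs_div, abs_of_pos hA, h1, div_le_iff₀ hA, add_mul, div_mul_cancel₀ _ hA.ne']
  refine (abs_add_le _ _).trans (add_le_add (hT.trans ?_) h2)
  calc δ * (T.card * b) ≤ δ * (2 * A.card * b) := by gcongr
    _ = _ := by ring

section LeaveOneOut

variable {n d K : ℕ} {i : Fin n}

lemma looB_eq (x : {j : Fin n // j ≠ i} → Network d) (o : InitOutput n d K i) (m : Fin 2)
    (k l : Fin K) :
    looB x o m k l =
      (∑ e ∈ (Finset.univ.filter fun j => o.1 j = m) ×ˢ block (o.2 m) s(k, l),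
        ((x e.1 e.2).toNat : ℝ)) /
      ((Finset.univ.filter fun j => o.1 j = m) ×ˢ block (o.2 m) s(k, l)).card := by
  simp only [looB, block, Finset.card_product, Finset.sum_product, Finset.sum_filter]
  congr 1
  rw [← Finset.sum_filter]
  simp

/-- The observations, among the layers other than the `i`-th, of the edges of a block of the `m`-th
component in the layers that truly belong to this component. -/
def trueBlock (θ : MMSBM n d K) (i : Fin n) (m : Fin 2) (c : Sym2 (Fin K)) :
    Finset ({j : Fin n // j ≠ i} × Edge d) :=
  (Finset.univ.filter fun j : {j : Fin n // j ≠ i} => θ.z j = m) ×ˢ block (θ.σ m) c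

lemma MMSBM.P_eq_of_mem_block {θ : MMSBM n d K} (hs : ∀ m, (θ.B m).IsSymm) {m : Fin 2}
    {k l : Fin K} {ω : Edge d} (hω : ω ∈ block (θ.σ m) s(k, l)) : θ.P m ω = θ.B m k l := by
  simp only [block, commPair, Finset.mem_filter, Finset.mem_univ, true_and, Sym2.eq_iff] at hω
  rcases hω with ⟨h1, h2⟩ | ⟨h1, h2⟩
  · rw [MMSBM.P, h1, h2]
  · rw [MMSBM.P, h1, h2, (hs m).apply]

/-- The numerical relations under which the leave-one-out estimates are analysed. All entries of
the probability matrices are of the order of `p`; `η` bounds the proportion of mislabelled layers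
and `η'` that of mislabelled nodes; `ε` is the relative precision that is aimed at. -/
structure Regime (θ : MMSBM n d K) (α β Γ p₀ Λ p I ε η η' : ℝ) : Prop where
  d_pos : 0 < d
  K_pos : 0 < K
  one_le_α : 1 ≤ α
  one_le_β : 1 ≤ β
  one_le_Γ : 1 ≤ Γ
  p_pos : 0 < p
  Λ_nonneg : 0 ≤ Λ
  I_nonneg : 0 ≤ I
  ε_pos : 0 < ε
  symm : ∀ m, (θ.B m).IsSymm
  B_lower : ∀ m k l, p ≤ Γ * θ.B m k l
  B_upper : ∀ m k l, θ.B m k l ≤ Γ * p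
  B_le : ∀ m k l, θ.B m k l ≤ p₀
  p₀_lt : p₀ < 1
  nodes_lower : ∀ m k, (d : ℝ) / (β * K) ≤ (Finset.univ.filter fun j => θ.σ m j = k).card
  nodes_upper : ∀ m k, ((Finset.univ.filter fun j => θ.σ m j = k).card : ℝ) ≤ β * d / K
  layers_lower : ∀ (i : Fin n) m,
    (n : ℝ) / (4 * α) ≤ (Finset.univ.filter fun j : {j : Fin n // j ≠ i} => θ.z j = m).card
  I_le : I ≤ Λ * (p * (d : ℝ) ^ 2)
  η'_nonneg : 0 ≤ η'
  η'_le : η' ≤ η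
  η_le : η * (p * (d : ℝ) ^ 2 * (K : ℝ) ^ 2) ≤ ε * I
  small_count : 64 * α * β ^ 4 * Λ * ε ≤ 1
  small_ratio : 16 * α * β ^ 2 * ε * (1 + Λ) * (Γ + 4 * β ^ 2) ≤ (1 - p₀) / 4
  small_noise : Λ * ε ≤ ((1 - p₀) / 8) ^ 2

/-- The properties of the layers other than the `i`-th on which the estimation of the edge
probabilities relies: the oracle frequencies are accurate, and no small set of layers or of nodes
carries too many edges. -/
structure Typical (θ : MMSBM n d K) (i : Fin n) (x : {j : Fin n // j ≠ i} → Network d)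
    (p I ε η η' : ℝ) : Prop where
  noise : ∀ m k l, |∑ e ∈ trueBlock θ i m s(k, l), (((x e.1 e.2).toNat : ℝ) - θ.B m k l)| ≤
    √(ε * I / (p * (d : ℝ) ^ 2)) * ((trueBlock θ i m s(k, l)).card * θ.B m k l)
  layers : ∀ V : Finset {j : Fin n // j ≠ i}, (V.card : ℝ) ≤ η * n →
    ∑ e ∈ V ×ˢ (Finset.univ : Finset (Edge d)), ((x e.1 e.2).toNat : ℝ) ≤ ε * n * I
  layers_block : ∀ V : Finset {j : Fin n // j ≠ i}, (V.card : ℝ) ≤ η * n → ∀ m k l,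
    ∑ e ∈ V ×ˢ block (θ.σ m) s(k, l), ((x e.1 e.2).toNat : ℝ) ≤
      ε * (n * (p * (d : ℝ) ^ 2) / (K : ℝ) ^ 2)
  nodes : ∀ W : Finset (Fin d), (W.card : ℝ) ≤ η' * d →
    ∑ e ∈ (Finset.univ : Finset {j : Fin n // j ≠ i}) ×ˢ touching W, ((x e.1 e.2).toNat : ℝ) ≤
      ε * (n * I / (K : ℝ) ^ 2)

end LeaveOneOut

/-! ### Estimated edge probabilities under an accurate initialization -/

section Deterministic

variable {n d K : ℕ} {i : Fin n} {θ : MMSBM n d K} {α β Γ p₀ Λ p I ε η η' : ℝ}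
  {x : {j : Fin n // j ≠ i} → Network d} {o : InitOutput n d K i}

/-- The layers that the initialization mislabels, when `π` matches the component names. -/
def badLayers (θ : MMSBM n d K) (o : InitOutput n d K i) (π : Equiv.Perm (Fin 2)) :
    Finset {j : Fin n // j ≠ i} :=
  Finset.univ.filter fun j => o.1 j ≠ π (θ.z j)

/-- The nodes that the initialization misplaces in the `m`-th component, when `π` matches the
component names and `τ` the community names. -/
def badNodes (θ : MMSBM n d K) (o : InitOutput n d K i) (π : Equiv.Perm (Fin 2))
    (τ : Equiv.Perm (Fin K)) (m : Fin 2) : Finset (Fin d) :=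
  Finset.univ.filter fun j => o.2 (π m) j ≠ τ (θ.σ m j)

/-- The layers and communities are labelled with few errors, up to the matchings `π` and `τ`. -/
structure Matched (θ : MMSBM n d K) (o : InitOutput n d K i) (η η' : ℝ) (π : Equiv.Perm (Fin 2))
    (τ : Fin 2 → Equiv.Perm (Fin K)) : Prop where
  layers : ((badLayers θ o π).card : ℝ) ≤ η * n
  nodes : ∀ m, ((badNodes θ o π (τ m) m).card : ℝ) ≤ η' * d

namespace Regime

lemma B_pos (R : Regime θ α β Γ p₀ Λ p I ε η η') (m : Fin 2) (k l : Fin K) : 0 < θ.B m k l := by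
  have h1 := R.B_lower m k l
  have h2 := R.p_pos
  have h3 := R.one_le_Γ
  by_contra h
  have := mul_nonpos_of_nonneg_of_nonpos (show 0 ≤ Γ by linarith) (not_lt.1 h)
  linarith

lemma η_nonneg (R : Regime θ α β Γ p₀ Λ p I ε η η') : 0 ≤ η := R.η'_nonneg.trans R.η'_le

lemma card_block_upper (R : Regime θ α β Γ p₀ Λ p I ε η η') (m : Fin 2) (k l : Fin K) :
    ((block (θ.σ m) s(k, l)).card : ℝ) ≤ 2 * β ^ 2 * (d : ℝ) ^ 2 / (K : ℝ) ^ 2 := by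
  have h : ((block (θ.σ m) s(k, l)).card : ℝ) ≤ 2 * (((Finset.univ.filter fun j => θ.σ m j = k).card
      : ℝ) * (Finset.univ.filter fun j => θ.σ m j = l).card) := by
    exact_mod_cast card_block_le (θ.σ m) k l
  have hβ := R.one_le_β
  calc _ ≤ _ := h
    _ ≤ 2 * ((β * d / K) * (β * d / K)) := by
        gcongr
        · exact R.nodes_upper m k
        · exact R.nodes_upper m l
    _ = _ := by ring

lemma card_block_lower (R : Regime θ α β Γ p₀ Λ p I ε η η') (m : Fin 2) (k l : Fin K) :
    (d : ℝ) ^ 2 / (2 * β ^ 2 * (K : ℝ) ^ 2) ≤ (block (θ.σ m) s(k, l)).card := by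
  have h : (((Finset.univ.filter fun j => θ.σ m j = k).card
      : ℝ) * (Finset.univ.filter fun j => θ.σ m j = l).card) ≤
      2 * ((block (θ.σ m) s(k, l)).card : ℝ) := by
    exact_mod_cast mul_le_card_block (θ.σ m) k l
  have hβ := R.one_le_β
  have h2 : ((d : ℝ) / (β * K)) * ((d : ℝ) / (β * K)) ≤
      ((Finset.univ.filter fun j => θ.σ m j = k).card : ℝ) *
        (Finset.univ.filter fun j => θ.σ m j = l).card :=
    mul_le_mul (R.nodes_lower m k) (R.nodes_lower m l) (by positivity) (by positivity)
  have hK : (0 : ℝ) < K := by exact_mod_cast R.K_pos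
  calc _ = ((d : ℝ) / (β * K)) * ((d : ℝ) / (β * K)) / 2 := by field_simp
    _ ≤ _ := by linarith

lemma card_trueBlock_lower (R : Regime θ α β Γ p₀ Λ p I ε η η') (i : Fin n) (m : Fin 2)
    (k l : Fin K) :
    n * (d : ℝ) ^ 2 / (8 * α * β ^ 2 * (K : ℝ) ^ 2) ≤ (trueBlock θ i m s(k, l)).card := by
  have hK : (0 : ℝ) < K := by exact_mod_cast R.K_pos
  have hα := R.one_le_α
  have hβ := R.one_le_β
  rw [trueBlock, Finset.card_product, Nat.cast_mul]
  calc _ = (n : ℝ) / (4 * α) * ((d : ℝ) ^ 2 / (2 * β ^ 2 * (K : ℝ) ^ 2)) := by field_simp; ring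
    _ ≤ _ := mul_le_mul (R.layers_lower i m) (R.card_block_lower m k l) (by positivity)
        (by positivity)

lemma η_mul_sq_le (R : Regime θ α β Γ p₀ Λ p I ε η η') : η * (K : ℝ) ^ 2 ≤ Λ * ε := by
  have hd : (0 : ℝ) < d := by exact_mod_cast R.d_pos
  have h1 := R.η_le
  have h2 := mul_le_mul_of_nonneg_left R.I_le R.ε_pos.le
  have h3 : 0 < p * (d : ℝ) ^ 2 := mul_pos R.p_pos (by positivity)
  refine le_of_mul_le_mul_right ?_ h3
  calc _ = η * (p * (d : ℝ) ^ 2 * (K : ℝ) ^ 2) := by ring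
    _ ≤ _ := h1
    _ ≤ _ := h2
    _ = _ := by ring

end Regime

/-- The observations that may be counted wrongly in the block `s(k, l)` of the `m`-th component. -/
def badCells (θ : MMSBM n d K) (o : InitOutput n d K i) (π : Equiv.Perm (Fin 2))
    (τ : Equiv.Perm (Fin K)) (m : Fin 2) (k l : Fin K) : Finset ({j : Fin n // j ≠ i} × Edge d) :=
  badLayers θ o π ×ˢ block (θ.σ m) s(k, l) ∪ Finset.univ ×ˢ touching (badNodes θ o π τ m)

lemma mem_block_iff_of_notMem_touching {π : Equiv.Perm (Fin 2)} {τ : Equiv.Perm (Fin K)}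
    {m : Fin 2} {ω : Edge d} (hω : ω ∉ touching (badNodes θ o π τ m)) (k l : Fin K) :
    ω ∈ block (o.2 (π m)) s(τ k, τ l) ↔ ω ∈ block (θ.σ m) s(k, l) := by
  simp only [touching, badNodes, Finset.mem_filter, Finset.mem_univ, true_and, not_or,
    not_not] at hω
  simp [block, commPair, hω.1, hω.2]

lemma sdiff_subset_badCells {π : Equiv.Perm (Fin 2)} {τ : Equiv.Perm (Fin K)} {m : Fin 2}
    (k l : Fin K) :
    ((Finset.univ.filter fun j => o.1 j = π m) ×ˢ block (o.2 (π m)) s(τ k, τ l)) \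
      trueBlock θ i m s(k, l) ⊆ badCells θ o π τ m k l ∧
    trueBlock θ i m s(k, l) \
      ((Finset.univ.filter fun j => o.1 j = π m) ×ˢ block (o.2 (π m)) s(τ k, τ l)) ⊆
      badCells θ o π τ m k l := by
  have key : ∀ e : {j : Fin n // j ≠ i} × Edge d, e ∉ badCells θ o π τ m k l →
      (e ∈ (Finset.univ.filter fun j => o.1 j = π m) ×ˢ block (o.2 (π m)) s(τ k, τ l) ↔
        e ∈ trueBlock θ i m s(k, l)) := by
    rintro ⟨j, ω⟩ he
    simp only [badCells, Finset.mem_union, Finset.mem_product, Finset.mem_univ, true_and,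
      not_or, not_and] at he
    have h1 := mem_block_iff_of_notMem_touching he.2 k l
    simp only [trueBlock, Finset.mem_product, Finset.mem_filter, Finset.mem_univ, true_and, h1]
    refine and_congr_left fun h2 => ?_
    have h3 : j ∉ badLayers θ o π := fun h => he.1 h h2
    simp only [badLayers, Finset.mem_filter, Finset.mem_univ, true_and, not_not] at h3
    rw [h3, π.injective.eq_iff]
  constructor
  · intro e he
    by_contra h
    exact (Finset.mem_sdiff.1 he).2 ((key e h).1 (Finset.mem_sdiff.1 he).1)
  · intro e he
    by_contra h
    exact (Finset.mem_sdiff.1 he).2 ((key e h).2 (Finset.mem_sdiff.1 he).1)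

lemma card_badCells_le (R : Regime θ α β Γ p₀ Λ p I ε η η') {π : Equiv.Perm (Fin 2)}
    {τ : Fin 2 → Equiv.Perm (Fin K)} (M : Matched θ o η η' π τ) (m : Fin 2) (k l : Fin K) :
    ((badCells θ o π (τ m) m k l).card : ℝ) ≤ 4 * β ^ 2 * η * (n * (d : ℝ) ^ 2) := by
  have hK : (1 : ℝ) ≤ K := by exact_mod_cast R.K_pos
  have hd : (0 : ℝ) < d := by exact_mod_cast R.d_pos
  have hβ := R.one_le_β
  have hη := R.η_nonneg
  have h1 : ((badLayers θ o π ×ˢ block (θ.σ m) s(k, l)).card : ℝ) ≤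
      2 * β ^ 2 * η * (n * (d : ℝ) ^ 2) := by
    rw [Finset.card_product, Nat.cast_mul]
    calc _ ≤ (η * n) * (2 * β ^ 2 * (d : ℝ) ^ 2 / (K : ℝ) ^ 2) :=
          mul_le_mul M.layers (R.card_block_upper m k l) (by positivity) (by positivity)
      _ ≤ (η * n) * (2 * β ^ 2 * (d : ℝ) ^ 2 / 1) := by
          gcongr
          exact one_le_pow₀ hK
      _ = _ := by ring
  have h2 : (((Finset.univ : Finset {j : Fin n // j ≠ i}) ×ˢ
      touching (badNodes θ o π (τ m) m)).card : ℝ) ≤ 2 * β ^ 2 * η * (n * (d : ℝ) ^ 2) := by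
    rw [Finset.card_product, Nat.cast_mul]
    have e1 : ((Finset.univ : Finset {j : Fin n // j ≠ i}).card : ℝ) ≤ n := by
      have := Finset.card_le_univ (Finset.univ.filter fun j : Fin n => j ≠ i)
      rw [Finset.card_univ, Fintype.card_subtype]
      rw [Fintype.card_fin] at this
      exact_mod_cast this
    have e2 : ((touching (badNodes θ o π (τ m) m)).card : ℝ) ≤ 2 * (η * d) * d := by
      have h3 : ((touching (badNodes θ o π (τ m) m)).card : ℝ) ≤
          2 * (badNodes θ o π (τ m) m).card * d := by exact_mod_cast card_touching_le _
      have h4 := (M.nodes m).trans (mul_le_mul_of_nonneg_right R.η'_le hd.le)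
      exact h3.trans (by gcongr)
    calc _ ≤ (n : ℝ) * (2 * (η * d) * d) := mul_le_mul e1 e2 (by positivity) (by positivity)
      _ = 2 * 1 ^ 2 * η * (n * (d : ℝ) ^ 2) := by ring
      _ ≤ _ := by gcongr
  have h3 : ((badCells θ o π (τ m) m k l).card : ℝ) ≤
      (badLayers θ o π ×ˢ block (θ.σ m) s(k, l)).card +
      ((Finset.univ : Finset {j : Fin n // j ≠ i}) ×ˢ touching (badNodes θ o π (τ m) m)).card := by
    exact_mod_cast Finset.card_union_le _ _
  linarith

lemma sum_badCells_le (T : Typical θ i x p I ε η η') {π : Equiv.Perm (Fin 2)}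
    {τ : Fin 2 → Equiv.Perm (Fin K)} (M : Matched θ o η η' π τ) (m : Fin 2) (k l : Fin K) :
    ∑ e ∈ badCells θ o π (τ m) m k l, ((x e.1 e.2).toNat : ℝ) ≤
      ∑ e ∈ badLayers θ o π ×ˢ block (θ.σ m) s(k, l), ((x e.1 e.2).toNat : ℝ) +
        ε * (n * I / (K : ℝ) ^ 2) := by
  have h := Finset.sum_union_inter (s₁ := badLayers θ o π ×ˢ block (θ.σ m) s(k, l))
    (s₂ := (Finset.univ : Finset {j : Fin n // j ≠ i}) ×ˢ touching (badNodes θ o π (τ m) m))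
    (f := fun e => ((x e.1 e.2).toNat : ℝ))
  have h2 := T.nodes _ (M.nodes m)
  have h3 : 0 ≤ ∑ e ∈ (badLayers θ o π ×ˢ block (θ.σ m) s(k, l)) ∩
    ((Finset.univ : Finset {j : Fin n // j ≠ i}) ×ˢ touching (badNodes θ o π (τ m) m)),
      ((x e.1 e.2).toNat : ℝ) := Finset.sum_nonneg fun e _ => by positivity
  rw [badCells]
  linarith

/-- A bound for the relative contribution of the wrongly labelled layers and nodes to an estimated
block probability. -/
def contamination (θ : MMSBM n d K) (x : {j : Fin n // j ≠ i} → Network d)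
    (o : InitOutput n d K i) (π : Equiv.Perm (Fin 2)) (α β I ε η : ℝ) (m : Fin 2) (k l : Fin K) :
    ℝ :=
  16 * α * β ^ 2 * (K : ℝ) ^ 2 / (n * (d : ℝ) ^ 2) *
    (∑ e ∈ badLayers θ o π ×ˢ block (θ.σ m) s(k, l), ((x e.1 e.2).toNat : ℝ) +
      ε * (n * I / (K : ℝ) ^ 2) + θ.B m k l * (4 * β ^ 2 * η * (n * (d : ℝ) ^ 2)))

lemma abs_looB_sub_le (R : Regime θ α β Γ p₀ Λ p I ε η η') (T : Typical θ i x p I ε η η')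
    {π : Equiv.Perm (Fin 2)} {τ : Fin 2 → Equiv.Perm (Fin K)} (M : Matched θ o η η' π τ)
    (m : Fin 2) (k l : Fin K) :
    |looB x o (π m) (τ m k) (τ m l) - θ.B m k l| ≤
      2 * √(ε * I / (p * (d : ℝ) ^ 2)) * θ.B m k l + contamination θ x o π α β I ε η m k l := by
  have hK : (0 : ℝ) < K := by exact_mod_cast R.K_pos
  have hd : (0 : ℝ) < d := by exact_mod_cast R.d_pos
  have hn : (0 : ℝ) < n := by exact_mod_cast i.pos
  have hα : 0 < α := by linarith [R.one_le_α]
  have hβ : 0 < β := by linarith [R.one_le_β]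
  have hB := R.B_pos m k l
  set A := (Finset.univ.filter fun j => o.1 j = π m) ×ˢ block (o.2 (π m)) s(τ m k, τ m l) with hA
  set S := trueBlock θ i m s(k, l) with hS
  set D := badCells θ o π (τ m) m k l with hD
  obtain ⟨hAS, hSA⟩ := sdiff_subset_badCells (θ := θ) (o := o) (π := π) (τ := τ m) (m := m) k l
  have hDc := card_badCells_le R M m k l
  have hSc := R.card_trueBlock_lower i m k l
  have hAc : S.card ≤ A.card + D.card :=
    calc S.card ≤ (A ∪ D).card := Finset.card_le_card fun e he => by
          by_cases h : e ∈ A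
          · exact Finset.mem_union_left _ h
          · exact Finset.mem_union_right _ (hSA (Finset.mem_sdiff.2 ⟨he, h⟩))
      _ ≤ _ := Finset.card_union_le _ _
  have hAc' : (S.card : ℝ) ≤ A.card + D.card := by exact_mod_cast hAc
  have hsmall : 4 * β ^ 2 * η * (n * (d : ℝ) ^ 2) ≤
      n * (d : ℝ) ^ 2 / (16 * α * β ^ 2 * (K : ℝ) ^ 2) := by
    rw [le_div_iff₀ (by positivity)]
    calc 4 * β ^ 2 * η * (n * (d : ℝ) ^ 2) * (16 * α * β ^ 2 * (K : ℝ) ^ 2) =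
        (64 * α * β ^ 4 * (η * (K : ℝ) ^ 2)) * (n * (d : ℝ) ^ 2) := by ring
      _ ≤ (64 * α * β ^ 4 * (Λ * ε)) * (n * (d : ℝ) ^ 2) :=
          mul_le_mul_of_nonneg_right (mul_le_mul_of_nonneg_left R.η_mul_sq_le (by positivity))
            (by positivity)
      _ = (64 * α * β ^ 4 * Λ * ε) * (n * (d : ℝ) ^ 2) := by ring
      _ ≤ 1 * (n * (d : ℝ) ^ 2) := by gcongr; exact R.small_count
      _ = _ := one_mul _
  have htwo : n * (d : ℝ) ^ 2 / (8 * α * β ^ 2 * (K : ℝ) ^ 2) =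
      2 * (n * (d : ℝ) ^ 2 / (16 * α * β ^ 2 * (K : ℝ) ^ 2)) := by
    field_simp; norm_num
  have hAlow : n * (d : ℝ) ^ 2 / (16 * α * β ^ 2 * (K : ℝ) ^ 2) ≤ A.card := by linarith
  have hApos : (0 : ℝ) < A.card := lt_of_lt_of_le (by positivity) hAlow
  have hmain := abs_frequency_sub_le (A := A) (T := S) (D := D)
    (y := fun e => ((x e.1 e.2).toNat : ℝ)) hAS hSA (fun e => by positivity) hB.le
    (Real.sqrt_nonneg _) (T.noise m k l) (by linarith) hApos
  rw [looB_eq]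
  refine hmain.trans (add_le_add_right ?_ _)
  rw [div_le_iff₀ hApos, contamination]
  have hsum := sum_badCells_le T M m k l
  set N := ∑ e ∈ badLayers θ o π ×ˢ block (θ.σ m) s(k, l), ((x e.1 e.2).toNat : ℝ) +
      ε * (n * I / (K : ℝ) ^ 2) + θ.B m k l * (4 * β ^ 2 * η * (n * (d : ℝ) ^ 2)) with hN
  have hDN : ∑ e ∈ D, ((x e.1 e.2).toNat : ℝ) + θ.B m k l * D.card ≤ N := by
    have := mul_le_mul_of_nonneg_left hDc hB.le
    linarith
  have hN0 : 0 ≤ N := le_trans (add_nonneg (Finset.sum_nonneg fun e _ => by positivity)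
    (by positivity)) hDN
  calc _ ≤ N := hDN
    _ = 16 * α * β ^ 2 * (K : ℝ) ^ 2 / (n * (d : ℝ) ^ 2) * N *
        (n * (d : ℝ) ^ 2 / (16 * α * β ^ 2 * (K : ℝ) ^ 2)) := by field_simp
    _ ≤ _ := by gcongr

lemma contamination_le (R : Regime θ α β Γ p₀ Λ p I ε η η') (T : Typical θ i x p I ε η η')
    {π : Equiv.Perm (Fin 2)} {τ : Fin 2 → Equiv.Perm (Fin K)} (M : Matched θ o η η' π τ)
    (m : Fin 2) (k l : Fin K) :
    contamination θ x o π α β I ε η m k l ≤ (1 - p₀) / 4 * θ.B m k l := by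
  have hK : (0 : ℝ) < K := by exact_mod_cast R.K_pos
  have hd : (0 : ℝ) < d := by exact_mod_cast R.d_pos
  have hn : (0 : ℝ) < n := by exact_mod_cast i.pos
  have hα : 0 < α := by linarith [R.one_le_α]
  have hβ : 0 < β := by linarith [R.one_le_β]
  have hB := R.B_pos m k l
  have hε := R.ε_pos
  have h1 := T.layers_block _ M.layers m k l
  have hΛ := R.Λ_nonneg
  have hp := R.p_pos
  rw [contamination]
  calc _ ≤ 16 * α * β ^ 2 * (K : ℝ) ^ 2 / (n * (d : ℝ) ^ 2) *
        (ε * (n * (p * (d : ℝ) ^ 2) / (K : ℝ) ^ 2) +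
          ε * (n * (Λ * (p * (d : ℝ) ^ 2)) / (K : ℝ) ^ 2) +
          θ.B m k l * (4 * β ^ 2 * η * (n * (d : ℝ) ^ 2))) := by
        gcongr
        exact R.I_le
    _ = 16 * α * β ^ 2 * (ε * p * (1 + Λ) + 4 * β ^ 2 * θ.B m k l * (η * (K : ℝ) ^ 2)) := by
        field_simp
    _ ≤ 16 * α * β ^ 2 * (ε * (Γ * θ.B m k l) * (1 + Λ) +
          4 * β ^ 2 * θ.B m k l * ((1 + Λ) * ε)) := by
        have e0 : η * (K : ℝ) ^ 2 ≤ (1 + Λ) * ε := R.η_mul_sq_le.trans (by linarith)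
        have e1 := mul_le_mul_of_nonneg_left e0 (show 0 ≤ 4 * β ^ 2 * θ.B m k l by positivity)
        have e2 := mul_le_mul_of_nonneg_left (R.B_lower m k l)
          (show 0 ≤ ε * (1 + Λ) by positivity)
        apply mul_le_mul_of_nonneg_left _ (by positivity)
        linarith
    _ = 16 * α * β ^ 2 * ε * (1 + Λ) * (Γ + 4 * β ^ 2) * θ.B m k l := by ring
    _ ≤ _ := by gcongr; exact R.small_ratio

lemma Regime.noise_le (R : Regime θ α β Γ p₀ Λ p I ε η η') :
    2 * √(ε * I / (p * (d : ℝ) ^ 2)) ≤ (1 - p₀) / 4 := by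
  have hd : (0 : ℝ) < d := by exact_mod_cast R.d_pos
  have h3 : 0 < p * (d : ℝ) ^ 2 := mul_pos R.p_pos (by positivity)
  have h : √(ε * I / (p * (d : ℝ) ^ 2)) ≤ (1 - p₀) / 8 := by
    apply Real.sqrt_le_iff.2 ⟨by linarith [R.p₀_lt], ?_⟩
    refine le_trans ?_ R.small_noise
    rw [div_le_iff₀ h3]
    have := mul_le_mul_of_nonneg_left R.I_le R.ε_pos.le
    linarith
  linarith

lemma abs_looB_sub_le_mul (R : Regime θ α β Γ p₀ Λ p I ε η η') (T : Typical θ i x p I ε η η')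
    {π : Equiv.Perm (Fin 2)} {τ : Fin 2 → Equiv.Perm (Fin K)} (M : Matched θ o η η' π τ)
    (m : Fin 2) (k l : Fin K) :
    |looB x o (π m) (τ m k) (τ m l) - θ.B m k l| ≤ (1 - p₀) / 2 * θ.B m k l := by
  have h1 := abs_looB_sub_le R T M m k l
  have h2 := contamination_le R T M m k l
  have h3 := mul_le_mul_of_nonneg_right R.noise_le (R.B_pos m k l).le
  linarith

/-- The estimated edge probabilities are of the right order and bounded away from one, even at
the edges of misplaced nodes. -/
lemma looP_bounds (R : Regime θ α β Γ p₀ Λ p I ε η η') (T : Typical θ i x p I ε η η')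
    {π : Equiv.Perm (Fin 2)} {τ : Fin 2 → Equiv.Perm (Fin K)} (M : Matched θ o η η' π τ)
    (m : Fin 2) (ω : Edge d) :
    p ≤ 2 * Γ * looP x o (π m) ω ∧ looP x o (π m) ω ≤ 2 * Γ * p ∧
      (1 - p₀) / 2 ≤ 1 - looP x o (π m) ω := by
  obtain ⟨k, hk⟩ := (τ m).surjective (o.2 (π m) ω.1.1)
  obtain ⟨l, hl⟩ := (τ m).surjective (o.2 (π m) ω.1.2)
  rw [looP, ← hk, ← hl]
  have h := abs_le.1 (abs_looB_sub_le_mul R T M m k l)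
  have h1 := R.B_lower m k l
  have h2 := R.B_upper m k l
  have h3 := R.B_le m k l
  have h4 := R.B_pos m k l
  have h5 := R.p₀_lt
  have h6 := R.one_le_Γ
  have hp0 : 0 < p₀ := h4.trans_le h3
  have h7 : (1 - p₀) / 2 * θ.B m k l ≤ 1 / 2 * θ.B m k l := by gcongr; linarith
  have h8 : (1 - p₀) / 2 * θ.B m k l ≤ (1 - p₀) / 2 * 1 := by gcongr; linarith
  refine ⟨?_, ?_, ?_⟩
  · have : 1 / 2 * θ.B m k l ≤ looB x o (π m) (τ m k) (τ m l) := by linarith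
    have := mul_le_mul_of_nonneg_left this (show 0 ≤ 2 * Γ by linarith)
    linarith
  · linarith
  · linarith

lemma sum_block_sum_le (R : Regime θ α β Γ p₀ Λ p I ε η η') (T : Typical θ i x p I ε η η')
    {π : Equiv.Perm (Fin 2)} {τ : Fin 2 → Equiv.Perm (Fin K)} (M : Matched θ o η η' π τ)
    (m : Fin 2) :
    ∑ ω : Edge d, ∑ e ∈ badLayers θ o π ×ˢ block (θ.σ m) s(θ.σ m ω.1.1, θ.σ m ω.1.2),
        ((x e.1 e.2).toNat : ℝ) ≤
      2 * β ^ 2 * (d : ℝ) ^ 2 / (K : ℝ) ^ 2 * (ε * n * I) := by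
  have h1 : ∀ ω : Edge d,
      ∑ e ∈ badLayers θ o π ×ˢ block (θ.σ m) s(θ.σ m ω.1.1, θ.σ m ω.1.2),
        ((x e.1 e.2).toNat : ℝ) =
      ∑ e ∈ badLayers θ o π ×ˢ (Finset.univ : Finset (Edge d)),
        if commPair (θ.σ m) ω = commPair (θ.σ m) e.2 then ((x e.1 e.2).toNat : ℝ) else 0 := by
    intro ω
    rw [Finset.sum_product, Finset.sum_product]
    refine Finset.sum_congr rfl fun j _ => ?_
    rw [block, Finset.sum_filter]
    refine Finset.sum_congr rfl fun e _ => ?_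
    exact if_congr eq_comm rfl rfl
  simp_rw [h1]
  rw [Finset.sum_comm]
  have h2 : ∀ e : {j : Fin n // j ≠ i} × Edge d,
      ∑ ω : Edge d, (if commPair (θ.σ m) ω = commPair (θ.σ m) e.2 then
        ((x e.1 e.2).toNat : ℝ) else 0) ≤
      2 * β ^ 2 * (d : ℝ) ^ 2 / (K : ℝ) ^ 2 * ((x e.1 e.2).toNat : ℝ) := by
    intro e
    rw [← Finset.sum_filter, Finset.sum_const, nsmul_eq_mul]
    have := R.card_block_upper m (θ.σ m e.2.1.1) (θ.σ m e.2.1.2)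
    exact mul_le_mul_of_nonneg_right this (by positivity)
  calc _ ≤ ∑ e ∈ badLayers θ o π ×ˢ (Finset.univ : Finset (Edge d)),
        2 * β ^ 2 * (d : ℝ) ^ 2 / (K : ℝ) ^ 2 * ((x e.1 e.2).toNat : ℝ) :=
        Finset.sum_le_sum fun e _ => h2 e
    _ = 2 * β ^ 2 * (d : ℝ) ^ 2 / (K : ℝ) ^ 2 *
        ∑ e ∈ badLayers θ o π ×ˢ (Finset.univ : Finset (Edge d)), ((x e.1 e.2).toNat : ℝ) := by
        rw [Finset.mul_sum]
    _ ≤ _ := by gcongr; exact T.layers _ M.layers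

/-- The `χ²`-type error of the estimated edge probabilities is a small fraction of the separation.
At the edges of correctly placed nodes, the oracle noise enters quadratically and the contamination
linearly; the edges of misplaced nodes are few. -/
lemma sum_sq_looP_sub_le (R : Regime θ α β Γ p₀ Λ p I ε η η') (T : Typical θ i x p I ε η η')
    {π : Equiv.Perm (Fin 2)} {τ : Fin 2 → Equiv.Perm (Fin K)} (M : Matched θ o η η' π τ)
    (m : Fin 2) :
    ∑ ω : Edge d, (looP x o (π m) ω - θ.P m ω) ^ 2 / θ.P m ω ≤
      (8 * Γ + 32 * α * β ^ 2 * (2 * β ^ 2 + 1) + 128 * α * β ^ 4 * Γ + 18 * Γ ^ 3) * (ε * I) := by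
  have hK : (0 : ℝ) < K := by exact_mod_cast R.K_pos
  have hK1 : (1 : ℝ) ≤ K := by exact_mod_cast R.K_pos
  have hd : (0 : ℝ) < d := by exact_mod_cast R.d_pos
  have hn : (0 : ℝ) < n := by exact_mod_cast i.pos
  have hα : 0 < α := by linarith [R.one_le_α]
  have hβ : 0 < β := by linarith [R.one_le_β]
  have hΓ : 0 < Γ := by linarith [R.one_le_Γ]
  have hp := R.p_pos
  have hη := R.η_nonneg
  have hε := R.ε_pos
  have hI := R.I_nonneg
  set W := badNodes θ o π (τ m) m with hW
  set δ := √(ε * I / (p * (d : ℝ) ^ 2)) with hδ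
  have hδ2 : δ ^ 2 * (p * (d : ℝ) ^ 2) = ε * I := by
    rw [hδ, Real.sq_sqrt (by positivity)]
    field_simp
  set M₀ := 16 * α * β ^ 2 * (K : ℝ) ^ 2 / (n * (d : ℝ) ^ 2) with hM₀
  set F : Edge d → ℝ := fun ω =>
    ∑ e ∈ badLayers θ o π ×ˢ block (θ.σ m) s(θ.σ m ω.1.1, θ.σ m ω.1.2), ((x e.1 e.2).toNat : ℝ)
    with hF
  set c₁ := 8 * δ ^ 2 * (Γ * p) + 2 * (M₀ * (ε * (n * I / (K : ℝ) ^ 2) +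
    (Γ * p) * (4 * β ^ 2 * η * (n * (d : ℝ) ^ 2)))) with hc₁
  have hpt : ∀ ω, (looP x o (π m) ω - θ.P m ω) ^ 2 / θ.P m ω ≤
      (c₁ + 2 * M₀ * F ω) + if ω ∈ touching W then 9 * Γ ^ 3 * p else 0 := by
    intro ω
    have hF0 : 0 ≤ F ω := Finset.sum_nonneg fun e _ => by positivity
    have hPpos : 0 < θ.P m ω := R.B_pos _ _ _
    have hPup : θ.P m ω ≤ Γ * p := R.B_upper _ _ _
    have hPlow : p ≤ Γ * θ.P m ω := R.B_lower _ _ _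
    have hc₁0 : 0 ≤ c₁ := by positivity
    rw [div_le_iff₀ hPpos]
    split_ifs with hω
    · obtain ⟨h1, h2, -⟩ := looP_bounds R T M m ω
      have h3 : 0 ≤ looP x o (π m) ω := by
        by_contra h
        have := mul_nonpos_of_nonneg_of_nonpos (show 0 ≤ 2 * Γ by linarith) (not_le.1 h).le
        linarith
      have h4 : (looP x o (π m) ω - θ.P m ω) ^ 2 ≤ (3 * (Γ * p)) ^ 2 := by
        apply sq_le_sq'
        · linarith
        · have : 0 < Γ * p := by positivity
          linarith
      calc _ ≤ (3 * (Γ * p)) ^ 2 := h4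
        _ = 9 * Γ ^ 2 * p * p := by ring
        _ ≤ 9 * Γ ^ 2 * p * (Γ * θ.P m ω) := by gcongr
        _ = (0 + 9 * Γ ^ 3 * p) * θ.P m ω := by ring
        _ ≤ _ := by gcongr; positivity
    · rw [add_zero]
      have hω' := hω
      simp only [touching, hW, badNodes, Finset.mem_filter, Finset.mem_univ, true_and, not_or,
        not_not] at hω'
      have h1 := abs_looB_sub_le R T M m (θ.σ m ω.1.1) (θ.σ m ω.1.2)
      have h2 := contamination_le R T M m (θ.σ m ω.1.1) (θ.σ m ω.1.2)
      have h3 : looP x o (π m) ω = looB x o (π m) (τ m (θ.σ m ω.1.1)) (τ m (θ.σ m ω.1.2)) := by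
        rw [looP, hω'.1, hω'.2]
      rw [h3]
      change |looB x o (π m) (τ m (θ.σ m ω.1.1)) (τ m (θ.σ m ω.1.2)) - θ.P m ω| ≤
        2 * δ * θ.P m ω + _ at h1
      set u := contamination θ x o π α β I ε η m (θ.σ m ω.1.1) (θ.σ m ω.1.2) with hu
      change u ≤ (1 - p₀) / 4 * θ.P m ω at h2
      have hu0 : 0 ≤ u := by
        have hB := R.B_pos m (θ.σ m ω.1.1) (θ.σ m ω.1.2)
        rw [hu, contamination]
        positivity
      have hp0 : 0 < p₀ := hPpos.trans_le (R.B_le _ _ _)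
      have hu1 : u ≤ θ.P m ω := h2.trans (by nlinarith)
      have huF : u ≤ M₀ * (F ω + ε * (n * I / (K : ℝ) ^ 2) +
          Γ * p * (4 * β ^ 2 * η * (n * (d : ℝ) ^ 2))) := by
        rw [hu, contamination]
        gcongr
        exact hPup
      have h0 := abs_nonneg (looB x o (π m) (τ m (θ.σ m ω.1.1)) (τ m (θ.σ m ω.1.2)) - θ.P m ω)
      have hsq := sq_le_sq' (by linarith) h1
      rw [sq_abs] at hsq
      calc _ ≤ (2 * δ * θ.P m ω + u) ^ 2 := hsq
        _ ≤ 8 * δ ^ 2 * θ.P m ω * θ.P m ω + 2 * (u * u) := by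
            linarith [sq_nonneg (2 * δ * θ.P m ω - u)]
        _ ≤ 8 * δ ^ 2 * (Γ * p) * θ.P m ω + 2 * (u * θ.P m ω) := by gcongr
        _ = (8 * δ ^ 2 * (Γ * p) + 2 * u) * θ.P m ω := by ring
        _ ≤ _ := by
            apply mul_le_mul_of_nonneg_right _ hPpos.le
            rw [hc₁]
            linarith
  have hFsum := sum_block_sum_le R T M m
  have hE := card_edge_le (d := d)
  have htouch : ((touching W).card : ℝ) ≤ 2 * (η * d) * d := by
    have h3 : ((touching W).card : ℝ) ≤ 2 * W.card * d := by exact_mod_cast card_touching_le _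
    have h4 := (M.nodes m).trans (mul_le_mul_of_nonneg_right R.η'_le hd.le)
    exact h3.trans (by gcongr)
  have hηd : η * (p * (d : ℝ) ^ 2) ≤ ε * I := by
    refine le_trans ?_ R.η_le
    rw [← mul_assoc η (p * (d : ℝ) ^ 2)]
    exact le_mul_of_one_le_right (by positivity) (one_le_pow₀ hK1)
  have hc₁0 : 0 ≤ c₁ := by positivity
  calc _ ≤ ∑ ω : Edge d, ((c₁ + 2 * M₀ * F ω) + if ω ∈ touching W then 9 * Γ ^ 3 * p else 0) :=
        Finset.sum_le_sum fun ω _ => hpt ω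
    _ = Fintype.card (Edge d) * c₁ + 2 * M₀ * ∑ ω, F ω +
        (touching W).card * (9 * Γ ^ 3 * p) := by
        rw [Finset.sum_add_distrib, Finset.sum_add_distrib, ← Finset.mul_sum,
          Finset.sum_ite_mem, Finset.univ_inter]
        simp
    _ ≤ (d : ℝ) ^ 2 * c₁ + 2 * M₀ * (2 * β ^ 2 * (d : ℝ) ^ 2 / (K : ℝ) ^ 2 * (ε * n * I)) +
        (2 * (η * d) * d) * (9 * Γ ^ 3 * p) := by gcongr
    _ = 8 * Γ * (δ ^ 2 * (p * (d : ℝ) ^ 2)) + 32 * α * β ^ 2 * (2 * β ^ 2 + 1) * (ε * I) +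
        128 * α * β ^ 4 * Γ * (η * (p * (d : ℝ) ^ 2 * (K : ℝ) ^ 2)) +
        18 * Γ ^ 3 * (η * (p * (d : ℝ) ^ 2)) := by
        rw [hc₁, hM₀]
        field_simp
        ring
    _ ≤ 8 * Γ * (ε * I) + 32 * α * β ^ 2 * (2 * β ^ 2 + 1) * (ε * I) +
        128 * α * β ^ 4 * Γ * (ε * I) + 18 * Γ ^ 3 * (ε * I) := by
        rw [hδ2]
        have e1 := mul_le_mul_of_nonneg_left R.η_le (show 0 ≤ 128 * α * β ^ 4 * Γ by positivity)
        have e2 := mul_le_mul_of_nonneg_left hηd (show 0 ≤ 18 * Γ ^ 3 by positivity)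
        linarith
    _ = _ := by ring

/-- An accurate initialization comes with matchings of the component and community names. -/
lemma exists_matched (hd : 0 < d) (hn : 0 < n) {ηz : ℝ} (hz : ηz ≤ η) {π : Equiv.Perm (Fin 2)}
    (h₁ : ((Finset.univ.filter fun j : {j : Fin n // j ≠ i} => o.1 j ≠ π (θ.z j)).card : ℝ) / n ≤ ηz)
    (h₂ : ∀ m, misclust (o.2 (π m)) (θ.σ m) ≤ η') :
    ∃ τ : Fin 2 → Equiv.Perm (Fin K), Matched θ o η η' π τ := by
  have hd' : (0 : ℝ) < d := by exact_mod_cast hd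
  have hn' : (0 : ℝ) < n := by exact_mod_cast hn
  have h : ∀ m, ∃ τ : Equiv.Perm (Fin K), ((badNodes θ o π τ m).card : ℝ) ≤ η' * d := by
    intro m
    obtain ⟨τ, hτ⟩ := exists_eq_ciInf_of_finite (f := fun τ : Equiv.Perm (Fin K) =>
      ((Finset.univ.filter fun j => o.2 (π m) j ≠ τ (θ.σ m j)).card : ℝ) / Fintype.card (Fin d))
    refine ⟨τ, ?_⟩
    have := h₂ m
    rw [misclust, ← hτ, Fintype.card_fin, div_le_iff₀ hd'] at this
    exact this
  choose τ hτ using h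
  refine ⟨τ, ?_, hτ⟩
  rw [div_le_iff₀ hn'] at h₁
  exact h₁.trans (by gcongr)

end Deterministic

/-! ### Alignment, the likelihood ratio test, and independence -/

section Alignment

variable {n d K : ℕ} {θ : MMSBM n d K}

/-- The labels of layer `i` are compared by their likelihoods: the wrong label `π (1 - zᵢ)` is at
least as likely as the right one `π zᵢ`. -/
def WrongPreferred (θ : MMSBM n d K) {i : Fin n} (x : {j : Fin n // j ≠ i} → Network d)
    (o : InitOutput n d K i) (π : Equiv.Perm (Fin 2)) (y : Network d) : Prop :=
  logLik (looP x o (π (θ.z i))) y ≤ logLik (looP x o (π (1 - θ.z i))) y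

lemma card_filter_fillLabel_ne_le {i : Fin n} (o : InitOutput n d K i) (c : Fin 2)
    (π : Equiv.Perm (Fin 2)) :
    (Finset.univ.filter fun j => fillLabel o c j ≠ π (θ.z j)).card ≤
      (badLayers θ o π).card + 1 := by
  have h : (Finset.univ.filter fun j => fillLabel o c j ≠ π (θ.z j)) ⊆
      insert i ((badLayers θ o π).map (Function.Embedding.subtype _)) := by
    intro j hj
    by_cases hji : j = i
    · rw [hji]
      exact Finset.mem_insert_self _ _
    · refine Finset.mem_insert_of_mem ?_
      simp only [fillLabel, Finset.mem_filter, Finset.mem_univ, true_and, ne_eq, hji,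
        not_false_eq_true, dite_true] at hj
      simp [badLayers, hji, hj]
  refine (Finset.card_le_card h).trans ((Finset.card_insert_le _ _).trans ?_)
  rw [Finset.card_map]

open Classical in
/-- After the alignment, the error of the two-stage algorithm is at most the proportion of layers
whose likelihood prefers the wrong label. -/
lemma misclust_le_of_isTwoStageOutput (hn : 0 < n) {x : Fin n → Network d}
    {o : ∀ i, InitOutput n d K i} {zhat : Fin n → Fin 2} (hout : IsTwoStageOutput x o zhat)
    (π : Fin n → Equiv.Perm (Fin 2)) {η : ℝ}
    (hV : ∀ i, ((badLayers θ (o i) (π i)).card : ℝ) ≤ η * n)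
    (hbal : ∀ m, 4 * (η * n) + 4 < (Finset.univ.filter fun j => θ.z j = m).card) :
    misclust zhat θ.z ≤
      (Finset.univ.filter fun i => WrongPreferred θ (fun j => x j) (o i) (π i) (x i)).card / n := by
  obtain ⟨c, hc, h1, h2⟩ := hout
  set i₁ : Fin n := ⟨0, hn⟩ with hi₁
  have key : ∀ i, c i = π i (θ.z i) → zhat i = π i₁ (θ.z i) := by
    intro i hci
    by_cases hi : (i : ℕ) = 0
    · have : i = i₁ := Fin.ext hi
      subst this
      rw [h1 _ hi, hci]
    by_contra hne
    have hmax := h2 i₁ i rfl hi (π i₁ (θ.z i))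
    set D₁ := Finset.univ.filter fun j => fillLabel (o i₁) (c i₁) j ≠ π i₁ (θ.z j) with hD₁
    set D₂ := Finset.univ.filter fun j => fillLabel (o i) (c i) j ≠ π i (θ.z j) with hD₂
    have hD : (D₁ ∪ D₂).card ≤ (badLayers θ (o i₁) (π i₁)).card + 1 +
        ((badLayers θ (o i) (π i)).card + 1) :=
      (Finset.card_union_le _ _).trans (add_le_add (card_filter_fillLabel_ne_le _ _ _)
        (card_filter_fillLabel_ne_le _ _ _))
    have hbig : (Finset.univ.filter fun j => θ.z j = θ.z i).card ≤
        (Finset.univ.filter fun j => fillLabel (o i₁) (c i₁) j = π i₁ (θ.z i) ∧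
          fillLabel (o i) (c i) j = c i).card + (D₁ ∪ D₂).card := by
      refine (Finset.card_le_card ?_).trans (Finset.card_union_le _ _)
      intro j hj
      simp only [Finset.mem_filter, Finset.mem_univ, true_and] at hj
      by_contra h
      simp only [hD₁, hD₂, Finset.mem_union, Finset.mem_filter, Finset.mem_univ, true_and, not_or,
        not_not] at h
      exact h.1 ⟨by rw [h.2.1, hj], by rw [h.2.2, hj, hci]⟩
    have hsmall : (Finset.univ.filter fun j => fillLabel (o i₁) (c i₁) j = zhat i ∧
          fillLabel (o i) (c i) j = c i).card ≤ (D₁ ∪ D₂).card := by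
      refine Finset.card_le_card ?_
      intro j hj
      simp only [Finset.mem_filter, Finset.mem_univ, true_and] at hj
      by_contra h
      simp only [hD₁, hD₂, Finset.mem_union, Finset.mem_filter, Finset.mem_univ, true_and, not_or,
        not_not] at h
      have h3 : θ.z j = θ.z i := (π i).injective (by rw [← h.2, hj.2, hci])
      exact hne (by rw [← hj.1, h.1, h3])
    have hle : (Finset.univ.filter fun j => θ.z j = θ.z i).card ≤
        2 * ((badLayers θ (o i₁) (π i₁)).card + 1 + ((badLayers θ (o i) (π i)).card + 1)) := by
      omega
    have hle' : ((Finset.univ.filter fun j => θ.z j = θ.z i).card : ℝ) ≤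
        2 * ((badLayers θ (o i₁) (π i₁)).card + 1 + ((badLayers θ (o i) (π i)).card + 1)) := by
      exact_mod_cast hle
    linarith [hbal (θ.z i), hV i, hV i₁]
  have hbdd : BddBelow (Set.range fun π : Equiv.Perm (Fin 2) =>
      ((Finset.univ.filter fun i => zhat i ≠ π (θ.z i)).card : ℝ) / Fintype.card (Fin n)) :=
    (Set.finite_range _).bddBelow
  refine (ciInf_le hbdd (π i₁)).trans ?_
  rw [Fintype.card_fin]
  refine div_le_div_of_nonneg_right (Nat.cast_le.2 (Finset.card_le_card
    (Finset.monotone_filter_right _ fun i _ hi => ?_))) (Nat.cast_nonneg _)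
  have hci : c i ≠ π i (θ.z i) := fun h => hi (key i h)
  have hother : c i = π i (1 - θ.z i) := by
    obtain ⟨m, hm⟩ := (π i).surjective (c i)
    have hmz : m ≠ θ.z i := fun h => hci (by rw [← hm, h])
    rw [← hm]
    congr 1
    generalize θ.z i = z at hmz
    fin_cases m <;> fin_cases z <;> simp_all
  have := hc i (π i (θ.z i))
  rwa [hother] at this

end Alignment

section LikelihoodRatio

variable {d : ℕ}

lemma logLik_eq_coe {Q : Edge d → ℝ} (hQ : ∀ ω, Q ω ∈ Set.Ioo (0 : ℝ) 1) (y : Network d) :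
    logLik Q y = ((∑ ω, if y ω = true then Real.log (Q ω) else Real.log (1 - Q ω) : ℝ) : EReal) := by
  have h : ∀ s : Finset (Edge d),
      (∑ ω ∈ s, if y ω = true then elog (Q ω) else elog (1 - Q ω)) =
      ((∑ ω ∈ s, if y ω = true then Real.log (Q ω) else Real.log (1 - Q ω) : ℝ) : EReal) := by
    classical
    intro s
    induction s using Finset.induction_on with
    | empty => simp
    | insert a s ha ih =>
      rw [Finset.sum_insert ha, Finset.sum_insert ha, ih, EReal.coe_add]
      congr 1
      split_ifs
      · exact ENNReal.log_ofReal_of_pos (hQ a).1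
      · exact ENNReal.log_ofReal_of_pos (by linarith [(hQ a).2])
  exact h _

/-- Chernoff's bound for the likelihood ratio test between the estimates `Q` and `Q'`, when the
edges have probabilities `P`. -/
lemma measureReal_logLik_le {Ω : Type*} [MeasurableSpace Ω] {μ : Measure Ω}
    [IsProbabilityMeasure μ] {Y : Edge d → Ω → Bool} {P Q Q' : Edge d → ℝ}
    (hY : ∀ e, Measurable (Y e)) (hind : iIndepFun Y μ)
    (hP : ∀ e, μ.real {w | Y e w = true} = P e) (hQ : ∀ ω, Q ω ∈ Set.Ioo (0 : ℝ) 1)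
    (hQ' : ∀ ω, Q' ω ∈ Set.Ioo (0 : ℝ) 1) :
    μ.real {w | logLik Q (fun e => Y e w) ≤ logLik Q' (fun e => Y e w)} ≤
      ∏ ω, chernoffFactor (P ω) (Q ω) (Q' ω) := by
  set φ : Edge d → Bool → ℝ := fun ω b =>
    if b = true then √(Q' ω / Q ω) else √((1 - Q' ω) / (1 - Q ω)) with hφ
  have hsqrt : ∀ a b : ℝ, 0 < a → 0 < b →
      √(b / a) = Real.exp ((Real.log b - Real.log a) / 2) := by
    intro a b ha hb
    rw [Real.sqrt_eq_rpow, Real.rpow_def_of_pos (by positivity), Real.log_div hb.ne' ha.ne']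
    ring_nf
  have h := mul_measureReal_le_prod_comp_bool hY hind hP φ
    (fun ω b => by simp only [hφ]; split_ifs <;> positivity) (c := 1)
    (s := {y | logLik Q y ≤ logLik Q' y}) ?_
  · rw [one_mul] at h
    refine h.trans_eq (Finset.prod_congr rfl fun ω _ => ?_)
    simp [hφ, chernoffFactor]
  · intro y hy
    change logLik Q y ≤ logLik Q' y at hy
    rw [logLik_eq_coe hQ, logLik_eq_coe hQ', EReal.coe_le_coe_iff] at hy
    have h2 : ∀ ω, φ ω (y ω) = Real.exp (((if y ω = true then Real.log (Q' ω) else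
        Real.log (1 - Q' ω)) - (if y ω = true then Real.log (Q ω) else Real.log (1 - Q ω))) / 2) := by
      intro ω
      simp only [hφ]
      split_ifs
      · exact hsqrt _ _ (hQ ω).1 (hQ' ω).1
      · exact hsqrt _ _ (by linarith [(hQ ω).2]) (by linarith [(hQ' ω).2])
    simp_rw [h2]
    rw [← Real.exp_sum, Real.one_le_exp_iff, ← Finset.sum_div, Finset.sum_sub_distrib]
    linarith

end LikelihoodRatio

section Independence

variable {Ω : Type*} [MeasurableSpace Ω] {μ : Measure Ω}

/-- If `U` is independent of `(Y, X)` and `Y` of `X`, then `(U, Y)` is independent of `X`. -/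
lemma indepFun_prodMk_of_indepFun_prodMk [IsProbabilityMeasure μ] {α β γ : Type*} [MeasurableSpace α] [MeasurableSpace β]
    [MeasurableSpace γ] {U : Ω → α} {Y : Ω → β} {X : Ω → γ} (hU : Measurable U)
    (hY : Measurable Y) (hX : Measurable X) (hUYX : IndepFun U (fun w => (Y w, X w)) μ)
    (hYX : IndepFun Y X μ) : IndepFun (fun w => (U w, Y w)) X μ := by
  have hUY : IndepFun U Y μ := hUYX.comp measurable_id measurable_fst
  have hPU := Measure.isProbabilityMeasure_map (μ := μ) hU.aemeasurable
  have hPY := Measure.isProbabilityMeasure_map (μ := μ) hY.aemeasurable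
  have hPX := Measure.isProbabilityMeasure_map (μ := μ) hX.aemeasurable
  rw [indepFun_iff_map_prod_eq_prod_map_map (by fun_prop) (by fun_prop)] at hUYX hYX hUY ⊢
  rw [hYX, ← Measure.prodAssoc_prod] at hUYX
  rw [hUY]
  have h : Measure.map MeasurableEquiv.prodAssoc (Measure.map (fun w => ((U w, Y w), X w)) μ) =
      Measure.map (fun w => (U w, (Y w, X w))) μ := by
    rw [Measure.map_map (by fun_prop) (by fun_prop)]
    rfl
  exact (MeasurableEquiv.prodAssoc.map_measurableEquiv_injective (h.trans hUYX))

/-- A bound that holds for every value of an independent variable with finitely many values. -/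
lemma measureReal_le_of_indepFun [IsProbabilityMeasure μ] {α β : Type*} [Finite α] [MeasurableSpace α]
    [MeasurableSingletonClass α] [MeasurableSpace β] {Y : Ω → α} {X : Ω → β}
    (hY : Measurable Y) (h : IndepFun Y X μ) (T : Set α) (R : α → Set β)
    (hR : ∀ y, MeasurableSet (R y)) {c : ℝ} (hc : ∀ y ∈ T, μ.real {w | X w ∈ R y} ≤ c)
    (hc0 : 0 ≤ c) :
    μ.real {w | Y w ∈ T ∧ X w ∈ R (Y w)} ≤ c := by
  classical
  have := Fintype.ofFinite α
  have hsub : {w | Y w ∈ T ∧ X w ∈ R (Y w)} ⊆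
      ⋃ y ∈ (Finset.univ.filter fun y => y ∈ T), (Y ⁻¹' {y} ∩ X ⁻¹' R y) := by
    intro w hw
    simp only [Set.mem_iUnion]
    exact ⟨Y w, by simpa using hw.1, rfl, hw.2⟩
  have hsum : ∑ y, μ.real (Y ⁻¹' {y}) = 1 := by
    have h1 := measureReal_biUnion_finset (μ := μ) (s := (Finset.univ : Finset α))
      (f := fun y => Y ⁻¹' {y}) (fun y _ y' _ hne => Set.disjoint_left.2 fun w hw hw' => hne
        (hw.symm.trans hw')) (fun y _ => hY (measurableSet_singleton y))
    rw [← h1]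
    have : (⋃ y ∈ (Finset.univ : Finset α), Y ⁻¹' {y}) = Set.univ := by
      ext w; simp
    rw [this, probReal_univ]
  calc _ ≤ μ.real (⋃ y ∈ (Finset.univ.filter fun y => y ∈ T), (Y ⁻¹' {y} ∩ X ⁻¹' R y)) :=
        measureReal_mono hsub (measure_ne_top _ _)
    _ ≤ ∑ y ∈ Finset.univ.filter fun y => y ∈ T, μ.real (Y ⁻¹' {y} ∩ X ⁻¹' R y) :=
        measureReal_biUnion_finset_le _ _
    _ ≤ ∑ y ∈ Finset.univ.filter fun y => y ∈ T, μ.real (Y ⁻¹' {y}) * c := by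
        refine Finset.sum_le_sum fun y hy => ?_
        have h1 := h.measure_inter_preimage_eq_mul _ _ (measurableSet_singleton y) (hR y)
        rw [measureReal_def, h1, ENNReal.toReal_mul]
        exact mul_le_mul_of_nonneg_left (hc y (by simpa using hy)) ENNReal.toReal_nonneg
    _ ≤ ∑ y, μ.real (Y ⁻¹' {y}) * c :=
        Finset.sum_le_sum_of_subset_of_nonneg (Finset.filter_subset _ _) fun y _ _ =>
          mul_nonneg measureReal_nonneg hc0
    _ = c := by rw [← Finset.sum_mul, hsum, one_mul]

namespace MMSBM.IsSample

variable {n d K : ℕ} {θ : MMSBM n d K} {X : Fin n → Ω → Network d}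

lemma measurable_apply (hX : θ.IsSample μ X) (i : Fin n) (ω : Edge d) :
    Measurable fun w => X i w ω := (measurable_pi_apply ω).comp (hX.measurable i)

lemma iIndepFun_rest (hX : θ.IsSample μ X) (i : Fin n) :
    iIndepFun (fun (e : {j : Fin n // j ≠ i} × Edge d) w => X e.1 w e.2) μ :=
  hX.indep.precomp (g := fun e : {j : Fin n // j ≠ i} × Edge d => ((e.1 : Fin n), e.2))
    (fun e e' h => by
      simp only [Prod.mk.injEq] at h
      exact Prod.ext (Subtype.ext h.1) h.2)

lemma indepFun_rest (hX : θ.IsSample μ X) (i : Fin n) :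
    IndepFun (fun w (j : {j : Fin n // j ≠ i}) => X j w) (X i) μ := by
  classical
  have h := hX.indep.indepFun_finset (Finset.univ.filter fun e : Fin n × Edge d => e.1 ≠ i)
    (Finset.univ.filter fun e : Fin n × Edge d => e.1 = i)
    (Finset.disjoint_left.2 fun e he he' => (Finset.mem_filter.1 he).2 (Finset.mem_filter.1 he').2)
    (fun e => hX.measurable_apply e.1 e.2)
  exact h.comp (φ := fun f (j : {j : Fin n // j ≠ i}) (ω : Edge d) =>
      f ⟨((j : Fin n), ω), Finset.mem_filter.2 ⟨Finset.mem_univ _, j.2⟩⟩)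
    (ψ := fun f (ω : Edge d) => f ⟨(i, ω), Finset.mem_filter.2 ⟨Finset.mem_univ _, rfl⟩⟩)
    (by fun_prop) (by fun_prop)

lemma indepFun_seed_rest [IsProbabilityMeasure μ] (hX : θ.IsSample μ X) {S : Type*} [MeasurableSpace S] {U : Ω → S}
    (hU : Measurable U) (hUX : IndepFun U (fun w i => X i w) μ) (i : Fin n) :
    IndepFun (fun w => (U w, fun (j : {j : Fin n // j ≠ i}) => X j w)) (X i) μ := by
  refine indepFun_prodMk_of_indepFun_prodMk hU
    (measurable_pi_lambda _ fun j => hX.measurable j) (hX.measurable i) ?_ (hX.indepFun_rest i)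
  exact hUX.comp (φ := id)
    (ψ := fun f => ((fun (j : {j : Fin n // j ≠ i}) => f j), f i)) measurable_id (by fun_prop)

end MMSBM.IsSample

end Independence

/-! ### Probability of typical layers, and the error of a single layer -/

section Typicality

variable {Ω : Type*} [MeasurableSpace Ω] {μ : Measure Ω} {n d K : ℕ} {θ : MMSBM n d K}
  {α β Γ p₀ Λ p I ε η η' : ℝ} {X : Fin n → Ω → Network d}

lemma card_subtype_ne_le (i : Fin n) : (Fintype.card {j : Fin n // j ≠ i} : ℝ) ≤ n := by
  have := Fintype.card_subtype_le fun j : Fin n => j ≠ i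
  rw [Fintype.card_fin] at this
  exact_mod_cast this

/-- A union bound over a family of cells with few edges in expectation. The parameter `y` is the
exponent of the exponential moment. -/
lemma measureReal_exists_sum_gt_le [IsProbabilityMeasure μ] (hX : θ.IsSample μ X) (i : Fin n)
    {κ : Type*} (F : Finset κ) (A : κ → Finset ({j : Fin n // j ≠ i} × Edge d)) {y t l L Q : ℝ}
    (hy : 0 ≤ y) (hF : (F.card : ℝ) ≤ Real.exp L)
    (hA : ∀ V ∈ F, ∑ e ∈ A V, θ.P (θ.z e.1) e.2 ≤ l)
    (hQ : L + (Real.exp y - 1) * l + Q ≤ y * t) :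
    μ.real {w | ∃ V ∈ F, t < ∑ e ∈ A V, ((X e.1 w e.2).toNat : ℝ)} ≤ Real.exp (-Q) := by
  classical
  have hsub : {w | ∃ V ∈ F, t < ∑ e ∈ A V, ((X e.1 w e.2).toNat : ℝ)} ⊆
      ⋃ V ∈ F, {w | t < ∑ e ∈ A V, ((X e.1 w e.2).toNat : ℝ)} := by
    rintro w ⟨V, hV, h⟩
    simp only [Set.mem_iUnion]
    exact ⟨V, hV, h⟩
  have hone : ∀ V ∈ F, μ.real {w | t < ∑ e ∈ A V, ((X e.1 w e.2).toNat : ℝ)} ≤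
      Real.exp (-(y * t) + (Real.exp y - 1) * l) := by
    intro V hV
    have h := measureReal_exp_sum_le (Y := fun (e : {j : Fin n // j ≠ i} × Edge d) w => X e.1 w e.2)
      (fun e => hX.measurable_apply e.1 e.2) (hX.iIndepFun_rest i) (fun e => hX.prob e.1 e.2) (A V) y t
      (s := {x | t < ∑ e ∈ A V, ((x e).toNat : ℝ)})
      (fun x hx => mul_le_mul_of_nonneg_left (le_of_lt hx) hy)
    refine h.trans (Real.exp_le_exp.2 ?_)
    have := mul_le_mul_of_nonneg_left (hA V hV) (show 0 ≤ Real.exp y - 1 by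
      linarith [Real.add_one_le_exp y])
    linarith
  calc _ ≤ μ.real (⋃ V ∈ F, {w | t < ∑ e ∈ A V, ((X e.1 w e.2).toNat : ℝ)}) :=
        measureReal_mono hsub (measure_ne_top _ _)
    _ ≤ ∑ V ∈ F, μ.real {w | t < ∑ e ∈ A V, ((X e.1 w e.2).toNat : ℝ)} :=
        measureReal_biUnion_finset_le _ _
    _ ≤ ∑ V ∈ F, Real.exp (-(y * t) + (Real.exp y - 1) * l) := Finset.sum_le_sum hone
    _ = F.card * Real.exp (-(y * t) + (Real.exp y - 1) * l) := by
        rw [Finset.sum_const, nsmul_eq_mul]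
    _ ≤ Real.exp L * Real.exp (-(y * t) + (Real.exp y - 1) * l) := by gcongr
    _ ≤ _ := by
        rw [← Real.exp_add]
        exact Real.exp_le_exp.2 (by linarith)

/-- A sum of at most `c` edge probabilities is at most `c Γ p`. -/
lemma Regime.sum_P_le (R : Regime θ α β Γ p₀ Λ p I ε η η') {i : Fin n}
    (A : Finset ({j : Fin n // j ≠ i} × Edge d)) {c : ℝ} (hc : (A.card : ℝ) ≤ c) :
    ∑ e ∈ A, θ.P (θ.z e.1) e.2 ≤ c * (Γ * p) := by
  have h0 : 0 ≤ Γ * p := mul_nonneg (by linarith [R.one_le_Γ]) R.p_pos.le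
  calc _ ≤ ∑ e ∈ A, Γ * p := Finset.sum_le_sum fun e _ => R.B_upper _ _ _
    _ = A.card * (Γ * p) := by rw [Finset.sum_const, nsmul_eq_mul]
    _ ≤ _ := by gcongr

/-- The oracle frequency of a block is accurate: Bernstein's inequality at the relative deviation
`√(ε I / (p d²))`. -/
lemma measureReal_noise_le [IsProbabilityMeasure μ] (hX : θ.IsSample μ X)
    (R : Regime θ α β Γ p₀ Λ p I ε η η') (i : Fin n) {Q : ℝ}
    (hQ : Q ≤ ε * (n * I / (K : ℝ) ^ 2) / (32 * α * β ^ 2 * Γ)) (m : Fin 2) (k l : Fin K) :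
    μ.real {w | √(ε * I / (p * (d : ℝ) ^ 2)) * ((trueBlock θ i m s(k, l)).card * θ.B m k l) <
      |∑ e ∈ trueBlock θ i m s(k, l), (((X e.1 w e.2).toNat : ℝ) - θ.B m k l)|} ≤
      2 * Real.exp (-Q) := by
  classical
  have hK : (0 : ℝ) < K := by exact_mod_cast R.K_pos
  have hd : (0 : ℝ) < d := by exact_mod_cast R.d_pos
  have hα : 0 < α := by linarith [R.one_le_α]
  have hβ : 0 < β := by linarith [R.one_le_β]
  have hΓ : 0 < Γ := by linarith [R.one_le_Γ]
  have hp := R.p_pos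
  have hI := R.I_nonneg
  have hε := R.ε_pos
  set δ := √(ε * I / (p * (d : ℝ) ^ 2)) with hδ
  have hδ0 : 0 ≤ δ := Real.sqrt_nonneg _
  have hp0 : 0 < p₀ := (R.B_pos m k l).trans_le (R.B_le m k l)
  have hδ1 : δ ≤ 1 := by linarith [R.noise_le]
  have hδ2 : δ ^ 2 * (p * (d : ℝ) ^ 2) = ε * I := by
    rw [hδ, Real.sq_sqrt (by positivity)]
    field_simp
  have hPB : ∀ e ∈ trueBlock θ i m s(k, l), θ.P (θ.z e.1) e.2 = θ.B m k l := by
    intro e he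
    simp only [trueBlock, Finset.mem_product, Finset.mem_filter, Finset.mem_univ, true_and] at he
    rw [he.1, MMSBM.P_eq_of_mem_block R.symm he.2]
  have h := measureReal_abs_sum_sub_le (Y := fun (e : {j : Fin n // j ≠ i} × Edge d) w =>
    X e.1 w e.2) (fun e => hX.measurable_apply e.1 e.2) (hX.iIndepFun_rest i) (fun e => hX.prob e.1 e.2)
    (trueBlock θ i m s(k, l)) hδ0 hδ1
  have hsum : ∑ e ∈ trueBlock θ i m s(k, l), θ.P (θ.z e.1) e.2 =
      (trueBlock θ i m s(k, l)).card * θ.B m k l := by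
    rw [Finset.sum_congr rfl hPB, Finset.sum_const, nsmul_eq_mul]
  rw [hsum] at h
  refine le_trans (measureReal_mono (fun w hw => ?_) (measure_ne_top _ _)) (h.trans ?_)
  · simp only [Set.mem_ofPred_eq] at hw ⊢
    refine hw.le.trans_eq ?_
    congr 1
    exact Finset.sum_congr rfl fun e he => by rw [hPB e he]
  · gcongr
    have h1 := R.card_trueBlock_lower i m k l
    have h2 : n * (d : ℝ) ^ 2 / (8 * α * β ^ 2 * (K : ℝ) ^ 2) * (p / Γ) ≤
        (trueBlock θ i m s(k, l)).card * θ.B m k l := by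
      refine mul_le_mul h1 ?_ (by positivity) (by positivity)
      rw [div_le_iff₀ hΓ]
      linarith [R.B_lower m k l]
    have h3 : δ ^ 2 / 4 * (n * (d : ℝ) ^ 2 / (8 * α * β ^ 2 * (K : ℝ) ^ 2) * (p / Γ)) =
        ε * (n * I / (K : ℝ) ^ 2) / (32 * α * β ^ 2 * Γ) := by
      calc _ = (δ ^ 2 * (p * (d : ℝ) ^ 2)) * n / (K : ℝ) ^ 2 / (32 * α * β ^ 2 * Γ) := by
            field_simp; ring
        _ = _ := by rw [hδ2]; ring
    have h4 := mul_le_mul_of_nonneg_left h2 (show 0 ≤ δ ^ 2 / 4 by positivity)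
    linarith

/-- The layers other than the `i`-th are typical with high probability. In `h₂`, the exponential
moment is taken at `log (1 / η)`, so that the entropy of the choice of a proportion `η` of the
layers is dominated even when a block has few edges per layer. -/
lemma measureReal_not_typical_le [IsProbabilityMeasure μ] (hX : θ.IsSample μ X)
    (R : Regime θ α β Γ p₀ Λ p I ε η η') (i : Fin n) {Q : ℝ} (hη0 : 0 < η) (hη1 : η ≤ 1)
    (h₀ : Q ≤ ε * (n * I / (K : ℝ) ^ 2) / (32 * α * β ^ 2 * Γ))
    (h₁ : n + 2 * Γ * (η * n * (p * (d : ℝ) ^ 2)) + Q ≤ ε * n * I)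
    (h₂ : η * n * (1 + Real.log (1 / η)) + 2 * β ^ 2 * Γ * (n * (p * (d : ℝ) ^ 2) / (K : ℝ) ^ 2) +
      Q ≤ Real.log (1 / η) * (ε * (n * (p * (d : ℝ) ^ 2) / (K : ℝ) ^ 2)))
    (h₃ : η' * d * (1 + Real.log (1 / η')) + 4 * Γ * (η * n * (p * (d : ℝ) ^ 2)) + Q ≤
      ε * (n * I / (K : ℝ) ^ 2)) :
    μ.real {w | ¬ Typical θ i (fun j => X j w) p I ε η η'} ≤ 8 * (K : ℝ) ^ 2 * Real.exp (-Q) := by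
  classical
  have hK : (1 : ℝ) ≤ K := by exact_mod_cast R.K_pos
  have hd : (0 : ℝ) < d := by exact_mod_cast R.d_pos
  have hβ : 0 < β := by linarith [R.one_le_β]
  have hΓ : 0 < Γ := by linarith [R.one_le_Γ]
  have hp := R.p_pos
  have hη'1 : η' ≤ 1 := R.η'_le.trans hη1
  set FV := Finset.univ.filter fun V : Finset {j : Fin n // j ≠ i} => (V.card : ℝ) ≤ η * n with hFV
  set FW := Finset.univ.filter fun W : Finset (Fin d) => (W.card : ℝ) ≤ η' * d with hFW
  have hFVc : (FV.card : ℝ) ≤ Real.exp (η * n * (1 + Real.log (1 / η))) :=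
    card_filter_card_le hη0.le hη1 (card_subtype_ne_le i)
  have hFWc : (FW.card : ℝ) ≤ Real.exp (η' * d * (1 + Real.log (1 / η'))) :=
    card_filter_card_le R.η'_nonneg hη'1 (by simp)
  have hV : ∀ V ∈ FV, (V.card : ℝ) ≤ η * n := fun V hV => (Finset.mem_filter.1 hV).2
  have hW : ∀ W ∈ FW, (W.card : ℝ) ≤ η' * d := fun W hW => (Finset.mem_filter.1 hW).2
  have hexp1 : Real.exp 1 - 1 ≤ 2 := by linarith [Real.exp_one_lt_d9]
  have hent : η * n * (1 + Real.log (1 / η)) ≤ n := by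
    have h := Real.log_le_sub_one_of_pos (show 0 < 1 / η by positivity)
    have h' := mul_le_mul_of_nonneg_left h hη0.le
    have e : η * (1 / η) = 1 := by field_simp
    have h'' : η * (1 + Real.log (1 / η)) ≤ 1 := by linarith
    have := mul_le_mul_of_nonneg_right h'' (Nat.cast_nonneg (α := ℝ) n)
    linarith
  -- all edges of the mislabelled layers
  have p₁ := measureReal_exists_sum_gt_le hX i FV
    (fun V => V ×ˢ (Finset.univ : Finset (Edge d))) (y := 1) (t := ε * n * I)
    (l := η * n * (d : ℝ) ^ 2 * (Γ * p)) (Q := Q) zero_le_one hFVc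
    (fun V hv => R.sum_P_le _ (by
      rw [Finset.card_product, Nat.cast_mul]
      exact mul_le_mul (hV V hv) card_edge_le (by positivity) (by positivity)))
    (by
      have := mul_le_mul_of_nonneg_right hexp1
        (show 0 ≤ η * n * (d : ℝ) ^ 2 * (Γ * p) by positivity)
      linarith)
  -- the edges of a given block in the mislabelled layers
  have p₂ : ∀ m k l, μ.real {w | ∃ V ∈ FV, ε * (n * (p * (d : ℝ) ^ 2) / (K : ℝ) ^ 2) <
      ∑ e ∈ V ×ˢ block (θ.σ m) s(k, l), ((X e.1 w e.2).toNat : ℝ)} ≤ Real.exp (-Q) := by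
    intro m k l
    refine measureReal_exists_sum_gt_le hX i FV (fun V => V ×ˢ block (θ.σ m) s(k, l))
      (y := Real.log (1 / η)) (l := η * n * (2 * β ^ 2 * (d : ℝ) ^ 2 / (K : ℝ) ^ 2) * (Γ * p))
      (Real.log_nonneg (by rw [le_div_iff₀ hη0]; linarith)) hFVc
      (fun V hv => R.sum_P_le _ (by
        rw [Finset.card_product, Nat.cast_mul]
        exact mul_le_mul (hV V hv) (R.card_block_upper m k l) (by positivity) (by positivity))) ?_
    rw [Real.exp_log (by positivity)]
    have e1 : 1 / η * (η * n * (2 * β ^ 2 * (d : ℝ) ^ 2 / (K : ℝ) ^ 2) * (Γ * p)) =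
        2 * β ^ 2 * Γ * (n * (p * (d : ℝ) ^ 2) / (K : ℝ) ^ 2) := by
      field_simp
    have e2 : 0 ≤ η * n * (2 * β ^ 2 * (d : ℝ) ^ 2 / (K : ℝ) ^ 2) * (Γ * p) := by positivity
    linarith
  -- the edges of the misplaced nodes
  have p₃ := measureReal_exists_sum_gt_le hX i FW
    (fun W => (Finset.univ : Finset {j : Fin n // j ≠ i}) ×ˢ touching W) (y := 1)
    (t := ε * (n * I / (K : ℝ) ^ 2)) (l := n * (2 * (η * d) * d) * (Γ * p)) (Q := Q)
    zero_le_one hFWc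
    (fun W hw => R.sum_P_le _ (by
      rw [Finset.card_product, Nat.cast_mul]
      have h3 : ((touching W).card : ℝ) ≤ 2 * W.card * d := by exact_mod_cast card_touching_le _
      have h4 := (hW W hw).trans (mul_le_mul_of_nonneg_right R.η'_le hd.le)
      exact mul_le_mul (by simp) (h3.trans (by gcongr))
        (by positivity) (by positivity)))
    (by
      have := mul_le_mul_of_nonneg_right hexp1
        (show 0 ≤ n * (2 * (η * d) * d) * (Γ * p) by positivity)
      linarith)
  have p₀' := measureReal_noise_le hX R i h₀
  set E₀ : Fin 2 × Fin K × Fin K → Set Ω := fun c =>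
    {w | √(ε * I / (p * (d : ℝ) ^ 2)) *
        ((trueBlock θ i c.1 s(c.2.1, c.2.2)).card * θ.B c.1 c.2.1 c.2.2) <
      |∑ e ∈ trueBlock θ i c.1 s(c.2.1, c.2.2),
        (((X e.1 w e.2).toNat : ℝ) - θ.B c.1 c.2.1 c.2.2)|} with hE₀
  set E₂ : Fin 2 × Fin K × Fin K → Set Ω := fun c =>
    {w | ∃ V ∈ FV, ε * (n * (p * (d : ℝ) ^ 2) / (K : ℝ) ^ 2) <
      ∑ e ∈ V ×ˢ block (θ.σ c.1) s(c.2.1, c.2.2), ((X e.1 w e.2).toNat : ℝ)} with hE₂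
  set E₁ := {w | ∃ V ∈ FV, ε * n * I <
    ∑ e ∈ V ×ˢ (Finset.univ : Finset (Edge d)), ((X e.1 w e.2).toNat : ℝ)} with hE₁
  set E₃ := {w | ∃ W ∈ FW, ε * (n * I / (K : ℝ) ^ 2) <
    ∑ e ∈ (Finset.univ : Finset {j : Fin n // j ≠ i}) ×ˢ touching W,
      ((X e.1 w e.2).toNat : ℝ)} with hE₃
  have hsub : {w | ¬ Typical θ i (fun j => X j w) p I ε η η'} ⊆
      ((⋃ c ∈ (Finset.univ : Finset (Fin 2 × Fin K × Fin K)), E₀ c) ∪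
        (⋃ c ∈ (Finset.univ : Finset (Fin 2 × Fin K × Fin K)), E₂ c)) ∪ (E₁ ∪ E₃) := by
    intro w hw
    by_contra h
    simp only [Set.mem_union, Set.mem_iUnion, Finset.mem_univ, exists_prop, true_and, not_or,
      not_exists] at h
    refine hw ⟨?_, ?_, ?_, ?_⟩
    · intro m k l
      exact not_lt.1 (h.1.1 (m, k, l))
    · intro V hv
      by_contra hlt
      exact h.2.1 ⟨V, Finset.mem_filter.2 ⟨Finset.mem_univ _, hv⟩, not_le.1 hlt⟩
    · intro V hv m k l
      by_contra hlt
      exact h.1.2 (m, k, l) ⟨V, Finset.mem_filter.2 ⟨Finset.mem_univ _, hv⟩, not_le.1 hlt⟩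
    · intro W hw
      by_contra hlt
      exact h.2.2 ⟨W, Finset.mem_filter.2 ⟨Finset.mem_univ _, hw⟩, not_le.1 hlt⟩
  have hcard : ((Finset.univ : Finset (Fin 2 × Fin K × Fin K)).card : ℝ) = 2 * (K : ℝ) ^ 2 := by
    simp [Finset.card_univ]
    ring
  have hu₀ : μ.real (⋃ c ∈ (Finset.univ : Finset (Fin 2 × Fin K × Fin K)), E₀ c) ≤
      2 * (K : ℝ) ^ 2 * (2 * Real.exp (-Q)) := by
    refine (measureReal_biUnion_finset_le _ _).trans ?_
    refine (Finset.sum_le_sum fun c _ => p₀' c.1 c.2.1 c.2.2).trans_eq ?_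
    rw [Finset.sum_const, nsmul_eq_mul, hcard]
  have hu₂ : μ.real (⋃ c ∈ (Finset.univ : Finset (Fin 2 × Fin K × Fin K)), E₂ c) ≤
      2 * (K : ℝ) ^ 2 * Real.exp (-Q) := by
    refine (measureReal_biUnion_finset_le _ _).trans ?_
    refine (Finset.sum_le_sum fun c _ => p₂ c.1 c.2.1 c.2.2).trans_eq ?_
    rw [Finset.sum_const, nsmul_eq_mul, hcard]
  calc _ ≤ _ := measureReal_mono hsub (measure_ne_top _ _)
    _ ≤ (2 * (K : ℝ) ^ 2 * (2 * Real.exp (-Q)) + 2 * (K : ℝ) ^ 2 * Real.exp (-Q)) +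
        (Real.exp (-Q) + Real.exp (-Q)) :=
        (measureReal_union_le _ _).trans (add_le_add
          ((measureReal_union_le _ _).trans (add_le_add hu₀ hu₂))
          ((measureReal_union_le _ _).trans (add_le_add p₁ p₃)))
    _ = (6 * (K : ℝ) ^ 2 + 2) * Real.exp (-Q) := by ring
    _ ≤ _ := by
        gcongr
        linarith [one_le_pow₀ (n := 2) hK]

end Typicality

section SingleLayer

variable {Ω : Type*} [MeasurableSpace Ω] {μ : Measure Ω} [IsProbabilityMeasure μ] {n d K : ℕ}
  {θ : MMSBM n d K} {α β Γ p₀ Λ p I ε η η' : ℝ} {X : Fin n → Ω → Network d}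

/-- The constant in the bound of the `χ²`-type error of the estimated edge probabilities. -/
def chiConst (α β Γ : ℝ) : ℝ :=
  8 * Γ + 32 * α * β ^ 2 * (2 * β ^ 2 + 1) + 128 * α * β ^ 4 * Γ + 18 * Γ ^ 3

/-- The constant `C` is one for which the conclusion of `log_chernoffFactor_le` holds. -/
def IsChernoffConst (p₀ H r C : ℝ) : Prop :=
  ∀ a b a' b' : ℝ, 0 < a → a ≤ p₀ → 0 < b → b ≤ p₀ → b ≤ H * a → a ≤ H * a' →
    0 < b' → (1 - p₀) / 2 ≤ 1 - a' → (1 - p₀) / 2 ≤ 1 - b' →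
    Real.log (chernoffFactor a a' b') ≤
      (1 - r) * Real.log (√(a * b) + √((1 - a) * (1 - b))) +
        C * ((a' - a) ^ 2 / a + (b' - b) ^ 2 / b)

lemma MMSBM.separation_eq (θ : MMSBM n d K) (m : Fin 2) :
    θ.separation = -2 * ∑ ω : Edge d, Real.log
      (√(θ.P m ω * θ.P (1 - m) ω) + √((1 - θ.P m ω) * (1 - θ.P (1 - m) ω))) := by
  rw [MMSBM.separation]
  congr 1
  refine Finset.sum_congr rfl fun ω _ => ?_
  fin_cases m
  · rfl
  · change Real.log (√(θ.P 0 ω * θ.P 1 ω) + √((1 - θ.P 0 ω) * (1 - θ.P 1 ω))) =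
      Real.log (√(θ.P 1 ω * θ.P 0 ω) + √((1 - θ.P 1 ω) * (1 - θ.P 0 ω)))
    rw [mul_comm (θ.P 0 ω), mul_comm (1 - θ.P 0 ω)]

/-- Given typical other layers and an accurate initialization, the likelihood of layer `i` prefers
the wrong label with a probability of the order of `exp (-I / 2)`. -/
lemma measureReal_wrongPreferred_le (hX : θ.IsSample μ X) (R : Regime θ α β Γ p₀ Λ p I ε η η')
    (hI : I = θ.separation) {r C : ℝ} (hC0 : 0 ≤ C) (hC : IsChernoffConst p₀ (2 * Γ ^ 2) r C)
    {i : Fin n} {x : {j : Fin n // j ≠ i} → Network d} {o : InitOutput n d K i}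
    (T : Typical θ i x p I ε η η') {π : Equiv.Perm (Fin 2)} {τ : Fin 2 → Equiv.Perm (Fin K)}
    (M : Matched θ o η η' π τ) :
    μ.real {w | WrongPreferred θ x o π (X i w)} ≤
      Real.exp (-(1 - r - 4 * C * chiConst α β Γ * ε) * (I / 2)) := by
  have hΓ1 := R.one_le_Γ
  have hΓ : 0 < Γ := by linarith
  have hp := R.p_pos
  have hp₀ := R.p₀_lt
  set m := θ.z i with hm
  have hpos : ∀ m ω, 0 < looP x o (π m) ω := by
    intro m ω
    have h := (looP_bounds R T M m ω).1
    by_contra hneg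
    have := mul_nonpos_of_nonneg_of_nonpos (show 0 ≤ 2 * Γ by linarith) (not_lt.1 hneg)
    linarith
  have hIoo : ∀ m ω, looP x o (π m) ω ∈ Set.Ioo (0 : ℝ) 1 := fun m ω =>
    ⟨hpos m ω, by linarith [(looP_bounds R T M m ω).2.2]⟩
  have hind : iIndepFun (fun (ω : Edge d) w => X i w ω) μ :=
    hX.indep.precomp (g := fun ω : Edge d => (i, ω)) (fun ω ω' h => (Prod.ext_iff.1 h).2)
  have h := measureReal_logLik_le (Y := fun (ω : Edge d) w => X i w ω) (P := θ.P m)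
    (hX.measurable_apply i) hind (hX.prob i) (hIoo m) (hIoo (1 - m))
  refine h.trans ?_
  have hPpos : ∀ m ω, 0 < θ.P m ω := fun m ω => R.B_pos _ _ _
  have hPle : ∀ m ω, θ.P m ω ≤ p₀ := fun m ω => R.B_le _ _ _
  have hPup : ∀ m ω, θ.P m ω ≤ Γ * p := fun m ω => R.B_upper _ _ _
  have hPlow : ∀ m ω, p ≤ Γ * θ.P m ω := fun m ω => R.B_lower _ _ _
  have hfac : ∀ ω, chernoffFactor (θ.P m ω) (looP x o (π m) ω) (looP x o (π (1 - m)) ω) ≤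
      Real.exp ((1 - r) * Real.log (√(θ.P m ω * θ.P (1 - m) ω) +
          √((1 - θ.P m ω) * (1 - θ.P (1 - m) ω))) +
        C * ((looP x o (π m) ω - θ.P m ω) ^ 2 / θ.P m ω +
          (looP x o (π (1 - m)) ω - θ.P (1 - m) ω) ^ 2 / θ.P (1 - m) ω)) := by
    intro ω
    have hcpos : 0 < chernoffFactor (θ.P m ω) (looP x o (π m) ω) (looP x o (π (1 - m)) ω) := by
      have h1 : 0 < √(looP x o (π (1 - m)) ω / looP x o (π m) ω) :=
        Real.sqrt_pos.2 (div_pos (hpos _ _) (hpos _ _))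
      have h2 := hPpos m ω
      have h3 : 0 ≤ 1 - θ.P m ω := by linarith [hPle m ω]
      rw [chernoffFactor]
      positivity
    rw [← Real.log_le_iff_le_exp hcpos]
    have hΓp : Γ * p ≤ Γ ^ 2 * θ.P m ω := by
      have := mul_le_mul_of_nonneg_left (hPlow m ω) hΓ.le
      linarith
    refine hC _ _ _ _ (hPpos m ω) (hPle m ω) (hPpos _ ω) (hPle _ ω) ?_ ?_ (hpos _ _)
      (looP_bounds R T M m ω).2.2 (looP_bounds R T M (1 - m) ω).2.2
    · have := hPup (1 - m) ω
      have := mul_pos (show 0 < Γ ^ 2 by positivity) (hPpos m ω)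
      linarith
    · have h1 := hPup m ω
      have h2 := mul_le_mul_of_nonneg_left (looP_bounds R T M m ω).1 hΓ.le
      linarith
  calc _ ≤ ∏ ω, Real.exp ((1 - r) * Real.log (√(θ.P m ω * θ.P (1 - m) ω) +
          √((1 - θ.P m ω) * (1 - θ.P (1 - m) ω))) +
        C * ((looP x o (π m) ω - θ.P m ω) ^ 2 / θ.P m ω +
          (looP x o (π (1 - m)) ω - θ.P (1 - m) ω) ^ 2 / θ.P (1 - m) ω)) := by
        refine Finset.prod_le_prod (fun ω _ => ?_) fun ω _ => hfac ω
        have h3 : 0 ≤ 1 - θ.P m ω := by linarith [hPle m ω]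
        have h2 := hPpos m ω
        rw [chernoffFactor]
        positivity
    _ ≤ _ := by
        rw [← Real.exp_sum, Finset.sum_add_distrib, ← Finset.mul_sum, ← Finset.mul_sum,
          Finset.sum_add_distrib]
        apply Real.exp_le_exp.2
        have hsep := θ.separation_eq m
        rw [← hI] at hsep
        have e1 := sum_sq_looP_sub_le R T M m
        have e2 := sum_sq_looP_sub_le R T M (1 - m)
        rw [← chiConst] at e1 e2
        have e3 := mul_le_mul_of_nonneg_left (add_le_add e1 e2) hC0
        have e4 : ∑ ω : Edge d, Real.log (√(θ.P m ω * θ.P (1 - m) ω) +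
          √((1 - θ.P m ω) * (1 - θ.P (1 - m) ω))) = -(I / 2) := by linarith
        rw [e4]
        linarith

/-- The probability that the initialization is accurate but the likelihood of layer `i` prefers
the wrong label. The layer is independent of the pair of the other layers and the initialization,
which takes finitely many values. -/
lemma measureReal_matched_and_wrongPreferred_le (hX : θ.IsSample μ X)
    (R : Regime θ α β Γ p₀ Λ p I ε η η') (hI : I = θ.separation) {r C : ℝ} (hC0 : 0 ≤ C)
    (hC : IsChernoffConst p₀ (2 * Γ ^ 2) r C) {i : Fin n} {S : Type*} [MeasurableSpace S]
    {U : Ω → S} (hU : Measurable U) (hUX : IndepFun U (fun w i => X i w) μ)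
    {init : ({j : Fin n // j ≠ i} → Network d) → S → InitOutput n d K i}
    (hinit : Measurable fun y : ({j : Fin n // j ≠ i} → Network d) × S => init y.1 y.2)
    (π : InitOutput n d K i → Equiv.Perm (Fin 2)) {c : ℝ}
    (hc : μ.real {w | ¬ Typical θ i (fun j => X j w) p I ε η η'} ≤ c) :
    μ.real {w | (∃ τ, Matched θ (init (fun j => X j w) (U w)) η η'
        (π (init (fun j => X j w) (U w))) τ) ∧
      WrongPreferred θ (fun j => X j w) (init (fun j => X j w) (U w))
        (π (init (fun j => X j w) (U w))) (X i w)} ≤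
      c + Real.exp (-(1 - r - 4 * C * chiConst α β Γ * ε) * (I / 2)) := by
  set Z : Ω → ({j : Fin n // j ≠ i} → Network d) × InitOutput n d K i :=
    fun w => (fun j => X j w, init (fun j => X j w) (U w)) with hZ
  have hswap : Measurable fun y : S × ({j : Fin n // j ≠ i} → Network d) => init y.2 y.1 :=
    hinit.comp measurable_swap
  have hψ : Measurable fun y : S × ({j : Fin n // j ≠ i} → Network d) => (y.2, init y.2 y.1) :=
    measurable_snd.prodMk hswap
  have hrest : Measurable fun w (j : {j : Fin n // j ≠ i}) => X j w :=
    measurable_pi_lambda _ fun j => hX.measurable j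
  have hZm : Measurable Z := hψ.comp (hU.prodMk hrest)
  have hind : IndepFun Z (X i) μ :=
    (hX.indepFun_seed_rest hU hUX i).comp (φ := fun y => (y.2, init y.2 y.1)) (ψ := id) hψ
      measurable_id
  have h := measureReal_le_of_indepFun hZm hind
    {y | Typical θ i y.1 p I ε η η' ∧ ∃ τ, Matched θ y.2 η η' (π y.2) τ}
    (fun y => {x | WrongPreferred θ y.1 y.2 (π y.2) x}) (fun y => (Set.toFinite _).measurableSet)
    (c := Real.exp (-(1 - r - 4 * C * chiConst α β Γ * ε) * (I / 2)))
    (fun y hy => by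
      obtain ⟨T, τ, M⟩ := hy
      exact measureReal_wrongPreferred_le hX R hI hC0 hC T M) (Real.exp_pos _).le
  refine le_trans (measureReal_mono ?_ (measure_ne_top _ _))
    ((measureReal_union_le _ _).trans (add_le_add hc h))
  intro w hw
  by_cases hT : Typical θ i (fun j => X j w) p I ε η η'
  · exact Or.inr ⟨⟨hT, hw.1⟩, hw.2⟩
  · exact Or.inl hT

end SingleLayer

/-! ### Expected error, and consequences of the parameter space -/

section Expectation

variable {Ω : Type*} [MeasurableSpace Ω] {μ : Measure Ω} {n d K : ℕ} {θ : MMSBM n d K}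

lemma misclust_nonneg {ι κ : Type*} [Fintype ι] [DecidableEq κ] (z z' : ι → κ) :
    0 ≤ misclust z z' :=
  Real.iInf_nonneg fun _ => by positivity

lemma misclust_le_one {ι κ : Type*} [Fintype ι] [DecidableEq κ] (z z' : ι → κ) :
    misclust z z' ≤ 1 := by
  have hbdd : BddBelow (Set.range fun π : Equiv.Perm κ =>
      ((Finset.univ.filter fun i => z i ≠ π (z' i)).card : ℝ) / Fintype.card ι) :=
    ⟨0, by rintro _ ⟨π, rfl⟩; positivity⟩
  refine (ciInf_le hbdd 1).trans (div_le_one_of_le₀ ?_ (by positivity))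
  exact_mod_cast Finset.card_le_univ _

lemma measurableSet_initGood {S : Type*} [MeasurableSpace S] {X : Fin n → Ω → Network d}
    (hX : θ.IsSample μ X) {U : Ω → S} (hU : Measurable U) {Init : InitAlgorithm n d K S}
    (hInit : ∀ i, Measurable fun y : ({j : Fin n // j ≠ i} → Network d) × S => Init i y.1 y.2)
    (ηz ησ : ℝ) :
    MeasurableSet {w | ∀ i, InitGood θ ηz ησ (Init i (fun j => X j w) (U w))} := by
  have h : {w | ∀ i, InitGood θ ηz ησ (Init i (fun j => X j w) (U w))} =
      ⋂ i, (fun w => Init i (fun j => X j w) (U w)) ⁻¹' {o | InitGood θ ηz ησ o} := by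
    ext w
    simp
  rw [h]
  refine MeasurableSet.iInter fun i => ?_
  have hm : Measurable fun w => Init i (fun j => X j w) (U w) :=
    (hInit i).comp ((measurable_pi_lambda _ fun j : {j : Fin n // j ≠ i} =>
      hX.measurable j).prodMk hU)
  exact hm (Set.toFinite _).measurableSet

/-- The expected error on the event of an accurate initialization, by linearity of the
expectation over the layers. -/
lemma setIntegral_misclust_le [IsProbabilityMeasure μ] {α β Γ p₀ Λ p I ε η η' ηz : ℝ}
    {X : Fin n → Ω → Network d} (hn : 0 < n) (hX : θ.IsSample μ X)
    (R : Regime θ α β Γ p₀ Λ p I ε η η') (hI : I = θ.separation) {r C : ℝ} (hC0 : 0 ≤ C)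
    (hC : IsChernoffConst p₀ (2 * Γ ^ 2) r C) {S : Type*} [MeasurableSpace S]
    {U : Ω → S} (hU : Measurable U) (hUX : IndepFun U (fun w i => X i w) μ)
    {Init : InitAlgorithm n d K S}
    (hInit : ∀ i, Measurable fun y : ({j : Fin n // j ≠ i} → Network d) × S => Init i y.1 y.2)
    (hηz : ηz ≤ η) (hbal : ∀ m, 4 * (η * n) + 4 < (Finset.univ.filter fun j => θ.z j = m).card)
    {zhat : Ω → Fin n → Fin 2} (hzhat : Measurable zhat)
    (hout : ∀ w, IsTwoStageOutput (fun i => X i w) (fun i => Init i (fun j => X j w) (U w)) (zhat w))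
    {c : ℝ} (hc : ∀ i, μ.real {w | ¬ Typical θ i (fun j => X j w) p I ε η η'} ≤ c) :
    ∫ w in {w | ∀ i, InitGood θ ηz η' (Init i (fun j => X j w) (U w))},
        misclust (zhat w) θ.z ∂μ ≤
      c + Real.exp (-(1 - r - 4 * C * chiConst α β Γ * ε) * (I / 2)) := by
  classical
  set G := {w | ∀ i, InitGood θ ηz η' (Init i (fun j => X j w) (U w))} with hG
  have hGm : MeasurableSet G := measurableSet_initGood hX hU hInit ηz η'
  have hπ : ∀ i (o : InitOutput n d K i), ∃ π : Equiv.Perm (Fin 2), InitGood θ ηz η' o →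
      ∃ τ, Matched θ o η η' π τ := by
    intro i o
    by_cases ho : InitGood θ ηz η' o
    · obtain ⟨π, h₁, h₂⟩ := ho
      exact ⟨π, fun _ => exists_matched R.d_pos hn hηz h₁ h₂⟩
    · exact ⟨1, fun h => absurd h ho⟩
  choose π hπ using hπ
  set F : Fin n → Set Ω := fun i =>
    {w | (∃ τ, Matched θ (Init i (fun j => X j w) (U w)) η η'
        (π i (Init i (fun j => X j w) (U w))) τ) ∧
      WrongPreferred θ (fun j => X j w) (Init i (fun j => X j w) (U w))
        (π i (Init i (fun j => X j w) (U w))) (X i w)} with hF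
  have hFm : ∀ i, MeasurableSet (F i) := by
    intro i
    have hrest : Measurable fun w (j : {j : Fin n // j ≠ i}) => X j w :=
      measurable_pi_lambda _ fun j => hX.measurable j
    have hZ : Measurable fun w => ((fun j : {j : Fin n // j ≠ i} => X j w),
        Init i (fun j => X j w) (U w), X i w) :=
      hrest.prodMk (((hInit i).comp (hrest.prodMk hU)).prodMk (hX.measurable i))
    exact hZ (Set.toFinite {y : ({j : Fin n // j ≠ i} → Network d) × InitOutput n d K i ×
      Network d | (∃ τ, Matched θ y.2.1 η η' (π i y.2.1) τ) ∧
        WrongPreferred θ y.1 y.2.1 (π i y.2.1) y.2.2}).measurableSet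
  have hFint : ∀ i, Integrable ((F i).indicator fun _ => (1 : ℝ)) μ := fun i =>
    (integrable_const _).indicator (hFm i)
  have hpt : ∀ w ∈ G, misclust (zhat w) θ.z ≤
      (∑ i, (F i).indicator (fun _ => (1 : ℝ)) w) / n := by
    intro w hw
    have hM : ∀ i, ∃ τ, Matched θ (Init i (fun j => X j w) (U w)) η η'
        (π i (Init i (fun j => X j w) (U w))) τ := fun i => hπ i _ (hw i)
    refine (misclust_le_of_isTwoStageOutput hn (hout w)
      (fun i => π i (Init i (fun j => X j w) (U w)))
      (fun i => (hM i).choose_spec.layers) hbal).trans ?_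
    gcongr
    rw [← Finset.sum_boole]
    refine Finset.sum_le_sum fun i _ => ?_
    split_ifs with h
    · rw [Set.indicator_of_mem]
      exact ⟨hM i, h⟩
    · exact Set.indicator_nonneg (fun _ _ => zero_le_one) _
  have hint : Integrable (fun w => (∑ i, (F i).indicator (fun _ => (1 : ℝ)) w) / n) μ :=
    (integrable_finsetSum _ fun i _ => hFint i).div_const _
  calc _ ≤ ∫ w in G, (∑ i, (F i).indicator (fun _ => (1 : ℝ)) w) / n ∂μ :=
        setIntegral_mono_on (integrable_comp_of_finite hzhat fun z => misclust z θ.z).integrableOn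
          hint.integrableOn hGm hpt
    _ ≤ ∫ w, (∑ i, (F i).indicator (fun _ => (1 : ℝ)) w) / n ∂μ :=
        setIntegral_le_integral hint (ae_of_all _ fun w => div_nonneg
          (Finset.sum_nonneg fun i _ => Set.indicator_nonneg (fun _ _ => zero_le_one) _)
          (Nat.cast_nonneg _))
    _ = (∑ i, μ.real (F i)) / n := by
        rw [integral_div, integral_finsetSum _ fun i _ => hFint i]
        congr 1
        refine Finset.sum_congr rfl fun i _ => ?_
        rw [integral_indicator (hFm i), setIntegral_const, smul_eq_mul, mul_one]
    _ ≤ (∑ i : Fin n, (c + Real.exp (-(1 - r - 4 * C * chiConst α β Γ * ε) * (I / 2)))) / n := by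
        gcongr with i
        exact measureReal_matched_and_wrongPreferred_le hX R hI hC0 hC hU hUX (hInit i) (π i) (hc i)
    _ = _ := by
        rw [Finset.sum_const, Finset.card_univ, Fintype.card_fin, nsmul_eq_mul]
        have : (n : ℝ) ≠ 0 := by exact_mod_cast hn.ne'
        field_simp

end Expectation

section ParameterSpace

variable {n d K : ℕ} {θ : MMSBM n d K} {p q : Fin 2 → ℝ} {α β γ p₀ : ℝ}

namespace MMSBM.InParameterSpace

lemma p_pos (h : θ.InParameterSpace p q α β γ) (m : Fin 2) : 0 < p m := by
  obtain ⟨k, hk⟩ := (h.p_isLeast m).1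
  exact hk ▸ (h.mem_Ioo m k k).1

lemma q_pos (h : θ.InParameterSpace p q α β γ) (m : Fin 2) : 0 < q m := by
  obtain ⟨k, l, -, hk⟩ := (h.q_isGreatest m).1
  exact hk ▸ (h.mem_Ioo m k l).1

lemma K_pos (h : θ.InParameterSpace p q α β γ) : 0 < K := by
  obtain ⟨k, -⟩ := (h.p_isLeast 0).1
  exact k.pos

lemma B_lower (h : θ.InParameterSpace p q α β γ) (hγ : 1 ≤ γ) (m : Fin 2) (k l : Fin K) :
    p 0 ≤ γ ^ 2 * θ.B m k l := by
  have hγ0 : 0 ≤ γ := by linarith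
  have hB := (h.mem_Ioo m k l).1
  by_cases hkl : k = l
  · subst hkl
    have h1 := h.ratio_pp 0 m
    rw [div_le_iff₀ (h.p_pos m)] at h1
    have h2 : p m ≤ θ.B m k k := (h.p_isLeast m).2 ⟨k, rfl⟩
    calc p 0 ≤ γ * p m := h1
      _ ≤ γ * θ.B m k k := by gcongr
      _ ≤ γ ^ 2 * θ.B m k k := by gcongr; exact le_self_pow₀ hγ two_ne_zero
  · have h1 := h.ratio_pq 0 m
    rw [div_le_iff₀ (h.q_pos m)] at h1
    calc p 0 ≤ γ * q m := h1
      _ ≤ γ * (γ * θ.B m k l) := by gcongr; exact h.q_homogeneous m k l hkl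
      _ = _ := by ring

lemma B_upper (h : θ.InParameterSpace p q α β γ) (hγ : 1 ≤ γ) (m : Fin 2) (k l : Fin K) :
    θ.B m k l ≤ γ ^ 2 * p 0 := by
  have hγ0 : 0 < γ := by linarith
  have hp := h.p_pos 0
  by_cases hkl : k = l
  · subst hkl
    have h1 := h.ratio_pp m 0
    rw [div_le_iff₀ hp] at h1
    have h2 := h.p_homogeneous m k
    rw [inv_mul_le_iff₀ hγ0] at h2
    calc θ.B m k k ≤ γ * p m := h2
      _ ≤ γ * (γ * p 0) := by gcongr
      _ = _ := by ring
  · have h1 := h.ratio_qp m 0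
    rw [div_le_iff₀ hp] at h1
    have h2 : θ.B m k l ≤ q m := (h.q_isGreatest m).2 ⟨k, l, hkl, rfl⟩
    calc θ.B m k l ≤ γ * p 0 := h2.trans h1
      _ ≤ _ := by gcongr; exact le_self_pow₀ hγ two_ne_zero

/-- The separation is at most of the order of the expected number of edges of a layer. -/
lemma separation_le (h : θ.InParameterSpace p q α β γ) (hγ : 1 ≤ γ) (hp₀ : p₀ < 1)
    (hB : ∀ m k l, θ.B m k l ≤ p₀) :
    θ.separation ≤ 2 * γ ^ 2 / (1 - p₀) * (p 0 * (d : ℝ) ^ 2) := by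
  have hp := h.p_pos 0
  have hq : 0 < 1 - p₀ := by linarith
  have hterm : ∀ ω : Edge d, -Real.log (√(θ.P 0 ω * θ.P 1 ω) +
      √((1 - θ.P 0 ω) * (1 - θ.P 1 ω))) ≤ γ ^ 2 * p 0 / (1 - p₀) := by
    intro ω
    set g := √(θ.P 0 ω * θ.P 1 ω) + √((1 - θ.P 0 ω) * (1 - θ.P 1 ω)) with hg
    have hle : ∀ v : ℝ, 0 ≤ v → v ≤ 1 - θ.P 0 ω → v ≤ 1 - θ.P 1 ω → v ≤ g := by
      intro v hv h0 h1
      have : v ≤ √((1 - θ.P 0 ω) * (1 - θ.P 1 ω)) := by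
        apply Real.le_sqrt_of_sq_le
        rw [sq]
        exact mul_le_mul h0 h1 hv (by linarith)
      linarith [Real.sqrt_nonneg (θ.P 0 ω * θ.P 1 ω)]
    have hPle : ∀ m, θ.P m ω ≤ p₀ := fun m => hB m _ _
    have hg1 : 1 - p₀ ≤ g := hle _ hq.le (by linarith [hPle 0]) (by linarith [hPle 1])
    have hg0 : 0 < g := by linarith
    have hu : ∀ m, θ.P m ω ≤ γ ^ 2 * p 0 := fun m => h.B_upper hγ m _ _
    have hg2 : 1 - γ ^ 2 * p 0 ≤ g := by
      by_cases hs : 0 ≤ 1 - γ ^ 2 * p 0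
      · exact hle _ hs (by linarith [hu 0]) (by linarith [hu 1])
      · linarith
    have h1 := Real.one_sub_inv_le_log_of_pos hg0
    have h2 : g⁻¹ - 1 ≤ γ ^ 2 * p 0 / (1 - p₀) := by
      have : g⁻¹ - 1 = (1 - g) / g := by field_simp
      rw [this, div_le_div_iff₀ hg0 hq]
      by_cases hs : 0 ≤ 1 - g
      · exact mul_le_mul (by linarith) hg1 hq.le (by positivity)
      · exact (mul_nonpos_of_nonpos_of_nonneg (by linarith) hq.le).trans (by positivity)
    linarith
  have hsum := Finset.sum_le_sum fun ω (_ : ω ∈ (Finset.univ : Finset (Edge d))) => hterm ω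
  rw [Finset.sum_neg_distrib, Finset.sum_const, nsmul_eq_mul, Finset.card_univ] at hsum
  have hc := mul_le_mul_of_nonneg_right (card_edge_le (d := d))
    (show 0 ≤ γ ^ 2 * p 0 / (1 - p₀) by positivity)
  rw [MMSBM.separation]
  calc _ ≤ 2 * ((d : ℝ) ^ 2 * (γ ^ 2 * p 0 / (1 - p₀))) := by linarith
    _ = _ := by ring

lemma layers_lower (h : θ.InParameterSpace p q α β γ) (hα : 1 ≤ α) (hn : 4 * α ≤ n) (i : Fin n)
    (m : Fin 2) : (n : ℝ) / (4 * α) ≤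
      (Finset.univ.filter fun j : {j : Fin n // j ≠ i} => θ.z j = m).card := by
  classical
  have h1 := (h.layer_balance m).1
  have h2 : (Finset.univ.filter fun j => θ.z j = m) ⊆ insert i
      ((Finset.univ.filter fun j : {j : Fin n // j ≠ i} => θ.z j = m).map
        (Function.Embedding.subtype _)) := by
    intro j hj
    by_cases hji : j = i
    · simp [hji]
    · simpa [hji] using hj
  have h3 := (Finset.card_le_card h2).trans (Finset.card_insert_le _ _)
  rw [Finset.card_map] at h3
  have h4 : ((Finset.univ.filter fun j => θ.z j = m).card : ℝ) ≤
      (Finset.univ.filter fun j : {j : Fin n // j ≠ i} => θ.z j = m).card + 1 := by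
    exact_mod_cast h3
  have h5 : (n : ℝ) / (2 * α) = n / (4 * α) + n / (4 * α) := by field_simp; ring
  have h6 : 1 ≤ (n : ℝ) / (4 * α) := by
    rw [le_div_iff₀ (by linarith)]
    linarith
  linarith

end MMSBM.InParameterSpace

end ParameterSpace

/-! ### Choice of the constants -/

lemma eventually_mul_le (c : ℝ) {b : ℝ} (hb : 0 < b) : ∀ᶠ x in 𝓝[>] (0 : ℝ), c * x ≤ b := by
  have h : Tendsto (fun x : ℝ => c * x) (𝓝[>] 0) (𝓝 0) := by
    have h' : Tendsto (fun x : ℝ => c * x) (𝓝 0) (𝓝 (c * 0)) := tendsto_id.const_mul c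
    rw [mul_zero] at h'
    exact h'.mono_left nhdsWithin_le_nhds
  exact (h.eventually (gt_mem_nhds hb)).mono fun x hx => le_of_lt hx

/-- The numerical conditions of `measureReal_not_typical_le`. Here `s` stands for `p d²`. -/
lemma typicality_conditions {α β Γ Λ n d K s I ν ε η η' Q : ℝ} (hα : 1 ≤ α) (hβ : 1 ≤ β)
    (hΓ : 1 ≤ Γ) (hΛ : 0 < Λ) (hn : 0 < n) (hd : 0 < d) (hK : 1 ≤ K) (hs : 0 < s) (hε : 0 < ε)
    (hν : 0 < ν) (hIs : I ≤ Λ * s) (hI1 : 1 ≤ I) (hIΛ : Λ ≤ I) (hIε : 4 / ε ≤ I)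
    (hη : η = ν * I / (s * K ^ 2)) (hη'0 : 0 ≤ η') (hη' : η' ≤ η)
    (hent : d * (η' * Real.log (1 / η')) ≤ ν * (Λ * (n * I / K ^ 2)))
    (hQ : Q ≤ 4 * ν * (n * I / K ^ 2)) (c₁ : 128 * α * β ^ 2 * Γ * ν ≤ ε) (c₂ : 8 * Γ * ν ≤ ε)
    (c₃ : 16 * ν ≤ ε) (c₄ : 16 * Λ * ν ≤ ε) (c₅ : Λ * ν ≤ Real.exp (-(1 + 8 * β ^ 2 * Γ / ε)))
    (c₆ : (2 * Λ + 4 * Γ + 4) * ν ≤ ε) :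
    Q ≤ ε * (n * I / K ^ 2) / (32 * α * β ^ 2 * Γ) ∧
    n + 2 * Γ * (η * n * s) + Q ≤ ε * n * I ∧
    η * n * (1 + Real.log (1 / η)) + 2 * β ^ 2 * Γ * (n * s / K ^ 2) + Q ≤
      Real.log (1 / η) * (ε * (n * s / K ^ 2)) ∧
    η' * d * (1 + Real.log (1 / η')) + 4 * Γ * (η * n * s) + Q ≤ ε * (n * I / K ^ 2) := by
  have hI0 : 0 < I := by linarith
  have hα0 : 0 < α := by linarith
  have hβ0 : 0 < β := by linarith
  have hΓ0 : 0 < Γ := by linarith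
  have hK0 : 0 < K := by linarith
  have hη0 : 0 < η := by rw [hη]; positivity
  set b := n * I / K ^ 2 with hb
  have hb0 : 0 < b := by positivity
  have hηb : η * n * s = ν * b := by rw [hη, hb]; field_simp
  have hbn : b ≤ n * I := by
    rw [hb, div_le_iff₀ (by positivity)]
    exact le_mul_of_one_le_right (by positivity) (one_le_pow₀ hK)
  set b' := n * s / K ^ 2 with hb'
  have hb'0 : 0 < b' := by positivity
  have hbb' : b ≤ Λ * b' := by
    rw [hb, hb', ← mul_div_assoc]
    apply div_le_div_of_nonneg_right _ (by positivity)
    have := mul_le_mul_of_nonneg_left hIs hn.le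
    linarith
  have hs1 : 1 ≤ s := by
    by_contra h
    have := mul_lt_mul_of_pos_left (not_le.1 h) hΛ
    linarith
  have hηK : η * K ^ 2 ≤ Λ * ν := by
    have : η * K ^ 2 = ν * I / s := by rw [hη]; field_simp
    rw [this, div_le_iff₀ hs]
    have := mul_le_mul_of_nonneg_left hIs hν.le
    linarith
  have hηs : η ≤ Λ * ν := (le_mul_of_one_le_right hη0.le (one_le_pow₀ hK)).trans hηK
  have hlog : ∀ e : ℝ, 0 < e → e ≤ η → 1 + 8 * β ^ 2 * Γ / ε ≤ Real.log (1 / e) := by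
    intro e he heη
    rw [Real.le_log_iff_exp_le (by positivity), le_div_iff₀ he]
    calc _ ≤ Real.exp (1 + 8 * β ^ 2 * Γ / ε) * Real.exp (-(1 + 8 * β ^ 2 * Γ / ε)) := by
          gcongr; exact (heη.trans hηs).trans c₅
      _ = 1 := by rw [← Real.exp_add]; simp
  have hε' : 0 ≤ 8 * β ^ 2 * Γ / ε := by positivity
  refine ⟨?_, ?_, ?_, ?_⟩
  · rw [le_div_iff₀ (by positivity)]
    have h1 := mul_le_mul_of_nonneg_right hQ (show 0 ≤ 32 * α * β ^ 2 * Γ by positivity)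
    have h2 := mul_le_mul_of_nonneg_right c₁ hb0.le
    linarith
  · rw [hηb]
    have h1 : n ≤ ε / 4 * (n * I) := by
      rw [div_le_iff₀ hε] at hIε
      have := mul_le_mul_of_nonneg_left hIε hn.le
      linarith
    have h2 := mul_le_mul_of_nonneg_right c₂ hb0.le
    have h3 := mul_le_mul_of_nonneg_right c₃ hb0.le
    have h4 := mul_le_mul_of_nonneg_left hbn hε.le
    have h5 : 0 < ε * (n * I) := by positivity
    linarith
  · set l := Real.log (1 / η) with hl
    have hl0 := hlog η hη0 le_rfl
    rw [← hl] at hl0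
    have hl1 : 1 ≤ l := by linarith
    have h1 : η * n * (1 + l) ≤ ε / 8 * (l * b') := by
      have e1 : η * n ≤ ε / 16 * b' := by
        have e2 : 16 * (η * K ^ 2) ≤ ε * s := by
          have : ε * 1 ≤ ε * s := mul_le_mul_of_nonneg_left hs1 hε.le
          linarith
        rw [hb', ← mul_div_assoc, le_div_iff₀ (by positivity)]
        have := mul_le_mul_of_nonneg_right e2 hn.le
        linarith
      calc η * n * (1 + l) ≤ (ε / 16 * b') * (l + l) := by gcongr
        _ = _ := by ring
    have h2 : 2 * β ^ 2 * Γ * b' ≤ ε / 4 * (l * b') := by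
      have e1 : 8 * β ^ 2 * Γ ≤ l * ε := by
        rw [← div_le_iff₀ hε]
        linarith
      have := mul_le_mul_of_nonneg_right e1 hb'0.le
      linarith
    have h3 : Q ≤ ε / 4 * (l * b') := by
      have e1 := mul_le_mul_of_nonneg_left hbb' hν.le
      have e2 := mul_le_mul_of_nonneg_right c₄ hb'0.le
      have e3 := mul_le_mul_of_nonneg_right hl1 hb'0.le
      have e4 := mul_le_mul_of_nonneg_left e3 hε.le
      linarith
    have h4 : 0 < ε * (l * b') := by positivity
    linarith
  · rw [hηb]
    have h1 : η' * d * (1 + Real.log (1 / η')) ≤ 2 * (ν * (Λ * b)) := by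
      rcases hη'0.eq_or_lt with h | h
      · rw [← h, zero_mul, zero_mul]
        positivity
      · have e1 := hlog η' h hη'
        have e2 : 1 ≤ Real.log (1 / η') := by linarith
        have e3 := mul_le_mul_of_nonneg_left e2 (mul_nonneg hd.le hη'0)
        linarith
    have h2 := mul_le_mul_of_nonneg_right c₆ hb0.le
    linarith

/-- For every `ε₀ > 0`, in all models that are large enough and satisfy the conditions with a small
enough constant `ν`, the expected error on the event of an accurate initialization is at most
`exp (-(1 - ε₀) I / 2)`, up to a negligible term. -/
lemma exists_setIntegral_misclust_le {α β γ p₀ ε₀ : ℝ} (hα : 1 ≤ α) (hβ : 1 ≤ β) (hγ : 1 ≤ γ)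
    (hp₀ : p₀ < 1) (hε₀ : 0 < ε₀) :
    ∃ ν > 0, ∃ N : ℝ, ∀ (n d K : ℕ) (θ : MMSBM n d K) (p q : Fin 2 → ℝ) (Ω S : Type*)
      [MeasurableSpace Ω] [MeasurableSpace S] (μ : Measure Ω) [IsProbabilityMeasure μ]
      (X : Fin n → Ω → Network d) (U : Ω → S) (Init : InitAlgorithm n d K S) (I ηz ησ : ℝ)
      (zhat : Ω → Fin n → Fin 2),
      θ.InParameterSpace p q α β γ → (∀ m k l, θ.B m k l ≤ p₀) → θ.IsSample μ X →
      Measurable U → IndepFun U (fun w i => X i w) μ →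
      (∀ i, Measurable fun y : ({j : Fin n // j ≠ i} → Network d) × S => Init i y.1 y.2) →
      Measurable zhat →
      (∀ w, IsTwoStageOutput (fun i => X i w) (fun i => Init i (fun j => X j w) (U w)) (zhat w)) →
      I = θ.separation → 0 < d → N ≤ n → N ≤ I → (K : ℝ) ^ 2 * Real.log n ≤ ν * n → 0 ≤ ησ →
      max ησ ηz ≤ ν * (I / (p 0 * (d : ℝ) ^ 2 * (K : ℝ) ^ 2)) →
      d * (ησ * Real.log (1 / ησ)) ≤ ν * (2 * γ ^ 2 / (1 - p₀) * (n * I / (K : ℝ) ^ 2)) →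
      ∫ w in {w | ∀ i, InitGood θ ηz ησ (Init i (fun j => X j w) (U w))},
        misclust (zhat w) θ.z ∂μ ≤ Real.exp (-I) + Real.exp (-(1 - ε₀) * (I / 2)) := by
  have hq : 0 < 1 - p₀ := by linarith
  set Γ := γ ^ 2 with hΓ
  have hΓ1 : 1 ≤ Γ := one_le_pow₀ hγ
  set Λ := 2 * Γ / (1 - p₀) with hΛ
  have hΛ0 : 0 < Λ := by positivity
  obtain ⟨C, hC0, hC⟩ := log_chernoffFactor_le (H := 2 * Γ ^ 2) (r := ε₀ / 2) hp₀
    (by linarith [one_le_pow₀ (n := 2) hΓ1]) (by linarith)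
  -- the precision `ε` of the estimates
  obtain ⟨ε, ⟨⟨⟨s₁, s₂⟩, s₃⟩, s₄⟩, hε⟩ := ((((eventually_mul_le (64 * α * β ^ 4 * Λ) one_pos).and
    (eventually_mul_le (16 * α * β ^ 2 * (1 + Λ) * (Γ + 4 * β ^ 2))
      (show 0 < (1 - p₀) / 4 by positivity))).and
    (eventually_mul_le Λ (show 0 < ((1 - p₀) / 8) ^ 2 by positivity))).and
    (eventually_mul_le (4 * C * chiConst α β Γ) (show 0 < ε₀ / 2 by positivity))).and
    self_mem_nhdsWithin |>.exists
  replace hε : 0 < ε := hε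
  -- the constant `ν` of the conditions on the initialization
  obtain ⟨ν, ⟨⟨⟨⟨⟨⟨⟨c₁, c₂⟩, c₃⟩, c₄⟩, c₅⟩, c₆⟩, c₇⟩, c₈⟩, hν⟩ :=
    ((((((((eventually_mul_le (128 * α * β ^ 2 * Γ) hε).and
    (eventually_mul_le (8 * Γ) hε)).and (eventually_mul_le 16 hε)).and
    (eventually_mul_le (16 * Λ) hε)).and
    (eventually_mul_le Λ (Real.exp_pos (-(1 + 8 * β ^ 2 * Γ / ε))))).and
    (eventually_mul_le (2 * Λ + 4 * Γ + 4) hε)).and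
    (eventually_mul_le (16 * α * Λ) one_pos)).and (eventually_mul_le 1 one_pos)).and
    self_mem_nhdsWithin |>.exists
  replace hν : 0 < ν := hν
  refine ⟨ν, hν, max (max (Real.exp 7) (16 * α + 1)) (max (4 / ε) Λ), ?_⟩
  intro n d K θ p q Ω S _ _ μ _ X U Init I ηz ησ zhat hθ hB hX hU hUX hInit hzhat hout hI hd hNn
    hNI hKn hησ0 hηmax hent
  simp only [max_le_iff] at hNn hNI
  obtain ⟨⟨hn7, hnα⟩, -, -⟩ := hNn
  obtain ⟨⟨hI7, -⟩, hIε, hIΛ⟩ := hNI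
  have hn0 : (0 : ℝ) < n := (Real.exp_pos 7).trans_le hn7
  have hI1 : 1 ≤ I := by linarith [Real.add_one_le_exp (7 : ℝ)]
  have hI0 : 0 < I := by linarith
  have hK1 : (1 : ℝ) ≤ K := by exact_mod_cast hθ.K_pos
  have hd0 : (0 : ℝ) < d := by exact_mod_cast hd
  have hp := hθ.p_pos 0
  set s := p 0 * (d : ℝ) ^ 2 with hs
  have hs0 : 0 < s := by positivity
  have hIs : I ≤ Λ * s := hI ▸ hθ.separation_le hγ hp₀ hB
  set η := ν * I / (s * (K : ℝ) ^ 2) with hη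
  have hη0 : 0 < η := by positivity
  rw [← mul_div_assoc] at hηmax
  have hηs : η * (s * (K : ℝ) ^ 2) = ν * I := by rw [hη]; field_simp
  have hη1 : η ≤ Λ * ν := by
    rw [hη, div_le_iff₀ (by positivity)]
    have h1 := mul_le_mul_of_nonneg_left hIs hν.le
    have h2 : s * 1 ≤ s * (K : ℝ) ^ 2 := mul_le_mul_of_nonneg_left (one_le_pow₀ hK1) hs0.le
    have h3 := mul_le_mul_of_nonneg_left h2 (show 0 ≤ Λ * ν by positivity)
    linarith
  have R : Regime θ α β Γ p₀ Λ (p 0) I ε η ησ :=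
    { d_pos := hd
      K_pos := hθ.K_pos
      one_le_α := hα
      one_le_β := hβ
      one_le_Γ := hΓ1
      p_pos := hp
      Λ_nonneg := hΛ0.le
      I_nonneg := hI0.le
      ε_pos := hε
      symm := hθ.symm
      B_lower := hθ.B_lower hγ
      B_upper := hθ.B_upper hγ
      B_le := hB
      p₀_lt := hp₀
      nodes_lower := fun m k => (hθ.node_balance m k).1
      nodes_upper := fun m k => (hθ.node_balance m k).2
      layers_lower := fun i m => hθ.layers_lower hα (by linarith) i m
      I_le := hIs
      η'_nonneg := hησ0
      η'_le := (le_max_left _ _).trans hηmax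
      η_le := by
        rw [← hs, hηs]
        apply mul_le_mul_of_nonneg_right _ hI0.le
        linarith
      small_count := s₁
      small_ratio := by linarith
      small_noise := s₃ }
  have hn1 : 7 ≤ Real.log n := (Real.le_log_iff_exp_le hn0).2 hn7
  set Q := I + Real.log (8 * (K : ℝ) ^ 2) with hQ
  have hQle : Q ≤ 4 * ν * (n * I / (K : ℝ) ^ 2) := by
    have hKn' : (K : ℝ) ^ 2 ≤ n := by
      have h1 : (K : ℝ) ^ 2 * 1 ≤ (K : ℝ) ^ 2 * Real.log n :=
        mul_le_mul_of_nonneg_left (by linarith) (by positivity)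
      have h2 := mul_le_mul_of_nonneg_right c₈ hn0.le
      linarith
    have h1 : Real.log (8 * (K : ℝ) ^ 2) ≤ 2 * Real.log n := by
      rw [Real.log_mul (by norm_num) (by positivity)]
      have h2 := Real.log_le_sub_one_of_pos (show (0 : ℝ) < 8 by norm_num)
      have h3 := Real.log_le_log (by positivity) hKn'
      linarith
    have h2 : I * Real.log n ≤ ν * (n * I / (K : ℝ) ^ 2) := by
      rw [← mul_div_assoc, le_div_iff₀ (by positivity)]
      have := mul_le_mul_of_nonneg_left hKn hI0.le
      linarith
    have h3 : I + 2 * Real.log n ≤ 3 * (I * Real.log n) := by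
      have e1 := mul_le_mul_of_nonneg_left (show 1 ≤ Real.log n by linarith) hI0.le
      have e2 := mul_le_mul_of_nonneg_right hI1 (show 0 ≤ Real.log n by linarith)
      linarith
    have h4 : 0 < ν * (n * I / (K : ℝ) ^ 2) := by positivity
    linarith
  obtain ⟨h₀, h₁, h₂, h₃⟩ := typicality_conditions hα hβ hΓ1 hΛ0 hn0 hd0 hK1 hs0 hε hν hIs hI1 hIΛ
    hIε hη hησ0 ((le_max_left _ _).trans hηmax) hent hQle c₁ c₂ c₃ c₄ c₅ c₆
  have hηle1 : η ≤ 1 := (hη1.trans c₅).trans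
    (Real.exp_le_one_iff.2 (by have : 0 ≤ 8 * β ^ 2 * Γ / ε := by positivity
                               linarith))
  have hT : ∀ i, μ.real {w | ¬ Typical θ i (fun j => X j w) (p 0) I ε η ησ} ≤ Real.exp (-I) := by
    intro i
    refine (measureReal_not_typical_le hX R i hη0 hηle1 h₀ h₁ h₂ h₃).trans_eq ?_
    have hpos : (0 : ℝ) < 8 * (K : ℝ) ^ 2 := by positivity
    rw [hQ, neg_add, Real.exp_add, Real.exp_neg (Real.log _), Real.exp_log hpos]
    field_simp
  have hbal : ∀ m, 4 * (η * n) + 4 < (Finset.univ.filter fun j => θ.z j = m).card := by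
    intro m
    refine lt_of_lt_of_le ?_ (hθ.layer_balance m).1
    have hα0 : 0 < α := by linarith
    rw [lt_div_iff₀ (by positivity)]
    have e1 := mul_le_mul_of_nonneg_left (hη1) hα0.le
    have e2 : 16 * (α * η) ≤ 1 := by linarith
    have e3 := mul_le_mul_of_nonneg_right e2 hn0.le
    linarith
  refine (setIntegral_misclust_le (by exact_mod_cast hn0) hX R hI hC0 hC hU hUX hInit
    ((le_max_right _ _).trans hηmax) hbal hzhat hout hT).trans ?_
  refine add_le_add le_rfl (Real.exp_le_exp.2 (mul_le_mul_of_nonneg_right ?_ (by linarith)))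
  linarith

/-! ### Asymptotics -/

lemma mul_sq_le_rescaled_mul {n d : ℕ} (hn : 0 < n) {p : ℝ} (hp : 0 ≤ p) :
    p * (d : ℝ) ^ 2 ≤ rescaled n d p * (1 + (d : ℝ) / n) := by
  have hn' : (0 : ℝ) < n := by exact_mod_cast hn
  have h : (d : ℝ) ≤ ((min n d : ℕ) : ℝ) * (1 + (d : ℝ) / n) := by
    rcases le_total n d with h | h
    · rw [min_eq_left h, mul_add, mul_div_cancel₀ _ hn'.ne']
      linarith
    · rw [min_eq_right h]
      exact le_mul_of_one_le_right (by positivity) (by linarith [show 0 ≤ (d : ℝ) / n by positivity])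
  have := mul_le_mul_of_nonneg_left h (show 0 ≤ p * d by positivity)
  rw [rescaled]
  linarith

/-- The two conditions on the initialization, in terms of `p d²` instead of `a (1 + d / n)`. -/
lemma init_conditions {n d K : ℕ} {p A I ν Λ η η' : ℝ} (hn : 0 < n) (hd : 0 < d) (hK : 0 < K)
    (hp : 0 < p) (hA : rescaled n d p ≤ A) (hI : 0 ≤ I) (hIΛ : I ≤ Λ * (p * (d : ℝ) ^ 2))
    (hν : 0 ≤ ν)
    (hη : |η| ≤ ν * |I / (A * (K : ℝ) ^ 2 * (1 + (d : ℝ) / n))|)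
    (hη' : |η' * Real.log (1 / η')| ≤
      ν * |I ^ 2 / (A * (K : ℝ) ^ 2 * (1 + (d : ℝ) / n) ^ 2)|) :
    η ≤ ν * (I / (p * (d : ℝ) ^ 2 * (K : ℝ) ^ 2)) ∧
    d * (η' * Real.log (1 / η')) ≤ ν * (Λ * (n * I / (K : ℝ) ^ 2)) := by
  have hn' : (0 : ℝ) < n := by exact_mod_cast hn
  have hd' : (0 : ℝ) < d := by exact_mod_cast hd
  have hK' : (0 : ℝ) < K := by exact_mod_cast hK
  set u := 1 + (d : ℝ) / n with hu
  have hu0 : 0 < u := by positivity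
  have hs0 : 0 < p * (d : ℝ) ^ 2 := by positivity
  have hsA : p * (d : ℝ) ^ 2 ≤ A * u :=
    (mul_sq_le_rescaled_mul hn hp.le).trans (mul_le_mul_of_nonneg_right hA hu0.le)
  have hAu : 0 < A * u := hs0.trans_le hsA
  have hA0 : 0 < A := pos_of_mul_pos_left hAu hu0.le
  have hdu : (d : ℝ) ≤ n * u := by
    rw [hu, mul_add, mul_div_cancel₀ _ hn'.ne']
    linarith
  rw [abs_of_nonneg (a := I / _) (by positivity)] at hη
  rw [abs_of_nonneg (a := I ^ 2 / _) (by positivity)] at hη'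
  constructor
  · refine (le_abs_self _).trans (hη.trans ?_)
    refine mul_le_mul_of_nonneg_left (div_le_div_of_nonneg_left hI (by positivity) ?_) hν
    calc p * (d : ℝ) ^ 2 * (K : ℝ) ^ 2 ≤ A * u * (K : ℝ) ^ 2 :=
          mul_le_mul_of_nonneg_right hsA (by positivity)
      _ = _ := by ring
  · have h1 := mul_le_mul_of_nonneg_left ((le_abs_self _).trans hη') hd'.le
    refine h1.trans ?_
    have h2 : I / (A * u) ≤ Λ := by
      rw [div_le_iff₀ hAu]
      by_cases hΛ : 0 ≤ Λ
      · exact hIΛ.trans (mul_le_mul_of_nonneg_left hsA hΛ)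
      · have := mul_neg_of_neg_of_pos (not_le.1 hΛ) hs0
        linarith
    calc (d : ℝ) * (ν * (I ^ 2 / (A * (K : ℝ) ^ 2 * u ^ 2)))
        = ν * ((I / (A * u)) * ((d / u) * I / (K : ℝ) ^ 2)) := by field_simp
      _ ≤ ν * (Λ * ((d / u) * I / (K : ℝ) ^ 2)) := by gcongr
      _ ≤ ν * (Λ * (n * I / (K : ℝ) ^ 2)) := by
          have hΛ : 0 ≤ Λ := le_trans (by positivity) h2
          gcongr
          rw [div_le_iff₀ hu0]
          exact hdu

end

theorem theorem2
    -- absolute constants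
    (α β γ C₁ C₂ a₀ p₀ : ℝ) (hα : 1 ≤ α) (hβ : 1 ≤ β) (hγ : 1 ≤ γ)
    (hC₁ : 0 < C₁) (hC₂ : 0 < C₂) (ha₀ : 0 < a₀) (hp₀ : p₀ < 1)
    -- a sequence of models with `n` layers, `d` nodes and `K` communities
    (n d K : ℕ → ℕ) (hn : Tendsto n atTop atTop) (hd : Tendsto d atTop atTop)
    (θ : ∀ t, MMSBM (n t) (d t) (K t)) (p q : ℕ → Fin 2 → ℝ)
    (hθ : ∀ t, (θ t).InParameterSpace (p t) (q t) α β γ)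
    (hsparse : ∀ t m k l, (θ t).B m k l ≤ p₀)
    -- the observed networks, an independent seed, and the initialization algorithm
    {Ω S : ℕ → Type*} [∀ t, MeasurableSpace (Ω t)] [∀ t, MeasurableSpace (S t)]
    (μ : ∀ t, Measure (Ω t)) [∀ t, IsProbabilityMeasure (μ t)]
    (X : ∀ t, Fin (n t) → Ω t → Network (d t)) (hX : ∀ t, (θ t).IsSample (μ t) (X t))
    (U : ∀ t, Ω t → S t) (hU : ∀ t, Measurable (U t))
    (hUX : ∀ t, IndepFun (U t) (fun w i => X t i w) (μ t))
    (Init : ∀ t, InitAlgorithm (n t) (d t) (K t) (S t))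
    (hInit : ∀ t i, Measurable fun y : ({j : Fin (n t) // j ≠ i} → Network (d t)) × S t =>
      Init t i y.1 y.2)
    (o : ∀ t, Ω t → ∀ i, InitOutput (n t) (d t) (K t) i)
    (ho : ∀ t w i, o t w i = Init t i (fun j => X t j w) (U t w))
    -- the event that all leave-one-out initializations are accurate
    (ηz ησ : ℕ → ℝ) (G : ∀ t, Set (Ω t))
    (hG : ∀ t, G t = {w | ∀ i, InitGood (θ t) (ηz t) (ησ t) (o t w i)})
    (hGprob : ∀ t, 1 - C₁ / (n t : ℝ) ^ 2 ≤ (μ t).real (G t))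
    -- rescaled probabilities, their maximum over the components, and the separation strength
    (a b : ℕ → Fin 2 → ℝ) (ha : ∀ t m, a t m = rescaled (n t) (d t) (p t m))
    (hb : ∀ t m, b t m = rescaled (n t) (d t) (q t m))
    (abar : ℕ → ℝ) (habar : ∀ t, abar t = max (a t 0) (a t 1))
    (I : ℕ → ℝ) (hI : ∀ t, I t = (θ t).separation)
    -- conditions
    (hησ : ∀ t, ησ t ≤ C₂ * min ((a t 0 - b t 0) / (a t 0 * K t)) ((a t 1 - b t 1) / (a t 1 * K t)))
    (hησlog : (fun t => ησ t * Real.log (1 / ησ t)) =o[atTop]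
      fun t => I t ^ 2 / (abar t * (K t : ℝ) ^ 2 * (1 + (d t : ℝ) / n t) ^ 2))
    (hη : (fun t => max (ησ t) (ηz t)) =o[atTop]
      fun t => I t / (abar t * (K t : ℝ) ^ 2 * (1 + (d t : ℝ) / n t)))
    (ha_lower : ∀ t, a₀ ≤ min (a t 0) (a t 1))
    (hK : (fun t => (K t : ℝ) ^ 2 * Real.log (n t)) =o[atTop] fun t => (n t : ℝ))
    (hItop : Tendsto I atTop atTop)
    -- the output of the algorithm
    (zhat : ∀ t, Ω t → Fin (n t) → Fin 2) (hzhat : ∀ t, Measurable (zhat t))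
    (hout : ∀ t w, IsTwoStageOutput (fun i => X t i w) (o t w) (zhat t w)) :
    ∃ ρ : ℕ → ℝ, Tendsto ρ atTop (𝓝 0) ∧
      -- with high probability, conditionally on the accuracy of the initialization
      (∀ ε ∈ Set.Ioo (0 : ℝ) 1, ∀ᶠ t in atTop,
        1 - Real.exp (-(I t) ^ (1 - ε)) ≤ ((μ t)[|G t]).real
          {w | misclust (zhat t w) (θ t).z ≤ Real.exp (-(1 - ρ t) * (I t / 2))}) ∧
      -- in expectation, conditionally on the accuracy of the initialization
      (∀ C' : ℝ, 0 < C' → ∃ M : ℝ, ∀ᶠ t in atTop,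
        ∫ w, misclust (zhat t w) (θ t).z ∂((μ t)[|G t]) ≤
          Real.exp (-(1 - ρ t) * (I t / 2)) + M * (n t : ℝ) ^ (-C')) ∧
      -- in expectation, unconditionally
      (∃ M : ℝ, ∀ᶠ t in atTop,
        ∫ w, misclust (zhat t w) (θ t).z ∂(μ t) ≤
          Real.exp (-(1 - ρ t) * (I t / 2)) + M * (n t : ℝ) ^ (-2 : ℝ)) := by
  have hGm : ∀ t, MeasurableSet (G t) := fun t => by
    have := measurableSet_initGood (hX t) (hU t) (hInit t) (ηz t) (ησ t)
    rw [hG]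
    simpa only [ho] using this
  have hnR : Tendsto (fun t => (n t : ℝ)) atTop atTop := tendsto_natCast_atTop_atTop.comp hn
  have hGhalf : ∀ᶠ t in atTop, 1 / 2 ≤ (μ t).real (G t) := by
    filter_upwards [hnR.eventually_ge_atTop (2 * C₁ + 1)] with t ht
    have h1 : (1 : ℝ) ≤ n t := by linarith
    have h2 : C₁ / (n t : ℝ) ^ 2 ≤ 1 / 2 := by
      rw [div_le_iff₀ (by positivity)]
      have := le_self_pow₀ h1 two_ne_zero
      linarith
    linarith [hGprob t]
  set J : ℕ → ℝ := fun t => ∫ w in G t, misclust (zhat t w) (θ t).z ∂(μ t) with hJ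
  have hJ0 : ∀ t, 0 ≤ J t := fun t => integral_nonneg fun w => misclust_nonneg _ _
  have hmain : ∀ ε₀ > 0, ∀ᶠ t in atTop,
      J t ≤ Real.exp (-I t) + Real.exp (-(1 - ε₀) * (I t / 2)) := by
    intro ε₀ hε₀
    obtain ⟨ν, hν, N, hbound⟩ := exists_setIntegral_misclust_le hα hβ hγ hp₀ hε₀
    filter_upwards [hGhalf, hησlog.def hν, hη.def hν, hK.def hν, hItop.eventually_ge_atTop N,
      hItop.eventually_ge_atTop 0, hnR.eventually_ge_atTop N, hnR.eventually_ge_atTop 1,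
      hd.eventually_gt_atTop 0] with t hGt h1 h2 h3 hIN hI0 hnN hn1 hd0
    have hn0 : 0 < n t := by exact_mod_cast (zero_lt_one.trans_le hn1)
    have hp := (hθ t).p_pos 0
    have hrA : rescaled (n t) (d t) (p t 0) ≤ abar t := by
      rw [habar, ha]
      exact le_max_left _ _
    have hIs := (hθ t).separation_le hγ hp₀ (hsparse t)
    rw [← hI] at hIs
    obtain ⟨k₁, k₂⟩ := init_conditions hn0 hd0 (hθ t).K_pos hp hrA hI0 hIs hν.le h2 h1
    have hησ0 : 0 ≤ ησ t := by
      have hne : (G t).Nonempty := by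
        by_contra h
        rw [Set.not_nonempty_iff_eq_empty] at h
        rw [h] at hGt
        norm_num at hGt
      obtain ⟨w, hw⟩ := hne
      rw [hG] at hw
      obtain ⟨π, -, h⟩ := hw ⟨0, hn0⟩
      exact (misclust_nonneg _ _).trans (h 0)
    have hKn : (K t : ℝ) ^ 2 * Real.log (n t) ≤ ν * n t := by
      have := (le_abs_self _).trans h3
      rwa [Real.norm_natCast] at this
    have := hbound (n t) (d t) (K t) (θ t) (p t) (q t) (Ω t) (S t) (μ t) (X t) (U t) (Init t) (I t)
      (ηz t) (ησ t) (zhat t) (hθ t) (hsparse t) (hX t) (hU t) (hUX t) (hInit t) (hzhat t)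
      (fun w => by
        have h := hout t w
        rwa [show o t w = fun i => Init t i (fun j => X t j w) (U t w) from funext (ho t w)] at h)
      (hI t) hd0 hnN hIN hKn hησ0 k₁ k₂
    simp only [hJ, hG, ho]
    exact this
  -- A bound for the conditional error; the second term makes it positive, so that the exponent
  -- `ρ₀` can be read off its logarithm.
  set e : ℕ → ℝ := fun t => 2 * J t + Real.exp (-I t) with he
  have he0 : ∀ t, 0 < e t := fun t => by
    have := hJ0 t
    have := Real.exp_pos (-I t)
    simp only [he]
    linarith
  have hesmall : ∀ ε₀ > 0, ∀ᶠ t in atTop, e t ≤ Real.exp (-(1 - ε₀) * (I t / 2)) := by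
    intro ε₀ hε₀
    filter_upwards [hmain (ε₀ / 2) (by linarith), hItop.eventually_ge_atTop (16 / ε₀),
      hItop.eventually_ge_atTop 0] with t h1 h2 h3
    rw [div_le_iff₀ hε₀] at h2
    have h4 : Real.exp (-I t) ≤ Real.exp (-(1 - ε₀ / 2) * (I t / 2)) := by
      apply Real.exp_le_exp.2
      have := mul_nonneg hε₀.le h3
      linarith
    have h5 : Real.exp (-(1 - ε₀) * (I t / 2)) =
        Real.exp (-(1 - ε₀ / 2) * (I t / 2)) * Real.exp (ε₀ * I t / 4) := by
      rw [← Real.exp_add]; ring_nf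
    have h6 : 5 ≤ Real.exp (ε₀ * I t / 4) := by
      have := Real.add_one_le_exp (ε₀ * I t / 4)
      linarith
    rw [h5]
    have h7 := mul_le_mul_of_nonneg_left h6 (Real.exp_pos (-(1 - ε₀ / 2) * (I t / 2))).le
    simp only [he]
    linarith
  set ρ₀ : ℕ → ℝ := fun t => max 0 (1 + 2 * Real.log (e t) / I t) with hρ₀
  have hρ₀lim : Tendsto ρ₀ atTop (𝓝 0) := by
    refine tendsto_order.2 ⟨fun c hc => Eventually.of_forall fun t =>
      hc.trans_le (le_max_left _ _), fun c hc => ?_⟩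
    filter_upwards [hesmall (c / 2) (by linarith), hItop.eventually_gt_atTop 0] with t h1 h2
    have h3 := (Real.log_le_iff_le_exp (he0 t)).2 h1
    refine max_lt hc ?_
    have h4 : 2 * Real.log (e t) / I t ≤ -(1 - c / 2) := by
      rw [div_le_iff₀ h2]
      linarith
    linarith
  have heρ₀ : ∀ᶠ t in atTop, e t ≤ Real.exp (-(1 - ρ₀ t) * (I t / 2)) := by
    filter_upwards [hItop.eventually_gt_atTop 0] with t h
    rw [← Real.log_le_iff_le_exp (he0 t)]
    have h1 : 1 + 2 * Real.log (e t) / I t ≤ ρ₀ t := le_max_right _ _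
    have h2 := mul_le_mul_of_nonneg_right h1 (show 0 ≤ I t / 2 by linarith)
    have h3 : 2 * Real.log (e t) / I t * (I t / 2) = Real.log (e t) := by field_simp
    linarith
  have hlogI : Tendsto (fun t => Real.log (I t)) atTop atTop := Real.tendsto_log_atTop.comp hItop
  -- The term `2 / log I` leaves room for Markov's inequality, for every `ε` at once.
  have heρ : ∀ᶠ t in atTop, e t ≤ Real.exp (-(1 - (ρ₀ t + 2 / Real.log (I t))) * (I t / 2)) := by
    filter_upwards [heρ₀, hlogI.eventually_gt_atTop 0, hItop.eventually_gt_atTop 0] with t h1 h2 h3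
    refine h1.trans (Real.exp_le_exp.2 (mul_le_mul_of_nonneg_right ?_ (by linarith)))
    have : 0 < 2 / Real.log (I t) := by positivity
    linarith
  have hcond : ∀ᶠ t in atTop,
      ∫ w, misclust (zhat t w) (θ t).z ∂((μ t)[|G t]) ≤ e t := by
    filter_upwards [hGhalf] with t ht
    rw [ProbabilityTheory.cond, integral_smul_measure, ENNReal.toReal_inv, smul_eq_mul,
      ← measureReal_def]
    have h1 : ((μ t).real (G t))⁻¹ ≤ 2 := by
      rw [inv_le_comm₀ (by linarith) (by norm_num)]
      linarith
    have h2 := mul_le_mul_of_nonneg_right h1 (hJ0 t)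
    have h3 := Real.exp_pos (-I t)
    simp only [he]
    linarith
  have hint : ∀ t (m : Measure (Ω t)) [IsProbabilityMeasure m],
      Integrable (fun w => misclust (zhat t w) (θ t).z) m := fun t m _ =>
    integrable_comp_of_finite (hzhat t) fun z => misclust z (θ t).z
  refine ⟨fun t => ρ₀ t + 2 / Real.log (I t), ?_, ?_, ?_, ?_⟩
  · simpa using hρ₀lim.add (hlogI.const_div_atTop 2)
  · intro ε hε
    have hlog : ∀ᶠ t in atTop, Real.log (I t) ≤ I t ^ ε := by
      have := (isLittleO_log_rpow_atTop hε.1).comp_tendsto hItop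
      filter_upwards [this.def one_pos, hItop.eventually_ge_atTop 0] with t h1 h2
      simp only [Function.comp_apply, one_mul, Real.norm_eq_abs] at h1
      rw [abs_of_nonneg (Real.rpow_nonneg h2 _)] at h1
      exact (le_abs_self _).trans h1
    filter_upwards [hcond, heρ₀, hGhalf, hlog, hItop.eventually_gt_atTop 0,
      hlogI.eventually_gt_atTop 0] with t h1 h2 h3 h4 h5 h6
    have hprob : IsProbabilityMeasure ((μ t)[|G t]) := by
      apply cond_isProbabilityMeasure
      intro h
      rw [measureReal_def, h] at h3
      norm_num at h3
    set v := Real.exp (-(1 - (ρ₀ t + 2 / Real.log (I t))) * (I t / 2)) with hv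
    have hmarkov := mul_meas_ge_le_integral_of_nonneg (μ := (μ t)[|G t])
      (ae_of_all _ fun w => misclust_nonneg (zhat t w) (θ t).z) (hint t _) v
    have hv0 : 0 < v := Real.exp_pos _
    have hbad : ((μ t)[|G t]).real {w | v ≤ misclust (zhat t w) (θ t).z} ≤
        Real.exp (-(I t) ^ (1 - ε)) := by
      have h7 : Real.exp (-(1 - ρ₀ t) * (I t / 2)) = v * Real.exp (-(I t / Real.log (I t))) := by
        rw [hv, ← Real.exp_add]
        congr 1
        field_simp
        ring
      have h8 : I t ^ (1 - ε) ≤ I t / Real.log (I t) := by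
        rw [Real.rpow_sub h5, Real.rpow_one]
        gcongr
      have h9 : v * ((μ t)[|G t]).real {w | v ≤ misclust (zhat t w) (θ t).z} ≤
          v * Real.exp (-(I t / Real.log (I t))) := by
        rw [← h7]
        exact hmarkov.trans (h1.trans h2)
      exact (le_of_mul_le_mul_left h9 hv0).trans (Real.exp_le_exp.2 (by linarith))
    have hcompl : {w | misclust (zhat t w) (θ t).z ≤ v}ᶜ ⊆
        {w | v ≤ misclust (zhat t w) (θ t).z} := fun w hw =>
      (not_le.1 (show ¬ misclust (zhat t w) (θ t).z ≤ v from hw)).le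
    have hm : MeasurableSet {w | misclust (zhat t w) (θ t).z ≤ v} :=
      hzhat t (Set.toFinite {z | misclust z (θ t).z ≤ v}).measurableSet
    have h8 := measureReal_mono (μ := (μ t)[|G t]) hcompl (measure_ne_top _ _)
    rw [probReal_compl_eq_one_sub hm] at h8
    linarith
  · intro C' _
    refine ⟨0, ?_⟩
    filter_upwards [hcond, heρ] with t h1 h2
    linarith
  · refine ⟨C₁, ?_⟩
    filter_upwards [heρ] with t h1
    have h2 := integral_add_compl (hGm t) (hint t (μ t))
    have h3 : ∫ w in (G t)ᶜ, misclust (zhat t w) (θ t).z ∂(μ t) ≤ (μ t).real (G t)ᶜ := by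
      have := setIntegral_mono_on (μ := μ t) (s := (G t)ᶜ) (hint t (μ t)).integrableOn
        (integrable_const (1 : ℝ)).integrableOn (hGm t).compl
        fun w _ => misclust_le_one (zhat t w) (θ t).z
      rwa [setIntegral_const, smul_eq_mul, mul_one] at this
    rw [probReal_compl_eq_one_sub (hGm t)] at h3
    have h4 : (n t : ℝ) ^ (-2 : ℝ) = 1 / (n t : ℝ) ^ 2 := by
      rw [Real.rpow_neg (Nat.cast_nonneg _), one_div]
      norm_cast
    have h5 := hGprob t
    have h6 : e t = 2 * J t + Real.exp (-I t) := rfl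
    have h7 : J t = ∫ w in G t, misclust (zhat t w) (θ t).z ∂(μ t) := rfl
    rw [h4, mul_one_div]
    linarith [hJ0 t, Real.exp_pos (-I t)]
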